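/- **Setting.** Let $M$ be a smooth manifold (finite-dimensional, Hausdorff, second countable), $\mathbb{T}M=TM\oplus T^*M$ with the inner product $\langle X+\alpha,Y+\beta\rangle=\frac12(\alpha(Y)+\beta(X))$ and the Dorfman bracket $[X+\alpha,Y+\beta]=[X,Y]+\mathcal L_X\beta-\iota_Yd\alpha$ (extended complex-bilinearly to $\mathbb TM\otimes\mathbb C$). Write $\mathbb{L}_{\mathbf x}\mathbf y=[\mathbf x,\mathbf y]$, and for a real space $V$ of sections and a set $S$ of sections let $\mathbb L_V(S)$ be the real span of all $[\mathbf v,\mathbf x]$, $\mathbf v\in V$, $\mathbf x\in S$. For a subbundle $E$, or a set $S$ of sections, $\mathbb I(E)$, $\mathbb I(S)$ denote the sections $\mathbf x$ with $\mathbb L_{\mathbf x}\Gamma(E)\subseteq\Gamma(E)$, resp. $\mathbb L_{\mathbf x}S\subseteq S$; $\mathbb I_U$ is the same notion over an open set $U$. A *split structure* $E\in\mathbb E_k(M)$ is a subbundle $E\subseteq\mathbb TM$ of rank $2k$ on which the inner product has signature $(k,k)$. A *framing* of a bundle $E$ (over $U$) is a real vector space $V$ of sections of $E$ (over $U$) with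 $\dim V={\rm rank}\,E$ that spans $E$ at every point. A *split framing* $(V,W)$ of $E$ consists of isotropic $V,W$ with $V\oplus W$ a framing of $E$. $J\in{\rm SGF}(E)$ means that $E$ is a split structure and $J$ is a skew-symmetric orthogonal bundle endomorphism of $E$; put $L_J=\{\mathbf x-\sqrt{-1}J\mathbf x \mid \mathbf x\in E\}\subseteq E\otimes\mathbb C$ and $\mathbb I(J)=\mathbb I(\Gamma(L_J))$. $J\in{\rm CRF}(E)$ means that moreover $\Gamma(L_J)$ is closed under the Dorfman bracket. If $E\perp E'$ are split structures, $J\in {\rm CRF}(E)$ and $V$ is a framing of $E'$, then $(J,V)$ is a *normal pair* if $V\subseteq\mathbb I(J)\cap\mathbb I(E')$. **Contact data.** Let $E$ be a split structure, $E'\in\mathbb E_k(M)$ with $E\perp E'$, $L\subseteq E$ a maximal isotropic subbundle, $(V,W)$ a split framing of $E'$. Then $(L,V,W)$ is a *rank $k$ contact datum* for $(E,E')$ if (1) $V\subseteq\mathbb I(E)$; (2) $\Gamma(L\oplus{\rm span}(W))$ is closed under the Dorfman bracket; (3) $[V\oplus W,V\oplus W]=0$; (4) $\mathbb L_W(\Gamma(L))\subseteq\Gamma(L)$;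 (5) $\Gamma(E)=\Gamma(L)+\mathbb L_V(\Gamma(L))$. For $k=1$ and $J\in{\rm SGF}(E)$ (extended by $0$ to $E^\perp$), $(J,L,V)$, with $W$ understood, is a *normal contact datum* for $(E,E')$ if $(L,V,W)$ is a rank $1$ contact datum, the sum in (5) is direct, $J(L\oplus{\rm span}(W))\subseteq L\oplus{\rm span}(W)$, and $(J,V\oplus W)$ is a normal pair. **Bicontact data.** Let $E$ be a split structure and $E_1',E_2'\in\mathbb E_1(M)$, mutually orthogonal, let $L\subseteq E$ be maximal isotropic, and let $(V_i,W_i)$ be a split framing of $E_i'$, $i=1,2$. Let $L_1=\ker(\mathbb L_{V_2})\cap L$, i.e. the fibre of $L_1$ at $p$ is spanned by the values at $p$ of the sections of $L$ near $p$ annihilated by $\mathbb L_{V_2}$, and similarly $L_2=\ker(\mathbb L_{V_1})\cap L$. A local framing of $L_1$ (resp. $L_2$) over $U$ is understood to be a framing consisting of sections of $L$ over $U$ annihilated by $\mathbb L_{V_2}$ (resp. $\mathbb L_{V_1}$). Then $(L,V_1,V_2)$ is a *bicontact datum* if (1) $(L,V_1\oplus V_2,W_1\oplus W_2)$ is a rank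 $2$ contact datum for $(E,E_1'\oplus E_2')$; (2) $L_1,L_2$ are subbundles and $L=L_1\oplus L_2$; (3) around each point there are local framings $K_i\subseteq\mathbb I_U(E\oplus E_1'\oplus E_2')$ of $L_i$ over a neighbourhood $U$, $i=1,2$, with $[K_1,K_2]=0$. Put $E_i=L_i\oplus\mathbb L_{V_i}(L_i)$, meaning that the fibre of $E_i$ at $p$ is spanned by the values at $p$ of $\Gamma(L_i)$ and of $\mathbb L_{V_i}(\Gamma(L_i))$; also put $E_i''=E_i\oplus E_i'$ and $E''=E_1''\oplus E_2''$. For $J\in{\rm CRF}(E'')$, $(J,L,V_1,V_2)$ is a *Hermitian bicontact datum* if in addition $V_1\oplus W_1\subseteq\mathbb I(J)$, $J(V_1)=V_2$, $J(W_1)=W_2$ and $J$ preserves $L\oplus{\rm span}(W_1\oplus W_2)$. It is *adaptable* if around each point there are local framings $K_i\subseteq\mathbb I_U(E'')$ of $L_i$ over a neighbourhood $U$, $i=1,2$, with $[K_1,K_2]=0$ and $d\langle J\mathbf x,\mathbb L_{\mathbf v}\mathbf y\rangle\in\Gamma_U(E_i'')$ for all $\mathbf x,\mathbf y\in K_i$,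 $\mathbf v\in V_i$, $i=1,2$. **Theorem (Abstract Blair-Ludden-Yano Theorem).** Let $(J,L,V_1,V_2)$ be an adaptable Hermitian bicontact datum for $(E,E_1',E_2')$, and let $J_1,J_2,\Psi$ be the restrictions of $J$ to $E_1$, $E_2$ and $E_1'\oplus E_2'$ (the endomorphisms occurring in the corresponding Morimoto datum $(J_1,J_2,V_1\oplus W_1,V_2\oplus W_2,\Psi)$). Then $J_1\in{\rm SGF}(E_1)$, $J_2\in{\rm SGF}(E_2)$, $\Psi\in{\rm SGF}(E_1'\oplus E_2')$ (in particular $J$ preserves these bundles), and $(J_1,L_1,V_1)$ and $(J_2,L_2,V_2)$ are normal contact data for $(E_1,E_1')$ and $(E_2,E_2')$ respectively. -/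

import Mathlib

open scoped Manifold ContDiff Topology

noncomputable section

namespace GenGeom

section Basic

variable (F : Type*) [NormedAddCommGroup F] [NormedSpace ℝ F]
variable (M : Type*) [TopologicalSpace M] [ChartedSpace F M]

variable {M} in
/-- The fibre `T_pM ⊕ T_p^*M` of the generalized tangent bundle at `p`. -/
abbrev GenTangent (p : M) : Type _ :=
  TangentSpace 𝓘(ℝ, F) p × (TangentSpace 𝓘(ℝ, F) p →L[ℝ] ℝ)

/-- Set-theoretic sections `X + α` of the generalized tangent bundle. -/
abbrev GenField : Type _ := (p : M) → GenTangent F p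

/-- Families of linear subspaces of the fibres of the generalized tangent bundle. -/
abbrev FibreFamily : Type _ := (p : M) → Submodule ℝ (GenTangent F p)

/-- Families of linear endomorphisms of the fibres of the generalized tangent bundle. -/
abbrev EndFamily : Type _ := (p : M) → GenTangent F p →ₗ[ℝ] GenTangent F p

/-- Complex sections `a + √-1 b` of the complexified generalized tangent bundle, written as pairs
`(a, b)` of real sections. -/
abbrev CGenField : Type _ := GenField F M × GenField F M

end Basic

section Defs

variable {F : Type*} [NormedAddCommGroup F] [NormedSpace ℝ F]
variable {M : Type*} [TopologicalSpace M] [ChartedSpace F M]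

/-- The tautological inner product `⟨X + α, Y + β⟩ = (α(Y) + β(X)) / 2` at `p`. -/
def pairing (p : M) : LinearMap.BilinForm ℝ (GenTangent F p) :=
  LinearMap.mk₂ ℝ (fun x y => (1 / 2 : ℝ) * (x.2 y.1 + y.2 x.1))
    (fun x x' y => by simp; ring) (fun c x y => by simp; ring)
    (fun x y y' => by simp; ring) (fun c x y => by simp; ring)

/-! ### The Dorfman bracket -/

/-- The local representative, in the preferred chart at `p`, of a 1-form `α`. -/
def formInChart (α : (q : M) → TangentSpace 𝓘(ℝ, F) q →L[ℝ] ℝ) (p : M) : F → (F →L[ℝ] ℝ) :=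
  fun y => (α ((extChartAt 𝓘(ℝ, F) p).symm y)).comp
    (mfderiv 𝓘(ℝ, F) 𝓘(ℝ, F) (extChartAt 𝓘(ℝ, F) p).symm y)

/-- The differential of the chart at `p`, at the point `p`. -/
def chartDeriv (p : M) : TangentSpace 𝓘(ℝ, F) p →L[ℝ] F :=
  mfderiv 𝓘(ℝ, F) 𝓘(ℝ, F) (extChartAt 𝓘(ℝ, F) p) p

/-- `ι_v (dα)_p`, where `dα` is the exterior derivative of the 1-form `α`:
in the chart at `p`, `dα(v, w) = (Dα v) w - (Dα w) v`. -/
def contractExtDeriv (α : (q : M) → TangentSpace 𝓘(ℝ, F) q →L[ℝ] ℝ) (p : M)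
    (v : TangentSpace 𝓘(ℝ, F) p) : TangentSpace 𝓘(ℝ, F) p →L[ℝ] ℝ :=
  let A : F →L[ℝ] F →L[ℝ] ℝ := fderiv ℝ (formInChart α p) (extChartAt 𝓘(ℝ, F) p p)
  (A (chartDeriv p v) - A.flip (chartDeriv p v)).comp (chartDeriv p)

/-- The differential of a function at `p`. -/
def funDeriv (f : M → ℝ) (p : M) : TangentSpace 𝓘(ℝ, F) p →L[ℝ] ℝ :=
  mfderiv 𝓘(ℝ, F) 𝓘(ℝ, ℝ) f p

/-- The Dorfman bracket `[X + α, Y + β] = [X, Y] + 𝓛_X β - ι_Y dα`, where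
`𝓛_X β = ι_X dβ + d(β(X))`. -/
def dorfman (x y : GenField F M) : GenField F M := fun p =>
  (VectorField.mlieBracket 𝓘(ℝ, F) (fun q => (x q).1) (fun q => (y q).1) p,
    contractExtDeriv (fun q => (y q).2) p (x p).1
      + funDeriv (fun q => (y q).2 (x q).1) p
      - contractExtDeriv (fun q => (x q).2) p (y p).1)

/-- The complex bilinear extension of the Dorfman bracket. -/
def cdorfman (x y : CGenField F M) : CGenField F M :=
  (dorfman x.1 y.1 - dorfman x.2 y.2, dorfman x.1 y.2 + dorfman x.2 y.1)

/-! ### Sections, subbundles, framings -/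

/-- `x = X + α` is smooth on `U`. -/
def SmoothOn [IsManifold 𝓘(ℝ, F) ∞ M] (U : Set M) (x : GenField F M) : Prop :=
  ContMDiffOn 𝓘(ℝ, F) (𝓘(ℝ, F).prod 𝓘(ℝ, F)) ∞
    (fun p => Bundle.TotalSpace.mk' F (E := fun p : M => TangentSpace 𝓘(ℝ, F) p) p (x p).1) U ∧
  ContMDiffOn 𝓘(ℝ, F) (𝓘(ℝ, F).prod 𝓘(ℝ, F →L[ℝ] ℝ)) ∞
    (fun p => Bundle.TotalSpace.mk' (F →L[ℝ] ℝ)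
      (E := fun p : M => TangentSpace 𝓘(ℝ, F) p →L[ℝ] Bundle.Trivial M ℝ p) p (x p).2) U

variable [IsManifold 𝓘(ℝ, F) ∞ M]

/-- `Γ_U(E)`: smooth sections of `E` over the open set `U`. Such a section is represented by a
function on `M` of which only the values on `U` matter. -/
def SectionsOn (U : Set M) (E : FibreFamily F M) : Set (GenField F M) :=
  {x | SmoothOn U x ∧ ∀ p ∈ U, x p ∈ E p}

/-- `Γ(E)`: global smooth sections of `E`. -/
def Sections (E : FibreFamily F M) : Set (GenField F M) := SectionsOn Set.univ E

/-- `E` is a smooth subbundle of rank `r` of the generalized tangent bundle. -/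
def IsSubbundle (r : ℕ) (E : FibreFamily F M) : Prop :=
  ∀ p : M, ∃ U : Set M, IsOpen U ∧ p ∈ U ∧ ∃ e : Fin r → GenField F M,
    (∀ i, SmoothOn U (e i)) ∧
    ∀ q ∈ U, LinearIndependent ℝ (fun i => e i q) ∧
      Submodule.span ℝ (Set.range fun i => e i q) = E q

/-- The restriction to `E p` of the quadratic form `x ↦ ⟨x, x⟩`. -/
def normForm (E : FibreFamily F M) (p : M) : QuadraticForm ℝ (E p) :=
  (pairing p).toQuadraticMap.restrict (E p)

/-- `E ∈ 𝔼_k(M)`: a split structure of rank `2k`, i.e. a subbundle of rank `2k` on which the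
tautological inner product has signature `(k, k)`. -/
def IsSplit (k : ℕ) (E : FibreFamily F M) : Prop :=
  IsSubbundle (2 * k) E ∧ ∀ p,
    sigPos (R := ℝ) (M := E p) (normForm E p) = k ∧
    sigNeg (R := ℝ) (M := E p) (normForm E p) = k

/-- `⟨E, E'⟩ = 0`. -/
def Orthogonal (E E' : FibreFamily F M) : Prop :=
  ∀ p, ∀ x ∈ E p, ∀ y ∈ E' p, pairing p x y = 0

/-- `L` is a maximal isotropic subbundle of the split structure `E`. (In signature `(k, k)`, an
isotropic subspace is maximal iff its dimension is `k`.) -/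
def IsMaxIsotropic (L E : FibreFamily F M) : Prop :=
  (∀ p, L p ≤ E p) ∧ Orthogonal L L ∧ ∃ k, IsSplit k E ∧ IsSubbundle k L

/-- The real space of sections `V` is a framing of `E` over `U`: it consists of smooth sections of
`E` over `U`, its dimension is the rank of `E`, and it spans `E` at every point of `U`. -/
def IsFramingOn (U : Set M) (E : FibreFamily F M) (V : Submodule ℝ (GenField F M)) : Prop :=
  (V : Set (GenField F M)) ⊆ SectionsOn U E ∧ FiniteDimensional ℝ V ∧
    ∀ p ∈ U, Module.finrank ℝ V = Module.finrank ℝ (E p) ∧ V.map (LinearMap.proj p) = E p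

/-- `V` is a (global) framing of `E`. -/
def IsFraming (E : FibreFamily F M) (V : Submodule ℝ (GenField F M)) : Prop :=
  IsFramingOn Set.univ E V

/-- The fibres of the bundle `span(V)` generated over `C^∞(M)` by a real space of sections `V`. -/
def spanBundle (V : Submodule ℝ (GenField F M)) : FibreFamily F M :=
  fun p => V.map (LinearMap.proj p)

/-- `(V, W)` is a split framing of `E`: `V` and `W` are isotropic and `V ⊕ W` is a framing. -/
def IsSplitFraming (E : FibreFamily F M) (V W : Submodule ℝ (GenField F M)) : Prop :=
  (∀ x ∈ V, ∀ y ∈ V, ∀ p, pairing p (x p) (y p) = 0) ∧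
  (∀ x ∈ W, ∀ y ∈ W, ∀ p, pairing p (x p) (y p) = 0) ∧
  Disjoint V W ∧ IsFraming E (V ⊔ W)

/-! ### Normalizers -/

/-- `𝕀_U(E)`: sections over `U` whose generalized Lie derivative preserves `Γ_U(E)`. -/
def normalizerOn (U : Set M) (E : FibreFamily F M) : Set (GenField F M) :=
  {x | x ∈ SectionsOn U ⊤ ∧ ∀ y ∈ SectionsOn U E, dorfman x y ∈ SectionsOn U E}

/-- `𝕀(E)`. -/
def normalizer (E : FibreFamily F M) : Set (GenField F M) := normalizerOn Set.univ E

/-- The set of complex sections normalizing a set `S` of complex sections. -/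
def cnormalizer (S : Set (CGenField F M)) : Set (CGenField F M) :=
  {x | (x.1 ∈ Sections ⊤ ∧ x.2 ∈ Sections ⊤) ∧ ∀ y ∈ S, cdorfman x y ∈ S}

/-! ### Split generalized F-structures -/

/-- The pointwise action of a family of endomorphisms on sections. -/
def EndFamily.act (J : EndFamily F M) : GenField F M →ₗ[ℝ] GenField F M :=
  LinearMap.pi fun p => (J p).comp (LinearMap.proj p)

/-- `J ∈ SGF(E)`: `E` is a split structure and `J` is a smooth, skew-symmetric and orthogonal
bundle endomorphism of `E`. An endomorphism of `E` is represented by a family `J` of endomorphisms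
of the fibres of the generalized tangent bundle of which only the restriction to `E` matters. -/
structure IsSGF (E : FibreFamily F M) (J : EndFamily F M) : Prop where
  split : ∃ k, IsSplit k E
  maps : ∀ p, ∀ x ∈ E p, J p x ∈ E p
  smooth : ∀ U : Set M, IsOpen U → ∀ x ∈ SectionsOn U E, J.act x ∈ SectionsOn U E
  skew : ∀ p, ∀ x ∈ E p, ∀ y ∈ E p, pairing p (J p x) y = - pairing p x (J p y)
  orth : ∀ p, ∀ x ∈ E p, ∀ y ∈ E p, pairing p (J p x) (J p y) = pairing p x y

/-- `J₁` is the restriction of `J` to `E` (as endomorphisms only their values on `E` matter). -/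
def IsRestriction (E : FibreFamily F M) (J₁ J : EndFamily F M) : Prop :=
  ∀ p, ∀ x ∈ E p, J₁ p x = J p x

/-- `Γ(L_J)`, where `L_J = {x - √-1 J x | x ∈ E}` is the `√-1`-eigenbundle of `J`. -/
def eigenSections (E : FibreFamily F M) (J : EndFamily F M) : Set (CGenField F M) :=
  {z | ∃ x ∈ Sections E, z = (x, - J.act x)}

/-- `J ∈ CRF(E)`: the `√-1`-eigenbundle is closed under the Dorfman bracket. -/
def IsCRF (E : FibreFamily F M) (J : EndFamily F M) : Prop :=
  IsSGF E J ∧ ∀ x ∈ eigenSections E J, ∀ y ∈ eigenSections E J, cdorfman x y ∈ eigenSections E J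

/-- The real sections in `𝕀(J) = 𝕀(L_J)`. -/
def sgfNormalizer (E : FibreFamily F M) (J : EndFamily F M) : Set (GenField F M) :=
  {v | ((v, 0) : CGenField F M) ∈ cnormalizer (eigenSections E J)}

/-- `(J, V)` is a normal pair, where `J` is a split generalized CRF-structure on `E` and `V` is a
framing of the split structure `E' ⊆ E^⊥`. -/
structure IsNormalPair (E E' : FibreFamily F M) (J : EndFamily F M)
    (V : Submodule ℝ (GenField F M)) : Prop where
  crf : IsCRF E J
  split' : ∃ k, IsSplit k E'
  orthogonal : Orthogonal E E'
  framing : IsFraming E' V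
  normalizes : (V : Set (GenField F M)) ⊆ sgfNormalizer E J ∩ normalizer E'

/-! ### Contact data -/

/-- The real space `𝕃_V(S)` spanned by the sections `[v, x]` with `v ∈ V`, `x ∈ S`. -/
def lieSpan (V : Submodule ℝ (GenField F M)) (S : Set (GenField F M)) :
    Submodule ℝ (GenField F M) :=
  Submodule.span ℝ {z | ∃ v ∈ V, ∃ x ∈ S, z = dorfman v x}

/-- `(L, V, W)` is a rank `k` contact datum for `(E, E')`. -/
structure IsContactDatum (k : ℕ) (E E' L : FibreFamily F M)
    (V W : Submodule ℝ (GenField F M)) : Prop where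
  split : ∃ l, IsSplit l E
  split' : IsSplit k E'
  orthogonal : Orthogonal E E'
  maxIsotropic : IsMaxIsotropic L E
  framing : IsSplitFraming E' V W
  normalizes : (V : Set (GenField F M)) ⊆ normalizer E
  involutive : ∀ x ∈ Sections (L ⊔ spanBundle W), ∀ y ∈ Sections (L ⊔ spanBundle W),
    dorfman x y ∈ Sections (L ⊔ spanBundle W)
  commute : ∀ x ∈ V ⊔ W, ∀ y ∈ V ⊔ W, dorfman x y = 0
  preserves : (lieSpan W (Sections L) : Set (GenField F M)) ⊆ Sections L
  generates : ∀ z : GenField F M, z ∈ Sections E ↔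
    ∃ x ∈ Sections L, ∃ y ∈ lieSpan V (Sections L), z = x + y

/-- `(J, L, V)` is a normal contact datum for `(E, E')`; here `W` is the complement of `V` in the
split framing of the rank 2 split structure `E'`. The endomorphism `J` of `E` is extended by `0` to
`E^⊥`, hence it preserves `L ⊕ span(W)` iff it maps `L` to `L ⊕ span(W)`. The field `direct` says
that the sum `Γ(E) = Γ(L) + 𝕃_V(Γ(L))` is direct. -/
structure IsNormalContactDatum (E E' : FibreFamily F M) (J : EndFamily F M) (L : FibreFamily F M)
    (V W : Submodule ℝ (GenField F M)) : Prop where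
  contact : IsContactDatum 1 E E' L V W
  direct : ∀ x ∈ Sections L, x ∈ lieSpan V (Sections L) → x = 0
  sgf : IsSGF E J
  preserves : ∀ p, ∀ x ∈ L p, J p x ∈ L p ⊔ spanBundle W p
  normal : IsNormalPair E E' J (V ⊔ W)

/-! ### Bicontact data -/

/-- `ker(𝕃_V) ∩ Γ_U(L)`. -/
def kerSections (U : Set M) (V : Submodule ℝ (GenField F M)) (L : FibreFamily F M) :
    Set (GenField F M) :=
  {x | x ∈ SectionsOn U L ∧ ∀ v ∈ V, ∀ p ∈ U, dorfman v x p = 0}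

/-- `ker(𝕃_V) ∩ L`: the fibre at `p` is spanned by the values at `p` of the sections of `L`
near `p` that are annihilated by `𝕃_V`. -/
def kerBundle (V : Submodule ℝ (GenField F M)) (L : FibreFamily F M) : FibreFamily F M :=
  fun p => Submodule.span ℝ {a | ∃ U : Set M, IsOpen U ∧ p ∈ U ∧ ∃ x ∈ kerSections U V L, x p = a}

/-- `L ⊕ 𝕃_V(L)`. -/
def lieSum (V : Submodule ℝ (GenField F M)) (L : FibreFamily F M) : FibreFamily F M :=
  fun p => L p ⊔ (lieSpan V (Sections L)).map (LinearMap.proj p)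

/-- `K` is a framing over `U` of `ker(𝕃_V) ∩ L`. -/
def IsKerFramingOn (U : Set M) (V : Submodule ℝ (GenField F M)) (L : FibreFamily F M)
    (K : Submodule ℝ (GenField F M)) : Prop :=
  IsFramingOn U (kerBundle V L) K ∧ (K : Set (GenField F M)) ⊆ kerSections U V L

/-- Around each point there are local framings `K₁` of `ker(𝕃_{V₂}) ∩ L` and `K₂` of
`ker(𝕃_{V₁}) ∩ L` that normalize `E''`, satisfy `[K₁, K₂] = 0`, and have the property `P`. -/
def HasCommutingFramings (E'' L : FibreFamily F M) (V₁ V₂ : Submodule ℝ (GenField F M))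
    (P : Set M → Submodule ℝ (GenField F M) → Submodule ℝ (GenField F M) → Prop) : Prop :=
  ∀ p : M, ∃ U : Set M, IsOpen U ∧ p ∈ U ∧ ∃ K₁ K₂ : Submodule ℝ (GenField F M),
    IsKerFramingOn U V₂ L K₁ ∧ IsKerFramingOn U V₁ L K₂ ∧
    (K₁ : Set (GenField F M)) ⊆ normalizerOn U E'' ∧
    (K₂ : Set (GenField F M)) ⊆ normalizerOn U E'' ∧
    (∀ x ∈ K₁, ∀ y ∈ K₂, ∀ q ∈ U, dorfman x y q = 0) ∧
    P U K₁ K₂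

/-- `(L, V₁, V₂)` is a bicontact datum for `(E, E₁', E₂')`, where `(V₁, W₁)` and `(V₂, W₂)` are
split framings of `E₁'` and `E₂'`. Here `L₁ = ker(𝕃_{V₂}) ∩ L` and `L₂ = ker(𝕃_{V₁}) ∩ L`. -/
structure IsBicontactDatum (E E₁' E₂' L : FibreFamily F M)
    (V₁ W₁ V₂ W₂ : Submodule ℝ (GenField F M)) : Prop where
  split : ∃ k, IsSplit k E
  split₁ : IsSplit 1 E₁'
  split₂ : IsSplit 1 E₂'
  orth₁ : Orthogonal E E₁'
  orth₂ : Orthogonal E E₂'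
  orth₁₂ : Orthogonal E₁' E₂'
  maxIsotropic : IsMaxIsotropic L E
  framing₁ : IsSplitFraming E₁' V₁ W₁
  framing₂ : IsSplitFraming E₂' V₂ W₂
  contact : IsContactDatum 2 E (E₁' ⊔ E₂') L (V₁ ⊔ V₂) (W₁ ⊔ W₂)
  subbundle₁ : ∃ r, IsSubbundle r (kerBundle V₂ L)
  subbundle₂ : ∃ r, IsSubbundle r (kerBundle V₁ L)
  disjoint : ∀ p, Disjoint (kerBundle V₂ L p) (kerBundle V₁ L p)
  sum : ∀ p, L p = kerBundle V₂ L p ⊔ kerBundle V₁ L p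
  framings : HasCommutingFramings (E ⊔ E₁' ⊔ E₂') L V₁ V₂ (fun _ _ _ => True)

/-- `E₁ = L₁ ⊕ 𝕃_{V₁}(L₁)`, where `L₁ = ker(𝕃_{V₂}) ∩ L`. (Exchanging the roles of `V₁` and `V₂`
yields `E₂`.) -/
def bicontactSummand (L : FibreFamily F M) (V₁ V₂ : Submodule ℝ (GenField F M)) :
    FibreFamily F M :=
  lieSum V₁ (kerBundle V₂ L)

/-- `E'' = E₁'' ⊕ E₂''`, where `E_i'' = E_i ⊕ E_i'`. -/
def bicontactTotal (E₁' E₂' L : FibreFamily F M) (V₁ V₂ : Submodule ℝ (GenField F M)) :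
    FibreFamily F M :=
  (bicontactSummand L V₁ V₂ ⊔ E₁') ⊔ (bicontactSummand L V₂ V₁ ⊔ E₂')

/-- `(J, L, V₁, V₂)` is a Hermitian bicontact datum for `(E, E₁', E₂')`. -/
structure IsHermitianBicontactDatum (E E₁' E₂' : FibreFamily F M) (J : EndFamily F M)
    (L : FibreFamily F M) (V₁ W₁ V₂ W₂ : Submodule ℝ (GenField F M)) : Prop where
  bicontact : IsBicontactDatum E E₁' E₂' L V₁ W₁ V₂ W₂
  crf : IsCRF (bicontactTotal E₁' E₂' L V₁ V₂) J
  normalizes : ((V₁ ⊔ W₁ : Submodule ℝ (GenField F M)) : Set (GenField F M)) ⊆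
    sgfNormalizer (bicontactTotal E₁' E₂' L V₁ V₂) J
  mapV : V₁.map J.act = V₂
  mapW : W₁.map J.act = W₂
  preserves : ∀ p, ∀ x ∈ L p ⊔ spanBundle (W₁ ⊔ W₂) p, J p x ∈ L p ⊔ spanBundle (W₁ ⊔ W₂) p

/-- `d⟨J x, 𝕃_v y⟩ ∈ Γ_U(E'')` for all `x, y ∈ K` and `v ∈ V`. -/
def AdaptedOn (U : Set M) (E'' : FibreFamily F M) (J : EndFamily F M)
    (V K : Submodule ℝ (GenField F M)) : Prop :=
  ∀ x ∈ K, ∀ y ∈ K, ∀ v ∈ V,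
    (fun q => ((0, funDeriv (fun q' => pairing q' (J q' (x q')) (dorfman v y q')) q) :
      GenTangent F q)) ∈ SectionsOn U E''

/-- The Hermitian bicontact datum `(J, L, V₁, V₂)` is adaptable: around each point there are adapted
local framings `K₁` of `L₁` and `K₂` of `L₂`. -/
def IsAdaptable (E₁' E₂' : FibreFamily F M) (J : EndFamily F M)
    (L : FibreFamily F M) (V₁ V₂ : Submodule ℝ (GenField F M)) : Prop :=
  HasCommutingFramings (bicontactTotal E₁' E₂' L V₁ V₂) L V₁ V₂ fun U K₁ K₂ =>
    AdaptedOn U (bicontactSummand L V₁ V₂ ⊔ E₁') J V₁ K₁ ∧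
    AdaptedOn U (bicontactSummand L V₂ V₁ ⊔ E₂') J V₂ K₂

end Defs

end GenGeom

end

/-! In a split structure of rank 2 isotropic subspaces have dimension at most one, so `V₁`, `W₁`,
`V₂`, `W₂` are spanned by single sections `v₁`, `w₁`, `v₂`, `w₂`. Bump functions extend germs of
sections, so everything can be checked near a point. The tools are the rules of the Dorfman bracket:
the Leibniz rules, the Jacobi identity (`dorfman_jacobi`), invariance of the inner product
(`anchorDeriv_pair`), and skew-symmetry wherever the inner product vanishes (`dorfman_eq_neg`).

Take commuting frames `e` of `L₁` and `e'` of `L₂`. Since `[v₂, e] = 0` and `[v₁, e'] = 0`, the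
sections `e`, `[v₁, e]`, `e'`, `[v₂, e']` span `E`, and there are exactly rank `E` of them, so they
frame it (`frameAt_E`). Invariance turns commutation into orthogonality: `⟨[v₁, e], e'⟩ = -⟨e, [v₁,
e']⟩ = 0`, and so on. Hence `E` is the orthogonal sum of `E₁` and `E₂` (`orth_summand`), both are
nondegenerate, and `E₁` is split with `L₁` as maximal isotropic subbundle. From then on a section is
shown to lie in `E₁` by pairing it with a complement. This gives the contact datum on `E₁`
(`involutive_ker`, `generates_summand`, `isContactDatum`).

The structure `J` exchanges the lines of `v₁` and `v₂`, so skewness makes it preserve `L`. It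
commutes with `[v₂, ·]`, hence preserves `L₁`, and with `[v₁, ·]`, hence preserves `E₁`
(`act_mem_L`, `act_mem_ker`, `act_mem_summand`).

The essential point is that `J₁` is CRF. For sections `x`, `y` of `E₁`, the CRF property of `J` puts
`[x, y] - [J x, J y]` in `E''`; it must be orthogonal to `E₂`, `E₁'` and `E₂'`. If `z` is orthogonal
to `E₁`, then `⟨[x, y], z⟩ = ⟨y, [z, x]⟩`, so the question is how `[z, ·]` interacts with `J`. For a
generator `z` it commutes with `J`. For `z = e'` or `z = [v₂, e']` it kills `e` and `[v₁, e]`, and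
the only obstruction is the derivative along `z` of `⟨J e, [v₁, e]⟩`, whose differential lies in
`E₁''` by adaptability and so is orthogonal to `z` (`pairing_act_dorfman_act`).

The second summand follows by exchanging indices. The hypothesis that `V₂ ⊕ W₂` normalizes `J` is
not assumed but follows from the CRF condition (`act_mem_sgfNormalizer`). -/

noncomputable section

set_option linter.unusedSectionVars false

namespace GenGeom

open Bundle Filter VectorField

/-! ### Germs of smooth functions, vector fields and 1-forms -/

section Calculus

variable {F : Type*} [NormedAddCommGroup F] [NormedSpace ℝ F]
variable {M : Type*} [TopologicalSpace M] [ChartedSpace F M]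

variable (F M) in
/-- Set-theoretic vector fields. -/
abbrev VField : Type _ := (p : M) → TangentSpace 𝓘(ℝ, F) p

variable (F M) in
/-- Set-theoretic 1-forms. -/
abbrev OneForm : Type _ := (p : M) → TangentSpace 𝓘(ℝ, F) p →L[ℝ] ℝ

variable (F) in
/-- `f` is smooth on a neighbourhood of `p`. -/
def FunNear (p : M) (f : M → ℝ) : Prop :=
  ∀ᶠ q in 𝓝 p, ContMDiffAt 𝓘(ℝ, F) 𝓘(ℝ, ℝ) ∞ f q

/-- The derivative of `f` along `X`. -/
def lieFun (X : VField F M) (f : M → ℝ) : M → ℝ := fun q => funDeriv (F := F) f q (X q)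

section Functions

variable {p : M} {f g : M → ℝ} {X Y : VField F M}

lemma FunNear.mdiff (h : FunNear F p f) : MDifferentiableAt 𝓘(ℝ, F) 𝓘(ℝ, ℝ) f p :=
  h.self_of_nhds.mdifferentiableAt (by simp)

lemma FunNear.eventually (h : FunNear F p f) : ∀ᶠ q in 𝓝 p, FunNear F q f :=
  eventually_eventually_nhds.2 h

lemma FunNear.add (hf : FunNear F p f) (hg : FunNear F p g) :
    FunNear F p (fun q => f q + g q) := by
  filter_upwards [hf, hg] with q h1 h2 using h1.add h2

lemma FunNear.sub (hf : FunNear F p f) (hg : FunNear F p g) :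
    FunNear F p (fun q => f q - g q) := by
  filter_upwards [hf, hg] with q h1 h2 using h1.sub h2

lemma FunNear.mul (hf : FunNear F p f) (hg : FunNear F p g) :
    FunNear F p (fun q => f q * g q) := by
  filter_upwards [hf, hg] with q h1 h2 using h1.mul h2

lemma FunNear.const (c : ℝ) : FunNear F p (fun _ => c) :=
  Eventually.of_forall fun _ => contMDiffAt_const

lemma FunNear.sum {ι : Type*} {s : Finset ι} {f : ι → M → ℝ} (h : ∀ i ∈ s, FunNear F p (f i)) :
    FunNear F p (fun q => ∑ i ∈ s, f i q) := by
  classical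
  induction s using Finset.induction_on with
  | empty => simpa using FunNear.const 0
  | insert a s ha ih =>
    simp_rw [Finset.sum_insert ha]
    exact (h a (by simp)).add (ih fun i hi => h i (by simp [hi]))

lemma FunNear.prod {ι : Type*} {s : Finset ι} {f : ι → M → ℝ} (h : ∀ i ∈ s, FunNear F p (f i)) :
    FunNear F p (fun q => ∏ i ∈ s, f i q) := by
  classical
  induction s using Finset.induction_on with
  | empty => simpa using FunNear.const 1
  | insert a s ha ih =>
    simp_rw [Finset.prod_insert ha]
    exact (h a (by simp)).mul (ih fun i hi => h i (by simp [hi]))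

lemma FunNear.inv (hf : FunNear F p f) (h0 : f p ≠ 0) : FunNear F p (fun q => (f q)⁻¹) := by
  filter_upwards [hf, hf.self_of_nhds.continuousAt.eventually_ne h0] with q h1 h2 using h1.inv₀ h2

lemma FunNear.congr (hf : FunNear F p f) (h : g =ᶠ[𝓝 p] f) : FunNear F p g := by
  filter_upwards [hf, h.eventuallyEq_nhds] with q h1 h2 using h1.congr_of_eventuallyEq h2

lemma lieFun_eq (X : VField F M) (f : M → ℝ) (q : M) :
    lieFun X f q = mvfderiv 𝓘(ℝ, F) f q (X q) := rfl

lemma lieFun_congr (h : f =ᶠ[𝓝 p] g) : lieFun X f p = lieFun X g p := by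
  unfold lieFun funDeriv
  rw [h.mfderiv_eq]

lemma lieFun_congr_field (h : X p = Y p) : lieFun X f p = lieFun Y f p := by
  unfold lieFun
  rw [h]

lemma lieFun_add (hf : FunNear F p f) (hg : FunNear F p g) :
    lieFun X (fun q => f q + g q) p = lieFun X f p + lieFun X g p := by
  simp only [lieFun_eq]
  exact congr($(mvfderiv_add hf.mdiff hg.mdiff) (X p))

lemma lieFun_sub (hf : FunNear F p f) (hg : FunNear F p g) :
    lieFun X (fun q => f q - g q) p = lieFun X f p - lieFun X g p := by
  simp only [lieFun_eq]
  exact congr($(mvfderiv_sub hf.mdiff hg.mdiff) (X p))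

lemma lieFun_mul (hf : FunNear F p f) (hg : FunNear F p g) :
    lieFun X (fun q => f q * g q) p = lieFun X f p * g p + f p * lieFun X g p := by
  simp only [lieFun_eq]
  have := congr($(mvfderiv_mul hf.mdiff hg.mdiff) (X p))
  refine this.trans ?_
  simp [mul_comm, add_comm]

lemma lieFun_const (c : ℝ) : lieFun X (fun _ => c) p = 0 := by
  simp only [lieFun_eq]
  exact congr($(mvfderiv_const c) (X p))

lemma lieFun_const_mul (c : ℝ) (hf : FunNear F p f) :
    lieFun X (fun q => c * f q) p = c * lieFun X f p := by
  rw [lieFun_mul (.const c) hf, lieFun_const]; ring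

lemma lieFun_add_field : lieFun (fun q => X q + Y q) f p = lieFun X f p + lieFun Y f p := by
  simp [lieFun]

lemma lieFun_smul_field : lieFun (fun q => g q • X q) f p = g p * lieFun X f p := by
  simp [lieFun]

end Functions

variable [IsManifold 𝓘(ℝ, F) ∞ M]

/-- `X` is smooth on a neighbourhood of `p`. -/
def FieldNear (p : M) (X : VField F M) : Prop :=
  ∀ᶠ q in 𝓝 p, ContMDiffAt 𝓘(ℝ, F) (𝓘(ℝ, F).prod 𝓘(ℝ, F)) ∞
    (fun p => Bundle.TotalSpace.mk' F (E := fun p : M => TangentSpace 𝓘(ℝ, F) p) p (X p)) q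

/-- `α` is smooth on a neighbourhood of `p`. -/
def FormNear (p : M) (α : OneForm F M) : Prop :=
  ∀ᶠ q in 𝓝 p, ContMDiffAt 𝓘(ℝ, F) (𝓘(ℝ, F).prod 𝓘(ℝ, F →L[ℝ] ℝ)) ∞
    (fun p => Bundle.TotalSpace.mk' (F →L[ℝ] ℝ)
      (E := fun p : M => TangentSpace 𝓘(ℝ, F) p →L[ℝ] Bundle.Trivial M ℝ p) p (α p)) q

section Fields

variable {p : M} {f g : M → ℝ} {X Y Z : VField F M} {α β : OneForm F M}

lemma FieldNear.mdiff (h : FieldNear p X) : MDifferentiableAt 𝓘(ℝ, F) 𝓘(ℝ, F).tangent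
    (fun q => (⟨q, X q⟩ : TangentBundle 𝓘(ℝ, F) M)) p :=
  h.self_of_nhds.mdifferentiableAt (by simp)

lemma FieldNear.eventually (h : FieldNear p X) : ∀ᶠ q in 𝓝 p, FieldNear q X :=
  eventually_eventually_nhds.2 h

lemma FormNear.eventually (h : FormNear p α) : ∀ᶠ q in 𝓝 p, FormNear q α :=
  eventually_eventually_nhds.2 h

lemma FieldNear.add (hX : FieldNear p X) (hY : FieldNear p Y) :
    FieldNear p (fun q => X q + Y q) := by
  filter_upwards [hX, hY] with q h1 h2 using h1.add_section h2

lemma FieldNear.smul (hf : FunNear F p f) (hX : FieldNear p X) :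
    FieldNear p (fun q => f q • X q) := by
  filter_upwards [hf, hX] with q h1 h2 using h1.smul_section h2

lemma FieldNear.zero : FieldNear p (0 : VField F M) :=
  Eventually.of_forall fun _ => (contMDiff_zeroSection ℝ _).contMDiffAt

lemma FieldNear.congr (hX : FieldNear p X) (h : ∀ᶠ q in 𝓝 p, Y q = X q) : FieldNear p Y := by
  filter_upwards [hX, eventually_eventually_nhds.2 h] with q h1 h2
  exact h1.congr_of_eventuallyEq (h2.mono fun r hr => by simp [hr])

lemma FormNear.add (hα : FormNear p α) (hβ : FormNear p β) :
    FormNear p (fun q => α q + β q) := by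
  filter_upwards [hα, hβ] with q h1 h2 using h1.add_section h2

lemma FormNear.smul (hf : FunNear F p f) (hα : FormNear p α) :
    FormNear p (fun q => f q • α q) := by
  filter_upwards [hf, hα] with q h1 h2 using h1.smul_section h2

lemma FormNear.zero : FormNear p (0 : OneForm F M) :=
  Eventually.of_forall fun _ => (contMDiff_zeroSection ℝ _).contMDiffAt

lemma FormNear.congr (hα : FormNear p α) (h : ∀ᶠ q in 𝓝 p, β q = α q) : FormNear p β := by
  filter_upwards [hα, eventually_eventually_nhds.2 h] with q h1 h2
  exact h1.congr_of_eventuallyEq (h2.mono fun r hr => by simp [hr])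

lemma FormNear.apply (hα : FormNear p α) (hX : FieldNear p X) :
    FunNear F p (fun q => α q (X q)) := by
  filter_upwards [hα, hX] with q h1 h2
  have := ContMDiffAt.clm_bundle_apply (E₂ := Bundle.Trivial M ℝ) h1 h2
  rw [contMDiffAt_section] at this
  exact this

lemma FunNear.lieFun (hf : FunNear F p f) (hX : FieldNear p X) :
    FunNear F p (lieFun X f) := by
  filter_upwards [hf, hX] with q h1 h2
  have h3 := h1.mfderiv_const (m := ∞) (by simp)
  have h4 : ContMDiffAt 𝓘(ℝ, F) (𝓘(ℝ, F).prod 𝓘(ℝ, F →L[ℝ] ℝ)) ∞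
    (fun p => Bundle.TotalSpace.mk' (F →L[ℝ] ℝ)
      (E := fun p : M => TangentSpace 𝓘(ℝ, F) p →L[ℝ] Bundle.Trivial M ℝ p) p
        (mvfderiv 𝓘(ℝ, F) f p)) q := by
    rw [contMDiffAt_hom_bundle]
    refine ⟨contMDiffAt_id, h3.congr_of_eventuallyEq ?_⟩
    refine Eventually.of_forall fun r => ?_
    ext v
    simp [inTangentCoordinates, ContinuousLinearMap.inCoordinates]
    rfl
  have := ContMDiffAt.clm_bundle_apply (E₂ := Bundle.Trivial M ℝ) h4 h2
  rw [contMDiffAt_section] at this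
  exact this

end Fields
end Calculus

/-! ### The Lie bracket of vector fields -/

section Brackets

variable {F : Type*} [NormedAddCommGroup F] [NormedSpace ℝ F]
variable {M : Type*} [TopologicalSpace M] [ChartedSpace F M]

/-- The Lie bracket of vector fields. -/
abbrev brk (X Y : VField F M) : VField F M := mlieBracket 𝓘(ℝ, F) X Y

variable [FiniteDimensional ℝ F] [IsManifold 𝓘(ℝ, F) ∞ M]
variable {p : M} {f g : M → ℝ} {X X' Y Y' Z : VField F M} {α β : OneForm F M}

omit [FiniteDimensional ℝ F] in
lemma isManifold_minSmoothness_two : IsManifold 𝓘(ℝ, F) (minSmoothness ℝ 2) M := by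
  rw [minSmoothness_of_isRCLikeNormedField]; infer_instance

omit [FiniteDimensional ℝ F] in
lemma isManifold_minSmoothness_three : IsManifold 𝓘(ℝ, F) (minSmoothness ℝ 3) M := by
  rw [minSmoothness_of_isRCLikeNormedField]; infer_instance

lemma FieldNear.brk (hX : FieldNear p X) (hY : FieldNear p Y) : FieldNear p (brk X Y) := by
  have := FiniteDimensional.complete ℝ F
  have := isManifold_minSmoothness_two (F := F) (M := M)
  have : IsManifold 𝓘(ℝ, F) (((⊤ : ℕ∞) : WithTop ℕ∞) + 1) M := by
    rw [show (((⊤ : ℕ∞) : WithTop ℕ∞) + 1) = ∞ by rfl]; infer_instance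
  filter_upwards [hX, hY] with q h1 h2
  exact ContMDiffAt.mlieBracket_vectorField (m := ⊤) (n := ⊤) h1 h2
    (by rw [minSmoothness_of_isRCLikeNormedField]; rfl)

omit [FiniteDimensional ℝ F] [IsManifold 𝓘(ℝ, F) ∞ M] in
lemma brk_swap : brk X Y p = - brk Y X p := mlieBracket_swap_apply

omit [FiniteDimensional ℝ F] [IsManifold 𝓘(ℝ, F) ∞ M] in
lemma brk_congr (hX : ∀ᶠ q in 𝓝 p, X q = X' q) (hY : ∀ᶠ q in 𝓝 p, Y q = Y' q) :
    brk X Y p = brk X' Y' p :=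
  Filter.EventuallyEq.mlieBracket_vectorField_eq hX hY

lemma brk_add_right (hY : FieldNear p Y) (hZ : FieldNear p Z) :
    brk X (fun q => Y q + Z q) p = brk X Y p + brk X Z p := by
  have := FiniteDimensional.complete ℝ F
  exact mlieBracket_add_right hY.mdiff hZ.mdiff

lemma brk_add_left (hY : FieldNear p Y) (hZ : FieldNear p Z) :
    brk (fun q => Y q + Z q) X p = brk Y X p + brk Z X p := by
  have := FiniteDimensional.complete ℝ F
  exact mlieBracket_add_left hY.mdiff hZ.mdiff

lemma brk_smul_right (hf : FunNear F p f) (hY : FieldNear p Y) :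
    brk X (fun q => f q • Y q) p = lieFun X f p • Y p + f p • brk X Y p := by
  have := FiniteDimensional.complete ℝ F
  exact mlieBracket_smul_right hf.mdiff hY.mdiff

lemma brk_smul_left (hf : FunNear F p f) (hX : FieldNear p X) :
    brk (fun q => f q • X q) Y p = - lieFun Y f p • X p + f p • brk X Y p := by
  have := FiniteDimensional.complete ℝ F
  exact mlieBracket_smul_left hf.mdiff hX.mdiff

lemma brk_jacobi (hX : FieldNear p X) (hY : FieldNear p Y) (hZ : FieldNear p Z) :
    brk X (brk Y Z) p = brk (brk X Y) Z p + brk Y (brk X Z) p := by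
  have := FiniteDimensional.complete ℝ F
  have := isManifold_minSmoothness_three (F := F) (M := M)
  have h2 : minSmoothness ℝ 2 ≤ ∞ := by
    rw [minSmoothness_of_isRCLikeNormedField]; exact ENat.LEInfty.out
  exact leibniz_identity_mlieBracket_apply (hX.self_of_nhds.of_le h2) (hY.self_of_nhds.of_le h2)
    (hZ.self_of_nhds.of_le h2)

omit [FiniteDimensional ℝ F] in
lemma exists_fieldNear (p : M) (v : TangentSpace 𝓘(ℝ, F) p) :
    ∃ X : VField F M, FieldNear p X ∧ X p = v := by
  refine ⟨FiberBundle.extend F v, ?_, by simp⟩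
  obtain ⟨s, hs, h⟩ := FiberBundle.exists_contMDiffOn_extend (k := ∞) 𝓘(ℝ, F) F v
  filter_upwards [eventually_mem_nhds_iff.2 hs] with q hq using h.contMDiffAt hq

omit [FiniteDimensional ℝ F] in
lemma exists_formNear (p : M) (v : TangentSpace 𝓘(ℝ, F) p →L[ℝ] ℝ) :
    ∃ α : OneForm F M, FormNear p α ∧ α p = v := by
  let V : M → Type _ := fun p => TangentSpace 𝓘(ℝ, F) p →L[ℝ] Bundle.Trivial M ℝ p
  let v' : V p := v
  refine ⟨FiberBundle.extend (E := V) (F →L[ℝ] ℝ) v', ?_,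
    FiberBundle.extend_apply_self (F := F →L[ℝ] ℝ) (E := V) v'⟩
  obtain ⟨s, hs, h⟩ :=
    FiberBundle.exists_contMDiffOn_extend (k := ∞) 𝓘(ℝ, F) (V := V) (F →L[ℝ] ℝ) v'
  filter_upwards [eventually_mem_nhds_iff.2 hs] with q hq using h.contMDiffAt hq

/-- Expanding the Jacobi identity for `X`, `Y` and `f • Z` by the Leibniz rule leaves the claimed
identity multiplied by `Z p`, so it suffices to choose `Z` with `Z p ≠ 0`. If the tangent space is
zero, both sides vanish. -/
lemma lieFun_brk (hX : FieldNear p X) (hY : FieldNear p Y) (hf : FunNear F p f) :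
    lieFun (brk X Y) f p = lieFun X (lieFun Y f) p - lieFun Y (lieFun X f) p := by
  by_cases hF : ∀ v : TangentSpace 𝓘(ℝ, F) p, v = 0
  · simp [lieFun, hF (brk X Y p), hF (X p), hF (Y p)]
  push Not at hF
  obtain ⟨v, hv⟩ := hF
  obtain ⟨Z, hZ, rfl⟩ := exists_fieldNear p v
  have key : ∀ {X Y : VField F M}, FieldNear p X → FieldNear p Y →
      brk X (brk Y (fun q => f q • Z q)) p =
        (lieFun X (lieFun Y f) p • Z p + lieFun Y f p • brk X Z p) +
        (lieFun X f p • brk Y Z p + f p • brk X (brk Y Z) p) := by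
    intro X Y hX hY
    have h1 : ∀ᶠ q in 𝓝 p, brk Y (fun q => f q • Z q) q =
        lieFun Y f q • Z q + f q • brk Y Z q := by
      filter_upwards [hf.eventually, hZ.eventually] with q h1 h2 using brk_smul_right h1 h2
    rw [brk_congr (Eventually.of_forall fun q => rfl) h1,
      brk_add_right (.smul (hf.lieFun hY) hZ) (.smul hf (hY.brk hZ)),
      brk_smul_right (hf.lieFun hY) hZ, brk_smul_right hf (hY.brk hZ)]
  have h1 := brk_jacobi hX hY (hZ.smul hf)
  have h2 := brk_jacobi hX hY hZ
  rw [key hX hY, key hY hX, brk_smul_right hf hZ, h2] at h1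
  have h3 : (lieFun (brk X Y) f p - (lieFun X (lieFun Y f) p - lieFun Y (lieFun X f) p)) • Z p
      = 0 := by
    rw [sub_smul, sub_smul]
    have := sub_eq_zero.2 h1
    rw [← neg_eq_zero, ← this]
    simp only [smul_add]
    abel
  rcases smul_eq_zero.1 h3 with h | h
  · exact sub_eq_zero.1 h
  · exact absurd h hv

end Brackets

/-! ### Smoothness of 1-forms and Cartan's formula for the exterior derivative -/

section Forms

variable {F : Type*} [NormedAddCommGroup F] [NormedSpace ℝ F]
variable {M : Type*} [TopologicalSpace M] [ChartedSpace F M]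
variable [FiniteDimensional ℝ F] [IsManifold 𝓘(ℝ, F) ∞ M]
variable {p : M} {f g : M → ℝ} {X X' Y Y' Z : VField F M} {α β : OneForm F M}

/-- In a trivialization, `α` is the combination of the dual basis of `F` whose coefficients are the
values of `α` on the local frame, so finitely many smooth functions determine its smoothness. This
reduces smoothness of a Dorfman bracket to smoothness of functions. -/
lemma formNear_of_apply (h : ∀ T : VField F M, FieldNear p T → FunNear F p (fun q => α q (T q))) :
    FormNear p α := by
  have := FiniteDimensional.complete ℝ F
  let V : M → Type _ := fun p => TangentSpace 𝓘(ℝ, F) p →L[ℝ] Bundle.Trivial M ℝ p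
  let b := Module.finBasis ℝ F
  let e := trivializationAt F (TangentSpace 𝓘(ℝ, F)) p
  let e' := trivializationAt (F →L[ℝ] ℝ) V p
  have hT : ∀ i, FieldNear p (e.localFrame b i) := fun i => by
    filter_upwards [e.open_baseSet.mem_nhds (mem_baseSet_trivializationAt F _ p)] with q hq
    exact contMDiffAt_localFrame_of_mem (I := 𝓘(ℝ, F)) ∞ e b i hq
  have h1 : ∀ᶠ q in 𝓝 p, ∀ i, ContMDiffAt 𝓘(ℝ, F) 𝓘(ℝ, ℝ) ∞
      (fun q => α q (e.localFrame b i q)) q := eventually_all.2 fun i => h _ (hT i)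
  filter_upwards [h1, e.open_baseSet.mem_nhds (mem_baseSet_trivializationAt F _ p),
    e'.open_baseSet.mem_nhds (mem_baseSet_trivializationAt (F →L[ℝ] ℝ) V p)] with q hq hqe hqe'
  refine (e'.contMDiffAt_section_iff (s := fun p => (α p : V p)) hqe').2 ?_
  have h2 : ContMDiffAt 𝓘(ℝ, F) 𝓘(ℝ, F →L[ℝ] ℝ) ∞
      (fun r => ∑ i, (α r (e.localFrame b i r)) • LinearMap.toContinuousLinearMap (b.coord i)) q := by
    apply contMDiffAt_finsetSum
    intro i _
    exact (hq i).smul contMDiffAt_const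
  refine h2.congr_of_eventuallyEq ?_
  filter_upwards [e.open_baseSet.mem_nhds hqe] with r hr
  have h3 : (e' ⟨r, (α r : V r)⟩).2 = (α r).comp (e.symmL ℝ r) := by
    simp only [e']
    rw [hom_trivializationAt_apply]
    ext v
    simp [ContinuousLinearMap.inCoordinates, e]
  rw [h3]
  refine ContinuousLinearMap.coe_injective (b.ext fun j => ?_)
  have h4 : e.localFrame b j r = e.symmL ℝ r (b j) := by
    rw [Trivialization.localFrame_apply_of_mem_baseSet _ _ hr, Trivialization.basisAt]
    simp only [Module.Basis.map_apply, Trivialization.linearEquivAt_symm_apply]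
    exact (Trivialization.symmL_apply _ hr _).symm
  simp [Finsupp.single_apply, h4]

lemma formInChart_differentiableAt (hα : FormNear p α) :
    DifferentiableAt ℝ (formInChart α p) (extChartAt 𝓘(ℝ, F) p p) := by
  have h := ((contMDiffAt_hom_bundle _).1 hα.self_of_nhds).2
  have h2 := h.mdifferentiableAt (by simp)
  have h3 : MDifferentiableAt 𝓘(ℝ, F) 𝓘(ℝ, F) (extChartAt 𝓘(ℝ, F) p).symm
      (extChartAt 𝓘(ℝ, F) p p) := by
    have := mdifferentiableWithinAt_extChartAt_symm (I := 𝓘(ℝ, F)) (mem_extChartAt_target p)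
    rwa [ModelWithCorners.range_eq_univ, mdifferentiableWithinAt_univ] at this
  have h4 := MDifferentiableAt.comp_of_eq (extChartAt 𝓘(ℝ, F) p p) h2 h3 (by simp)
  -- Over the chart domain the inverse of the tangent trivialization at `p` is the derivative of the
  -- inverse chart, so the bundle coordinates of `α` agree with `formInChart`.
  refine (mdifferentiableAt_iff_differentiableAt.1 h4).congr_of_eventuallyEq ?_
  filter_upwards [extChartAt_target_mem_nhds (I := 𝓘(ℝ, F)) p] with y hy
  have hs : (extChartAt 𝓘(ℝ, F) p).symm y ∈ (chartAt F p).source := by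
    rw [← extChartAt_source 𝓘(ℝ, F)]; exact (extChartAt 𝓘(ℝ, F) p).map_target hy
  have h5 := TangentBundle.symmL_trivializationAt (I := 𝓘(ℝ, F)) hs
  rw [(extChartAt 𝓘(ℝ, F) p).right_inv hy] at h5
  rw [ModelWithCorners.range_eq_univ, mfderivWithin_univ] at h5
  unfold formInChart
  rw [← h5]
  ext v
  simp [ContinuousLinearMap.inCoordinates]
  rfl

/-- The local representative, in the preferred chart at `p`, of a vector field. -/
def fieldInChart (X : VField F M) (p : M) : F → F :=
  fun y => (mfderiv 𝓘(ℝ, F) 𝓘(ℝ, F) (extChartAt 𝓘(ℝ, F) p).symm y).inverse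
    (X ((extChartAt 𝓘(ℝ, F) p).symm y))

lemma mpullbackWithin_eq_fieldInChart (X : VField F M) (p : M) :
    mpullbackWithin 𝓘(ℝ, F) 𝓘(ℝ, F) (extChartAt 𝓘(ℝ, F) p).symm X (Set.range 𝓘(ℝ, F))
      = fieldInChart X p := by
  rw [ModelWithCorners.range_eq_univ, mpullbackWithin_univ]
  rfl

lemma fieldInChart_differentiableAt (hX : FieldNear p X) :
    DifferentiableAt ℝ (fieldInChart X p) (extChartAt 𝓘(ℝ, F) p p) := by
  have := FiniteDimensional.complete ℝ F
  have h := (mdifferentiableWithinAt_univ.2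
    hX.mdiff).differentiableWithinAt_mpullbackWithin_vectorField
  rwa [mpullbackWithin_eq_fieldInChart, ModelWithCorners.range_eq_univ, Set.preimage_univ,
    Set.univ_inter, differentiableWithinAt_univ] at h

lemma mfderiv_extChartAt_symm_self (p : M) :
    mfderiv 𝓘(ℝ, F) 𝓘(ℝ, F) (extChartAt 𝓘(ℝ, F) p).symm (extChartAt 𝓘(ℝ, F) p p)
      = ContinuousLinearMap.id ℝ F := by
  have h := mfderivWithin_range_extChartAt_symm (I := 𝓘(ℝ, F)) (x := p)
  rwa [ModelWithCorners.range_eq_univ, mfderivWithin_univ] at h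

lemma fieldInChart_self (X : VField F M) (p : M) :
    fieldInChart X p (extChartAt 𝓘(ℝ, F) p p) = X p := by
  have h := mfderivWithin_extChartAt_symm_inverse_apply (I := 𝓘(ℝ, F)) (x := p) (X p)
  rw [ModelWithCorners.range_eq_univ, mfderivWithin_univ] at h
  unfold fieldInChart
  rw [extChartAt_to_inv (I := 𝓘(ℝ, F)) p]
  exact h

lemma formInChart_self (α : OneForm F M) (p : M) :
    formInChart α p (extChartAt 𝓘(ℝ, F) p p) = α p := by
  unfold formInChart
  rw [mfderiv_extChartAt_symm_self, extChartAt_to_inv (I := 𝓘(ℝ, F)) p]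
  rfl

/-- The tangent space at `p` is modelled on `F` by the preferred chart at `p` itself, so the
derivative of that chart at `p` is the identity and no transition maps appear. -/
lemma brk_eq_fieldInChart (X Y : VField F M) (p : M) :
    brk X Y p = fderiv ℝ (fieldInChart Y p) (extChartAt 𝓘(ℝ, F) p p) (X p)
      - fderiv ℝ (fieldInChart X p) (extChartAt 𝓘(ℝ, F) p p) (Y p) := by
  rw [brk, ← mlieBracketWithin_univ, mlieBracketWithin_apply, mfderiv_extChartAt_self,
    mpullbackWithin_eq_fieldInChart, mpullbackWithin_eq_fieldInChart,
    ModelWithCorners.range_eq_univ, Set.preimage_univ, Set.univ_inter, lieBracketWithin_univ,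
    lieBracket, fieldInChart_self, fieldInChart_self]
  exact congr($(ContinuousLinearMap.inverse_id (R := ℝ) (M := F)) _)

lemma lieFun_apply_eq (hα : FormNear p α) (hY : FieldNear p Y) :
    lieFun X (fun q => α q (Y q)) p =
      fderiv ℝ (formInChart α p) (extChartAt 𝓘(ℝ, F) p p) (X p) (Y p) +
      α p (fderiv ℝ (fieldInChart Y p) (extChartAt 𝓘(ℝ, F) p p) (X p)) := by
  have h1 : (fun q => α q (Y q)) ∘ (extChartAt 𝓘(ℝ, F) p).symm =ᶠ[𝓝 (extChartAt 𝓘(ℝ, F) p p)]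
      fun y => formInChart α p y (fieldInChart Y p y) := by
    filter_upwards [extChartAt_target_mem_nhds (I := 𝓘(ℝ, F)) p] with y hy
    have h2 := isInvertible_mfderivWithin_extChartAt_symm (I := 𝓘(ℝ, F)) hy
    rw [ModelWithCorners.range_eq_univ, mfderivWithin_univ] at h2
    have h3 := h2.self_apply_inverse (Y ((extChartAt 𝓘(ℝ, F) p).symm y))
    exact congr(α _ $h3).symm
  have h2 := (formInChart_differentiableAt hα).hasFDerivAt.clm_apply
    (fieldInChart_differentiableAt hY).hasFDerivAt
  have h3 := (hα.apply hY).mdiff.mfderiv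
  have h4 : lieFun X (fun q => α q (Y q)) p =
    fderiv ℝ ((fun q => α q (Y q)) ∘ (extChartAt 𝓘(ℝ, F) p).symm) (extChartAt 𝓘(ℝ, F) p p) (X p) := by
    unfold lieFun funDeriv
    rw [h3, ModelWithCorners.range_eq_univ, fderivWithin_univ]
    rfl
  rw [h4, h1.fderiv_eq, h2.fderiv, formInChart_self, fieldInChart_self]
  exact add_comm _ _

/-- Cartan's formula. In the chart, the terms that differentiate the two fields cancel against the
Lie bracket, and the antisymmetrized derivative of `α` remains. It replaces the chart definition of
the exterior derivative by derivatives of functions and Lie brackets. -/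
lemma contractExtDeriv_apply (hα : FormNear p α) (hX : FieldNear p X) (hY : FieldNear p Y) :
    contractExtDeriv α p (X p) (Y p) =
      lieFun X (fun q => α q (Y q)) p - lieFun Y (fun q => α q (X q)) p - α p (brk X Y p) := by
  rw [lieFun_apply_eq hα hY, lieFun_apply_eq hα hX, brk_eq_fieldInChart]
  have : chartDeriv p = ContinuousLinearMap.id ℝ F := mfderiv_extChartAt_self
  unfold contractExtDeriv
  rw [this]
  have h := map_sub (α p) (fderiv ℝ (fieldInChart Y p) (extChartAt 𝓘(ℝ, F) p p) (X p))
    (fderiv ℝ (fieldInChart X p) (extChartAt 𝓘(ℝ, F) p p) (Y p))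
  refine Eq.trans ?_ (congrArg (fun t => _ - t) h.symm)
  have h2 : ∀ a b c d : ℝ, a - b = a + c - (b + d) - (c - d) := by intros; ring
  exact h2 _ _ _ _

end Forms

/-! ### The Courant algebroid identities for the Dorfman bracket -/

section Dorfman

variable {F : Type*} [NormedAddCommGroup F] [NormedSpace ℝ F]
variable {M : Type*} [TopologicalSpace M] [ChartedSpace F M]

/-- The derivative of a function along the vector part of a generalized vector field. -/
def anchorDeriv (x : GenField F M) (f : M → ℝ) : M → ℝ := lieFun (fun q => (x q).1) f

lemma pairing_apply (p : M) (a b : GenTangent F p) :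
    pairing p a b = (1 / 2 : ℝ) * (a.2 b.1 + b.2 a.1) := rfl

lemma pairing_comm (p : M) (a b : GenTangent F p) : pairing p a b = pairing p b a := by
  rw [pairing_apply, pairing_apply, add_comm]

/-- The pairing of two generalized vector fields. -/
def pair (x y : GenField F M) : M → ℝ := fun q => pairing q (x q) (y q)

lemma pair_comm (x y : GenField F M) : pair x y = pair y x :=
  funext fun q => pairing_comm q _ _

variable [FiniteDimensional ℝ F] [IsManifold 𝓘(ℝ, F) ∞ M]

/-- `x` is smooth on a neighbourhood of `p`. -/
def GenNear (p : M) (x : GenField F M) : Prop :=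
  FieldNear p (fun q => (x q).1) ∧ FormNear p (fun q => (x q).2)

variable {p : M} {f : M → ℝ} {T : VField F M} {x x' y y' z : GenField F M}

lemma GenNear.eventually (hx : GenNear p x) : ∀ᶠ q in 𝓝 p, GenNear q x :=
  hx.1.eventually.and hx.2.eventually

lemma GenNear.add (hx : GenNear p x) (hy : GenNear p y) : GenNear p (fun q => x q + y q) :=
  ⟨hx.1.add hy.1, hx.2.add hy.2⟩

lemma GenNear.smul (hf : FunNear F p f) (hx : GenNear p x) : GenNear p (fun q => f q • x q) :=
  ⟨hx.1.smul hf, hx.2.smul hf⟩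

lemma GenNear.congr (hx : GenNear p x) (h : ∀ᶠ q in 𝓝 p, y q = x q) : GenNear p y :=
  ⟨hx.1.congr (h.mono fun q hq => by rw [hq]), hx.2.congr (h.mono fun q hq => by rw [hq])⟩

lemma GenNear.neg (hx : GenNear p x) : GenNear p (fun q => - x q) :=
  GenNear.congr (hx.smul (.const (-1))) (Eventually.of_forall fun q => (neg_one_smul ℝ (x q)).symm)

lemma GenNear.zero : GenNear p (0 : GenField F M) := ⟨.zero, .zero⟩

lemma GenNear.sum {ι : Type*} {s : Finset ι} {e : ι → GenField F M}
    (h : ∀ i ∈ s, GenNear p (e i)) : GenNear p (fun q => ∑ i ∈ s, e i q) := by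
  classical
  induction s using Finset.induction_on with
  | empty => exact GenNear.zero
  | insert a s ha ih =>
    simp_rw [Finset.sum_insert ha]
    exact (h a (by simp)).add (ih fun i hi => h i (by simp [hi]))

lemma GenNear.pair (hx : GenNear p x) (hy : GenNear p y) : FunNear F p (pair x y) :=
  (FunNear.const _).mul ((hx.2.apply hy.1).add (hy.2.apply hx.1))

lemma dorfman_fst : (fun q => (dorfman x y q).1) = brk (fun q => (x q).1) (fun q => (y q).1) := rfl

/-- Tested on a vector field `T`, the form part involves only derivatives of functions and Lie
brackets. All identities below are proved by such testing, after which they are polynomial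
identities in these terms. -/
lemma dorfman_snd_apply (hx : GenNear p x) (hy : GenNear p y) (hT : FieldNear p T) :
    (dorfman x y p).2 (T p) =
      lieFun (fun q => (x q).1) (fun q => (y q).2 (T q)) p
      - (y p).2 (brk (fun q => (x q).1) T p)
      - lieFun (fun q => (y q).1) (fun q => (x q).2 (T q)) p
      + lieFun T (fun q => (x q).2 (y q).1) p
      + (x p).2 (brk (fun q => (y q).1) T p) := by
  have h1 := contractExtDeriv_apply hy.2 hx.1 hT
  have h2 := contractExtDeriv_apply hx.2 hy.1 hT
  have h3 : lieFun T (fun q => (y q).2 (x q).1) p =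
    funDeriv (fun q => (y q).2 (x q).1) p (T p) := rfl
  change contractExtDeriv (fun q => (y q).2) p (x p).1 (T p)
      + funDeriv (fun q => (y q).2 (x q).1) p (T p)
      - contractExtDeriv (fun q => (x q).2) p (y p).1 (T p) = _
  rw [h1, h2, ← h3]
  ring

lemma dorfman_snd_near (hx : GenNear p x) (hy : GenNear p y) (hT : FieldNear p T) :
    (fun q => (dorfman x y q).2 (T q)) =ᶠ[𝓝 p] fun q =>
      lieFun (fun q => (x q).1) (fun q => (y q).2 (T q)) q
      - (y q).2 (brk (fun q => (x q).1) T q)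
      - lieFun (fun q => (y q).1) (fun q => (x q).2 (T q)) q
      + lieFun T (fun q => (x q).2 (y q).1) q
      + (x q).2 (brk (fun q => (y q).1) T q) := by
  filter_upwards [hx.eventually, hy.eventually, hT.eventually] with q h1 h2 h3
  exact dorfman_snd_apply h1 h2 h3

lemma GenNear.dorfman (hx : GenNear p x) (hy : GenNear p y) : GenNear p (dorfman x y) := by
  refine ⟨hx.1.brk hy.1, formNear_of_apply fun T hT => ?_⟩
  refine FunNear.congr ?_ (dorfman_snd_near hx hy hT)
  exact (((((hy.2.apply hT).lieFun hx.1).sub (hy.2.apply (hx.1.brk hT))).sub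
    ((hx.2.apply hT).lieFun hy.1)).add ((hx.2.apply hy.1).lieFun hT)).add
    (hx.2.apply (hy.1.brk hT))

lemma lieFun_dorfman_snd (W : VField F M) (hx : GenNear p x) (hy : GenNear p y)
    (hT : FieldNear p T) :
    lieFun W (fun q => (GenGeom.dorfman x y q).2 (T q)) p =
      lieFun W (lieFun (fun q => (x q).1) (fun q => (y q).2 (T q))) p
      - lieFun W (fun q => (y q).2 (brk (fun q => (x q).1) T q)) p
      - lieFun W (lieFun (fun q => (y q).1) (fun q => (x q).2 (T q))) p
      + lieFun W (lieFun T (fun q => (x q).2 (y q).1)) p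
      + lieFun W (fun q => (x q).2 (brk (fun q => (y q).1) T q)) p := by
  have h1 := (hy.2.apply hT).lieFun hx.1
  have h2 := hy.2.apply (hx.1.brk hT)
  have h3 := (hx.2.apply hT).lieFun hy.1
  have h4 := (hx.2.apply hy.1).lieFun hT
  have h5 := hx.2.apply (hy.1.brk hT)
  rw [lieFun_congr (dorfman_snd_near hx hy hT),
    lieFun_add (((h1.sub h2).sub h3).add h4) h5, lieFun_add ((h1.sub h2).sub h3) h4,
    lieFun_sub (h1.sub h2) h3, lieFun_sub h1 h2]

lemma genTangent_ext {a b : GenTangent F p} (h1 : a.1 = b.1)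
    (h2 : ∀ T : VField F M, FieldNear p T → a.2 (T p) = b.2 (T p)) : a = b := by
  refine Prod.ext h1 (ContinuousLinearMap.ext fun v => ?_)
  obtain ⟨T, hT, rfl⟩ := exists_fieldNear p v
  exact h2 T hT

/-- Invariance of the inner product: the derivatives along `y` and `z` occur in the two pairings
with opposite signs, and the remaining bracket terms cancel by antisymmetry of the Lie bracket. -/
lemma anchorDeriv_pair (hx : GenNear p x) (hy : GenNear p y) (hz : GenNear p z) :
    anchorDeriv x (pair y z) p = pairing p (dorfman x y p) (z p) + pairing p (y p) (dorfman x z p) := by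
  unfold anchorDeriv pair
  simp only [pairing_apply]
  rw [lieFun_const_mul _ ((hy.2.apply hz.1).add (hz.2.apply hy.1)),
    lieFun_add (hy.2.apply hz.1) (hz.2.apply hy.1), dorfman_snd_apply hx hy hz.1,
    dorfman_snd_apply hx hz hy.1, show (dorfman x y p).1 = brk (fun q => (x q).1) (fun q => (y q).1) p
    from rfl, show (dorfman x z p).1 = brk (fun q => (x q).1) (fun q => (z q).1) p from rfl,
    brk_swap (X := fun q => (z q).1) (Y := fun q => (y q).1), map_neg]
  ring

lemma dorfman_congr (hx : ∀ᶠ q in 𝓝 p, x q = x' q) (hy : ∀ᶠ q in 𝓝 p, y q = y' q)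
    (hx' : GenNear p x') (hy' : GenNear p y') : dorfman x y p = dorfman x' y' p := by
  have hx1 := hx'.congr hx
  have hy1 := hy'.congr hy
  refine genTangent_ext (brk_congr (hx.mono fun q hq => by rw [hq]) (hy.mono fun q hq => by rw [hq]))
    fun T hT => ?_
  rw [dorfman_snd_apply hx1 hy1 hT, dorfman_snd_apply hx' hy' hT]
  have e1 : ∀ᶠ q in 𝓝 p, (fun q => (x q).1) q = (fun q => (x' q).1) q :=
    hx.mono fun q hq => by simp only [hq]
  have e2 : ∀ᶠ q in 𝓝 p, (fun q => (y q).1) q = (fun q => (y' q).1) q :=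
    hy.mono fun q hq => by simp only [hq]
  rw [lieFun_congr_field (X := fun q => (x q).1) (Y := fun q => (x' q).1) e1.self_of_nhds,
    lieFun_congr_field (X := fun q => (y q).1) (Y := fun q => (y' q).1) e2.self_of_nhds,
    brk_congr e1 (Eventually.of_forall fun _ => rfl), brk_congr e2 (Eventually.of_forall fun _ => rfl),
    hx.self_of_nhds, hy.self_of_nhds,
    lieFun_congr (hy.mono fun q hq => show (y q).2 (T q) = (y' q).2 (T q) by rw [hq]),
    lieFun_congr (hx.mono fun q hq => show (x q).2 (T q) = (x' q).2 (T q) by rw [hq]),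
    lieFun_congr ((hx.and hy).mono fun q hq =>
      show (x q).2 (y q).1 = (x' q).2 (y' q).1 by rw [hq.1, hq.2])]

lemma dorfman_add_right (hx : GenNear p x) (hy : GenNear p y) (hz : GenNear p z) :
    dorfman x (fun q => y q + z q) p = dorfman x y p + dorfman x z p := by
  refine genTangent_ext (brk_add_right hy.1 hz.1) fun T hT => ?_
  have h1 := dorfman_snd_apply hx (hy.add hz) hT
  simp only [Prod.snd_add, Prod.fst_add, add_apply, map_add] at h1 ⊢
  rw [h1, dorfman_snd_apply hx hy hT, dorfman_snd_apply hx hz hT,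
    lieFun_add (hy.2.apply hT) (hz.2.apply hT), lieFun_add_field,
    lieFun_add (hx.2.apply hy.1) (hx.2.apply hz.1), brk_add_left hy.1 hz.1, map_add]
  ring

lemma dorfman_smul_right (hf : FunNear F p f) (hx : GenNear p x) (hy : GenNear p y) :
    dorfman x (fun q => f q • y q) p = f p • dorfman x y p + anchorDeriv x f p • y p := by
  refine genTangent_ext ?_ fun T hT => ?_
  · exact (brk_smul_right hf hy.1).trans (add_comm _ _)
  have h1 := dorfman_snd_apply hx (hy.smul hf) hT
  simp only [Prod.snd_add, Prod.smul_snd, Prod.smul_fst, add_apply,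
    smul_apply, map_smul, smul_eq_mul] at h1 ⊢
  rw [h1, dorfman_snd_apply hx hy hT, lieFun_mul hf (hy.2.apply hT), lieFun_smul_field,
    lieFun_mul hf (hx.2.apply hy.1), brk_smul_left hf hy.1, map_add, map_smul, map_smul]
  simp only [smul_eq_mul, anchorDeriv]
  ring

lemma dorfman_symm (hx : GenNear p x) (hy : GenNear p y) :
    dorfman x y p = - dorfman y x p + ((0, (2 : ℝ) • funDeriv (pair x y) p) : GenTangent F p) := by
  refine genTangent_ext ?_ fun T hT => ?_
  · simp only [Prod.fst_add, Prod.fst_neg, add_zero]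
    exact brk_swap
  have h0 : ((2 : ℝ) • funDeriv (pair x y) p) (T p) = 2 * lieFun T (pair x y) p := rfl
  simp only [Prod.snd_add, Prod.snd_neg, add_apply,
    neg_apply]
  rw [h0]
  unfold pair
  simp only [pairing_apply]
  rw [dorfman_snd_apply hx hy hT, dorfman_snd_apply hy hx hT,
    lieFun_const_mul _ ((hx.2.apply hy.1).add (hy.2.apply hx.1)),
    lieFun_add (hx.2.apply hy.1) (hy.2.apply hx.1)]
  ring

/-- The Leibniz form of the Jacobi identity, which needs no skew-symmetry. After testing on `T`, the
second-order derivatives match by `lieFun_brk`; what is left is the Jacobi identity for three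
triples of vector fields, evaluated by the form parts of `x`, `y` and `z`. -/
lemma dorfman_jacobi (hx : GenNear p x) (hy : GenNear p y) (hz : GenNear p z) :
    dorfman x (dorfman y z) p = dorfman (dorfman x y) z p + dorfman y (dorfman x z) p := by
  refine genTangent_ext (brk_jacobi hx.1 hy.1 hz.1) fun T hT => ?_
  simp only [Prod.snd_add, add_apply]
  have hxy := hx.dorfman hy
  have hxz := hx.dorfman hz
  have hyz := hy.dorfman hz
  rw [dorfman_snd_apply hx hyz hT, dorfman_snd_apply hxy hz hT, dorfman_snd_apply hy hxz hT]
  rw [lieFun_dorfman_snd _ hy hz hT, lieFun_dorfman_snd _ hx hy hT, lieFun_dorfman_snd _ hx hz hT,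
    lieFun_dorfman_snd _ hx hy hz.1, dorfman_snd_apply hy hz (hx.1.brk hT),
    dorfman_snd_apply hx hy (hz.1.brk hT), dorfman_snd_apply hx hz (hy.1.brk hT)]
  simp only [dorfman_fst]
  simp only [show ∀ q, (dorfman y z q).1 = brk (fun q => (y q).1) (fun q => (z q).1) q
    from fun _ => rfl, show ∀ q, (dorfman x z q).1 = brk (fun q => (x q).1) (fun q => (z q).1) q
    from fun _ => rfl]
  have j1 := congrArg (x p).2 (brk_jacobi hy.1 hz.1 hT)
  have j2 := congrArg (y p).2 (brk_jacobi hx.1 hz.1 hT)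
  have j3 := congrArg (z p).2 (brk_jacobi hx.1 hy.1 hT)
  rw [map_add] at j1 j2 j3
  rw [lieFun_brk hy.1 hz.1 (hx.2.apply hT), lieFun_brk hx.1 hy.1 (hz.2.apply hT),
    lieFun_brk hx.1 hz.1 (hy.2.apply hT), lieFun_brk hx.1 hT (hy.2.apply hz.1),
    lieFun_brk hz.1 hT (hx.2.apply hy.1), lieFun_brk hy.1 hT (hx.2.apply hz.1)]
  linear_combination -j1 + j2 - j3

end Dorfman

/-! ### Extension of germs to global sections, and smooth coefficients -/

section Sections

variable {F : Type*} [NormedAddCommGroup F] [NormedSpace ℝ F]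
variable {M : Type*} [TopologicalSpace M] [ChartedSpace F M]
variable [FiniteDimensional ℝ F] [IsManifold 𝓘(ℝ, F) ∞ M]

instance finiteDimensional_genTangent (p : M) : FiniteDimensional ℝ (GenTangent F p) :=
  inferInstanceAs (FiniteDimensional ℝ (F × (F →L[ℝ] ℝ)))

variable {U : Set M} {p : M} {f g : M → ℝ} {x y z : GenField F M} {E : FibreFamily F M}

lemma SmoothOn.genNear (hU : IsOpen U) (h : SmoothOn U x) (hp : p ∈ U) : GenNear p x := by
  refine ⟨?_, ?_⟩
  · filter_upwards [hU.mem_nhds hp] with q hq using h.1.contMDiffAt (hU.mem_nhds hq)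
  · filter_upwards [hU.mem_nhds hp] with q hq using h.2.contMDiffAt (hU.mem_nhds hq)

lemma smoothOn_of_genNear (h : ∀ p ∈ U, GenNear p x) : SmoothOn U x :=
  ⟨fun p hp => (h p hp).1.self_of_nhds.contMDiffWithinAt,
    fun p hp => (h p hp).2.self_of_nhds.contMDiffWithinAt⟩

lemma genNear_of_mem_sectionsOn (hU : IsOpen U) (h : x ∈ SectionsOn U E) (hp : p ∈ U) :
    GenNear p x := SmoothOn.genNear hU h.1 hp

lemma genNear_of_mem_sections (h : x ∈ Sections E) (p : M) : GenNear p x :=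
  genNear_of_mem_sectionsOn isOpen_univ h (Set.mem_univ p)

lemma mem_sections_iff : x ∈ Sections E ↔ ∀ p, GenNear p x ∧ x p ∈ E p :=
  ⟨fun h p => ⟨genNear_of_mem_sections h p, h.2 p (Set.mem_univ p)⟩,
    fun h => ⟨smoothOn_of_genNear fun p _ => (h p).1, fun p _ => (h p).2⟩⟩

lemma mem_sectionsOn_iff (hU : IsOpen U) :
    x ∈ SectionsOn U E ↔ ∀ p ∈ U, GenNear p x ∧ x p ∈ E p :=
  ⟨fun h p hp => ⟨genNear_of_mem_sectionsOn hU h hp, h.2 p hp⟩,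
    fun h => ⟨smoothOn_of_genNear fun p hp => (h p hp).1, fun p hp => (h p hp).2⟩⟩

/-- Multiply by a bump function supported in `U`. Since brackets depend only on germs
(`dorfman_congr`), this lets hypotheses about global sections be applied to local ones. -/
lemma exists_section_germ [T2Space M] (hU : IsOpen U) (hp : p ∈ U) (hx : x ∈ SectionsOn U E) :
    ∃ x' ∈ Sections E, ∀ᶠ q in 𝓝 p, x' q = x q := by
  obtain ⟨χ, -, hχ⟩ := (SmoothBumpFunction.nhds_basis_tsupport (I := 𝓘(ℝ, F)) p).mem_iff.1
    (hU.mem_nhds hp)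
  have hsm : ∀ q, FunNear F q χ := fun q => Eventually.of_forall fun r => χ.contMDiff.contMDiffAt
  refine ⟨fun q => χ q • x q, mem_sections_iff.2 fun q => ?_, ?_⟩
  · by_cases hq : q ∈ U
    · have := (mem_sectionsOn_iff hU).1 hx q hq
      exact ⟨this.1.smul (hsm q), (E q).smul_mem _ this.2⟩
    · have h0 : ∀ᶠ r in 𝓝 q, χ r • x r = (0 : GenField F M) r := by
        have : q ∉ tsupport χ := fun h => hq (hχ h)
        filter_upwards [(isClosed_tsupport χ).isOpen_compl.mem_nhds this] with r hr
        rw [image_eq_zero_of_notMem_tsupport hr, zero_smul]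
        rfl
      refine ⟨GenNear.zero.congr h0, ?_⟩
      rw [h0.self_of_nhds]
      exact (E q).zero_mem
  · filter_upwards [χ.eventuallyEq_one] with q hq
    rw [hq]
    exact one_smul _ _

lemma exists_genNear (p : M) (v : GenTangent F p) : ∃ x : GenField F M, GenNear p x ∧ x p = v := by
  obtain ⟨X, hX, h1⟩ := exists_fieldNear p v.1
  obtain ⟨α, hα, h2⟩ := exists_formNear p v.2
  exact ⟨fun q => (X q, α q), ⟨hX, hα⟩, Prod.ext h1 h2⟩

lemma pairing_eq_zero {a : GenTangent F p} (h : ∀ b, pairing p a b = 0) : a = 0 := by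
  have h1 : a.2 = 0 := ContinuousLinearMap.ext fun v => by
    have := h (v, 0)
    rw [pairing_apply] at this
    simpa using this
  have h2 : a.1 = 0 := by
    let w : F := a.1
    by_contra h0
    have h0' : w ≠ 0 := h0
    obtain ⟨β, hβ⟩ := SeparatingDual.exists_ne_zero (R := ℝ) h0'
    have h3 : (1 / 2 : ℝ) * (a.2 0 + β w) = 0 := h (0, β)
    rw [map_zero, zero_add] at h3
    exact hβ (by linarith)
  exact Prod.ext h2 h1

lemma pairing_nondegenerate (p : M) : (pairing p : LinearMap.BilinForm ℝ (GenTangent F p)).Nondegenerate :=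
  ⟨fun _ h => pairing_eq_zero h, fun _ h => pairing_eq_zero fun b => by
    rw [pairing_comm]; exact h b⟩

/-- By nondegeneracy of the pairing, the coordinate functionals of the family, extended to the whole
fibre, are represented by vectors. -/
lemma exists_dual_family {ι : Type*} [DecidableEq ι] {v : ι → GenTangent F p} (hv : LinearIndependent ℝ v) :
    ∃ c : ι → GenTangent F p, ∀ i j, pairing p (v i) (c j) = if i = j then 1 else 0 := by
  have h : ∀ j, ∃ c, ∀ i, pairing p (v i) c = if i = j then 1 else 0 := fun j => by
    obtain ⟨l, hl⟩ := ((Module.Basis.span hv).coord j).exists_extend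
    refine ⟨((pairing p).toDual (pairing_nondegenerate p)).symm l, fun i => ?_⟩
    rw [pairing_comm, LinearMap.BilinForm.apply_toDual_symm_apply]
    have h1 := congr($hl ⟨v i, Submodule.subset_span ⟨i, rfl⟩⟩)
    have h2 : (Module.Basis.span hv) i = ⟨v i, Submodule.subset_span ⟨i, rfl⟩⟩ :=
      Module.Basis.span_apply hv i
    rw [← h2] at h1
    simp only [Module.Basis.coord_apply, Module.Basis.repr_self, Finsupp.single_apply] at h1
    rw [← h1, h2]
    rfl
  choose c hc using h
  exact ⟨c, fun i j => hc j i⟩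

lemma FunNear.det {ι : Type*} [Fintype ι] [DecidableEq ι] {A : M → Matrix ι ι ℝ}
    (h : ∀ i j, FunNear F p (fun q => A q i j)) : FunNear F p (fun q => (A q).det) := by
  simp_rw [Matrix.det_apply']
  exact FunNear.sum fun σ _ => (FunNear.const _).mul (FunNear.prod fun i _ => h _ _)

/-- Cramer's rule. Extend vectors dual to the `e i p` to smooth sections `d i`; the matrix of
pairings of the `e j` with the `d i` is the identity at `p`, hence invertible nearby, and the
coefficients of `x` are quotients of determinants of smooth functions. -/
lemma exists_coeff {ι : Type*} [Fintype ι] {e : ι → GenField F M} (he : ∀ i, GenNear p (e i))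
    (hli : LinearIndependent ℝ fun i => e i p) (hx : GenNear p x)
    (hxe : ∀ᶠ q in 𝓝 p, x q ∈ Submodule.span ℝ (Set.range fun i => e i q)) :
    ∃ f : ι → M → ℝ, (∀ i, FunNear F p (f i)) ∧
      ∀ᶠ q in 𝓝 p, x q = ∑ i, f i q • e i q := by
  classical
  obtain ⟨c, hc⟩ := exists_dual_family hli
  choose d hd hdc using fun j => exists_genNear p (c j)
  let A : M → Matrix ι ι ℝ := fun q i j => pair (e j) (d i) q
  have hA : ∀ i j, FunNear F p (fun q => A q i j) := fun i j => (he j).pair (hd i)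
  have hdet : FunNear F p (fun q => (A q).det) := FunNear.det hA
  have hAp : A p = 1 := by
    ext i j
    simp only [A, pair, hdc, hc, Matrix.one_apply]
    simp [eq_comm]
  have h0 : (A p).det ≠ 0 := by rw [hAp]; simp
  let b : M → ι → ℝ := fun q i => pair x (d i) q
  refine ⟨fun i q => ((A q).det)⁻¹ * ((A q).updateCol i (b q)).det, fun i => ?_, ?_⟩
  · refine (hdet.inv h0).mul (FunNear.det fun k l => ?_)
    by_cases hl : l = i
    · subst hl
      simpa using hx.pair (hd k)
    · simpa [Matrix.updateCol_apply, hl] using hA k l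
  · filter_upwards [hxe, hdet.self_of_nhds.continuousAt.eventually_ne h0] with q h1 h2
    obtain ⟨a, ha⟩ := (Submodule.mem_span_range_iff_exists_fun ℝ).1 h1
    have hb : b q = (A q).mulVec a := by
      ext i
      simp only [b, A, pair, ← ha, Matrix.mulVec, dotProduct, map_sum, LinearMap.sum_apply, map_smul,
        LinearMap.smul_apply, smul_eq_mul]
      exact Finset.sum_congr rfl fun _ _ => mul_comm _ _
    have hcr : ∀ i, ((A q).updateCol i (b q)).det = (A q).det * a i := fun i => by
      rw [← Matrix.cramer_apply, hb, Matrix.cramer_eq_adjugate_mulVec, Matrix.mulVec_mulVec,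
        Matrix.adjugate_mul, Matrix.smul_mulVec, Matrix.one_mulVec]
      rfl
    rw [← ha]
    refine Finset.sum_congr rfl fun i _ => ?_
    rw [hcr, inv_mul_cancel_left₀ h2]

lemma dorfman_smul_left (hf : FunNear F p f) (hx : GenNear p x) (hy : GenNear p y) :
    dorfman (fun q => f q • x q) y p = f p • dorfman x y p - anchorDeriv y f p • x p
      + ((0, (2 * pair x y p) • funDeriv f p) : GenTangent F p) := by
  have h1 : funDeriv (F := F) (pair (fun q => f q • x q) y) p =
      f p • funDeriv (pair x y) p + pair x y p • funDeriv f p := by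
    have : pair (fun q => f q • x q) y = fun q => f q * pair x y q := by
      funext q
      simp [pair]
    rw [this]
    have := mvfderiv_mul (I := 𝓘(ℝ, F)) hf.mdiff (hx.pair hy).mdiff
    exact this
  rw [dorfman_symm (hx.smul hf) hy, dorfman_smul_right hf hy hx, dorfman_symm hx hy, h1]
  refine Prod.ext ?_ ?_
  · simp only [Prod.fst_add, Prod.fst_sub, Prod.fst_neg, Prod.smul_fst]
    module
  · simp only [Prod.snd_add, Prod.snd_sub, Prod.snd_neg, Prod.smul_snd]
    module

lemma dorfman_sum_right {ι : Type*} (s : Finset ι) {f : ι → M → ℝ} {e : ι → GenField F M}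
    (hf : ∀ i, FunNear F p (f i)) (hx : GenNear p x) (he : ∀ i, GenNear p (e i)) :
    dorfman x (fun q => ∑ i ∈ s, f i q • e i q) p =
      ∑ i ∈ s, (f i p • dorfman x (e i) p + anchorDeriv x (f i) p • e i p) := by
  classical
  induction s using Finset.induction_on with
  | empty =>
    have := dorfman_smul_right (f := fun _ => 0) (.const 0) hx hx
    simp only [zero_smul, zero_add] at this
    simp only [Finset.sum_empty]
    rw [this, anchorDeriv, lieFun_const, zero_smul]
  | insert a s ha ih =>
    simp_rw [Finset.sum_insert ha]
    rw [dorfman_add_right hx ((he a).smul (hf a)) (GenNear.sum fun i _ => (he i).smul (hf i)), ih,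
      dorfman_smul_right (hf a) hx (he a)]

lemma dorfman_zero_right (hx : GenNear p x) : dorfman x (0 : GenField F M) p = 0 := by
  have := dorfman_sum_right (∅ : Finset (Fin 0)) (f := fun _ _ => 0) (e := fun _ => x)
    (fun _ => .const 0) hx fun _ => hx
  simp only [Finset.sum_empty] at this
  exact this

lemma dorfman_eq_neg (hx : GenNear p x) (hy : GenNear p y) (h : ∀ᶠ q in 𝓝 p, pair x y q = 0) :
    dorfman x y p = - dorfman y x p := by
  have h1 : funDeriv (F := F) (pair x y) p = 0 := by
    have := (show pair x y =ᶠ[𝓝 p] fun _ => (0 : ℝ) from h).mfderiv_eq (I := 𝓘(ℝ, F)) (I' := 𝓘(ℝ, ℝ))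
    unfold funDeriv
    rw [this]
    exact mvfderiv_const (I := 𝓘(ℝ, F)) (0 : ℝ)
  rw [dorfman_symm hx hy, h1]
  simp

end Sections

/-! ### Signature, radical and isotropic subspaces -/

section Signature

variable {V : Type*} [AddCommGroup V] [Module ℝ V] [FiniteDimensional ℝ V]
variable {B : LinearMap.BilinForm ℝ V} {E L : Submodule ℝ V} {k : ℕ}

/-- The positive index, the negative index and the dimension of the radical add up to `2 * k`, so
the radical is zero. -/
lemma eq_zero_of_signature (hB : ∀ a b, B a b = B b a) (hE : Module.finrank ℝ E = 2 * k)
    (h1 : sigPos (B.toQuadraticMap.restrict E) = k)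
    (h2 : sigNeg (B.toQuadraticMap.restrict E) = k) :
    ∀ a ∈ E, (∀ b ∈ E, B a b = 0) → a = 0 := by
  intro a ha hb
  have h := QuadraticForm.sigPos_add_sigNeg_add_radical (Q := B.toQuadraticMap.restrict E)
  rw [h1, h2, hE] at h
  have h2 : (B.toQuadraticMap.restrict E).radical = ⊥ := Submodule.finrank_eq_zero.1 (by omega)
  have h3 : (⟨a, ha⟩ : E) ∈ (B.toQuadraticMap.restrict E).radical := by
    rw [QuadraticMap.mem_radical_iff']
    refine ⟨hb a ha, fun b => ?_⟩
    change B (a + b) (a + b) = B b b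
    simp only [map_add, LinearMap.add_apply, hb a ha, hb b b.2, hB b a]
    ring
  rw [h2, Submodule.mem_bot] at h3
  exact congrArg Subtype.val h3

lemma finrank_le_of_signature (B : LinearMap.BilinForm ℝ V) (hE : Module.finrank ℝ E = 2 * k)
    (h1 : sigPos (B.toQuadraticMap.restrict E) = k) (hL : L ≤ E) (h0 : ∀ a ∈ L, B a a = 0) :
    Module.finrank ℝ L ≤ k := by
  have h := QuadraticForm.sigPos_add_finrank_le_of_nonpos (Q := B.toQuadraticMap.restrict E)
    (V := L.comap E.subtype) fun a ha => (h0 _ ha).le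
  have h2 : Module.finrank ℝ (L.comap E.subtype) = Module.finrank ℝ L :=
    (Submodule.comapSubtypeEquivOfLe hL).finrank_eq
  omega

/-- A `k`-dimensional isotropic subspace meets every definite subspace trivially, so each index is
at most `k`; nondegeneracy makes them add up to `2 * k`. -/
lemma signature_of_isotropic (hB : ∀ a b, B a b = B b a) (hE : Module.finrank ℝ E = 2 * k)
    (h : ∀ a ∈ E, (∀ b ∈ E, B a b = 0) → a = 0) (hLE : L ≤ E) (hL : Module.finrank ℝ L = k)
    (h0 : ∀ a ∈ L, B a a = 0) :
    sigPos (B.toQuadraticMap.restrict E) = k ∧ sigNeg (B.toQuadraticMap.restrict E) = k := by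
  have h1 := QuadraticForm.sigPos_add_sigNeg_add_radical (Q := B.toQuadraticMap.restrict E)
  have h2 : (B.toQuadraticMap.restrict E).radical = ⊥ := by
    rw [Submodule.eq_bot_iff]
    intro a ha
    rw [QuadraticMap.mem_radical_iff'] at ha
    refine Subtype.ext (h a a.2 fun b hb => ?_)
    have h3 : B (a + b) (a + b) = B b b := ha.2 ⟨b, hb⟩
    have h4 : B a a = 0 := ha.1
    simp only [map_add, LinearMap.add_apply, h4, hB b a] at h3
    linarith
  rw [h2, finrank_bot, hE] at h1
  have h3 : Module.finrank ℝ (L.comap E.subtype) = k :=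
    (Submodule.comapSubtypeEquivOfLe hLE).finrank_eq.trans hL
  have h4 := QuadraticForm.sigPos_add_finrank_le_of_nonpos (Q := B.toQuadraticMap.restrict E)
    (V := L.comap E.subtype) fun a ha => (h0 _ ha).le
  have h5 := QuadraticForm.sigPos_add_finrank_le_of_nonpos (Q := - B.toQuadraticMap.restrict E)
    (V := L.comap E.subtype) fun a ha => by
      change - B a a ≤ 0
      exact (neg_eq_zero.2 (h0 _ ha)).le
  rw [h3, hE] at h4 h5
  rw [sigPos_neg] at h5
  omega

end Signature

/-! ### Germs of sections, local frames, and fibrewise orthogonality -/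

section Germs

variable {F : Type*} [NormedAddCommGroup F] [NormedSpace ℝ F]
variable {M : Type*} [TopologicalSpace M] [ChartedSpace F M]

/-- The tautological inner product is nondegenerate on the fibre of `E` at `p`. -/
def NondegAt (E : FibreFamily F M) (p : M) : Prop :=
  ∀ a ∈ E p, (∀ b ∈ E p, pairing p a b = 0) → a = 0

variable [FiniteDimensional ℝ F] [IsManifold 𝓘(ℝ, F) ∞ M]

/-- `x` is a smooth section of `E` on a neighbourhood of `p`. -/
def SecNear (E : FibreFamily F M) (p : M) (x : GenField F M) : Prop :=
  GenNear p x ∧ ∀ᶠ q in 𝓝 p, x q ∈ E q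

/-- `e` is a smooth framing of `E` on a neighbourhood of `p`. -/
def FrameAt {ι : Type*} (E : FibreFamily F M) (p : M) (e : ι → GenField F M) : Prop :=
  (∀ i, GenNear p (e i)) ∧ ∀ᶠ q in 𝓝 p, LinearIndependent ℝ (fun i => e i q) ∧
    Submodule.span ℝ (Set.range fun i => e i q) = E q

variable {U : Set M} {p : M} {f g : M → ℝ} {x y z v : GenField F M} {E E' E'' : FibreFamily F M}

lemma SecNear.eventually (h : SecNear E p x) : ∀ᶠ q in 𝓝 p, SecNear E q x :=
  (GenNear.eventually h.1).and (eventually_eventually_nhds.2 h.2)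

lemma SecNear.mem (h : SecNear E p x) : x p ∈ E p := h.2.self_of_nhds

lemma SecNear.mono (h : SecNear E p x) (hE : ∀ q, E q ≤ E' q) : SecNear E' p x :=
  ⟨h.1, h.2.mono fun q => @hE q _⟩

lemma SecNear.add (hx : SecNear E p x) (hy : SecNear E p y) : SecNear E p (fun q => x q + y q) :=
  ⟨GenNear.add hx.1 hy.1, by filter_upwards [hx.2, hy.2] with q h1 h2 using add_mem h1 h2⟩

lemma SecNear.smul (hf : FunNear F p f) (hx : SecNear E p x) : SecNear E p (fun q => f q • x q) :=
  ⟨GenNear.smul hf hx.1, by filter_upwards [hx.2] with q h1 using Submodule.smul_mem _ _ h1⟩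

lemma SecNear.congr (hx : SecNear E p x) (h : ∀ᶠ q in 𝓝 p, y q = x q) : SecNear E p y :=
  ⟨GenNear.congr hx.1 h, by filter_upwards [hx.2, h] with q h1 h2 using h2 ▸ h1⟩

lemma mem_sections_iff_secNear : x ∈ Sections E ↔ ∀ p, SecNear E p x := by
  rw [mem_sections_iff]
  exact ⟨fun h p => ⟨(h p).1, Eventually.of_forall fun q => (h q).2⟩, fun h p => ⟨(h p).1, (h p).mem⟩⟩

lemma mem_sectionsOn_iff_secNear (hU : IsOpen U) :
    x ∈ SectionsOn U E ↔ ∀ p ∈ U, SecNear E p x := by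
  rw [mem_sectionsOn_iff hU]
  exact ⟨fun h p hp => ⟨(h p hp).1, by filter_upwards [hU.mem_nhds hp] with q hq using (h q hq).2⟩,
    fun h p hp => ⟨(h p hp).1, (h p hp).mem⟩⟩

lemma SecNear.exists_open (h : SecNear E p x) :
    ∃ U : Set M, IsOpen U ∧ p ∈ U ∧ x ∈ SectionsOn U E := by
  obtain ⟨U, hU, hUo, hp⟩ := eventually_nhds_iff.1 h.eventually
  exact ⟨U, hUo, hp, (mem_sectionsOn_iff_secNear hUo).2 hU⟩

lemma SecNear.exists_section [T2Space M] (h : SecNear E p x) :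
    ∃ x' ∈ Sections E, ∀ᶠ q in 𝓝 p, x' q = x q := by
  obtain ⟨U, hU, hp, hx⟩ := h.exists_open
  exact exists_section_germ hU hp hx

lemma FrameAt.eventually {ι : Type*} [Finite ι] {e : ι → GenField F M} (h : FrameAt E p e) :
    ∀ᶠ q in 𝓝 p, FrameAt E q e :=
  (eventually_all.2 fun i => (h.1 i).eventually).and (eventually_eventually_nhds.2 h.2)

lemma FrameAt.secNear {ι : Type*} {e : ι → GenField F M} (h : FrameAt E p e) (i : ι) :
    SecNear E p (e i) :=
  ⟨h.1 i, h.2.mono fun _ hq => hq.2 ▸ Submodule.subset_span ⟨i, rfl⟩⟩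

lemma FrameAt.span_eq {ι : Type*} {e : ι → GenField F M} (h : FrameAt E p e) :
    Submodule.span ℝ (Set.range fun i => e i p) = E p := h.2.self_of_nhds.2

lemma FrameAt.linearIndependent {ι : Type*} {e : ι → GenField F M} (h : FrameAt E p e) :
    LinearIndependent ℝ fun i => e i p := h.2.self_of_nhds.1

lemma FrameAt.finrank {ι : Type*} [Fintype ι] {e : ι → GenField F M} (h : FrameAt E p e) :
    Module.finrank ℝ (E p) = Fintype.card ι := by
  rw [← h.span_eq, finrank_span_eq_card h.linearIndependent]

lemma FrameAt.exists_coeff {ι : Type*} [Fintype ι] {e : ι → GenField F M} (h : FrameAt E p e)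
    (hx : SecNear E p x) : ∃ f : ι → M → ℝ, (∀ i, FunNear F p (f i)) ∧
      ∀ᶠ q in 𝓝 p, x q = ∑ i, f i q • e i q := by
  refine GenGeom.exists_coeff h.1 h.linearIndependent hx.1 ?_
  filter_upwards [h.2, hx.2] with q h1 h2
  rw [h1.2]
  exact h2

/-- A bracket with a section of `E` lies in a subspace that contains `E p` and the brackets with
the elements of a framing. -/
lemma FrameAt.dorfman_mem {ι : Type*} [Fintype ι] {e : ι → GenField F M} (h : FrameAt E p e)
    (hx : SecNear E p x) (hv : GenNear p v) {S : Submodule ℝ (GenTangent F p)}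
    (h1 : ∀ i, dorfman v (e i) p ∈ S) (h2 : ∀ i, e i p ∈ S) : dorfman v x p ∈ S := by
  obtain ⟨f, hf, hfx⟩ := h.exists_coeff hx
  rw [dorfman_congr (Eventually.of_forall fun _ => rfl) hfx hv
    (GenNear.sum fun i _ => (h.1 i).smul (hf i)), dorfman_sum_right _ hf hv h.1]
  exact Submodule.sum_mem _ fun i _ => add_mem (S.smul_mem _ (h1 i)) (S.smul_mem _ (h2 i))

lemma IsSubbundle.exists_frameAt {r : ℕ} (h : IsSubbundle r E) (p : M) :
    ∃ e : Fin r → GenField F M, FrameAt E p e := by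
  obtain ⟨U, hU, hp, e, he, h2⟩ := h p
  refine ⟨e, fun i => (he i).genNear hU hp, ?_⟩
  filter_upwards [hU.mem_nhds hp] with q hq using h2 q hq

lemma isSubbundle_of_frameAt {r : ℕ} (h : ∀ p, ∃ e : Fin r → GenField F M, FrameAt E p e) :
    IsSubbundle r E := by
  intro p
  obtain ⟨e, he⟩ := h p
  obtain ⟨U, hU, hUo, hp⟩ := eventually_nhds_iff.1 he.eventually
  exact ⟨U, hUo, hp, e, fun i => smoothOn_of_genNear fun q hq => (hU q hq).1 i,
    fun q hq => ⟨(hU q hq).linearIndependent, (hU q hq).span_eq⟩⟩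

lemma IsSubbundle.finrank {r : ℕ} (h : IsSubbundle r E) (p : M) :
    Module.finrank ℝ (E p) = r := by
  obtain ⟨e, he⟩ := h.exists_frameAt p
  simpa using he.finrank

lemma IsSubbundle.exists_section [T2Space M] {r : ℕ} (h : IsSubbundle r E) {a : GenTangent F p}
    (ha : a ∈ E p) : ∃ x ∈ Sections E, x p = a := by
  obtain ⟨e, he⟩ := h.exists_frameAt p
  rw [← he.span_eq] at ha
  obtain ⟨c, rfl⟩ := (Submodule.mem_span_range_iff_exists_fun ℝ).1 ha
  have h1 : SecNear E p (fun q => ∑ i, c i • e i q) := by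
    refine ⟨GenNear.sum fun i _ => (he.1 i).smul (.const (c i)), ?_⟩
    filter_upwards [he.eventually] with q hq
    exact Submodule.sum_mem _ fun i _ => Submodule.smul_mem _ _ (hq.secNear i).mem
  obtain ⟨x, hx, hxe⟩ := h1.exists_section
  exact ⟨x, hx, hxe.self_of_nhds⟩

/-- Replace the germ of `x` by a global section with the same germ; the brackets then agree near
`p`. Thus normalizer conditions, stated for global sections, localize. -/
lemma dorfman_secNear_of_sections [T2Space M] (hv : ∀ p, GenNear p v)
    (h : ∀ x ∈ Sections E, dorfman v x ∈ Sections E') (hx : SecNear E p x) :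
    SecNear E' p (dorfman v x) := by
  obtain ⟨x', hx', he⟩ := hx.exists_section
  refine (mem_sections_iff_secNear.1 (h x' hx') p).congr ?_
  filter_upwards [eventually_eventually_nhds.2 he] with q hq
  exact dorfman_congr (Eventually.of_forall fun _ => rfl) (hq.mono fun _ h => h.symm) (hv q)
    (genNear_of_mem_sections hx' q)

lemma dorfman_secNear_of_sections₂ [T2Space M]
    (h : ∀ x ∈ Sections E, ∀ y ∈ Sections E', dorfman x y ∈ Sections E'') (hx : SecNear E p x)
    (hy : SecNear E' p y) : SecNear E'' p (dorfman x y) := by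
  obtain ⟨x', hx', he⟩ := hx.exists_section
  obtain ⟨y', hy', hf⟩ := hy.exists_section
  refine (mem_sections_iff_secNear.1 (h x' hx' y' hy') p).congr ?_
  filter_upwards [eventually_eventually_nhds.2 he, eventually_eventually_nhds.2 hf] with q h1 h2
  exact dorfman_congr (h1.mono fun _ h => h.symm) (h2.mono fun _ h => h.symm)
    (genNear_of_mem_sections hx' q) (genNear_of_mem_sections hy' q)

lemma dorfman_eq_zero_right (hx : GenNear p x) (hy : ∀ᶠ q in 𝓝 p, y q = 0) :
    dorfman x y p = 0 := by
  rw [dorfman_congr (y' := (0 : GenField F M)) (Eventually.of_forall fun _ => rfl) hy hx .zero,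
    dorfman_zero_right hx]

lemma dorfman_zero_left (hy : GenNear p y) : dorfman (0 : GenField F M) y p = 0 := by
  rw [dorfman_eq_neg .zero hy (Eventually.of_forall fun q => by simp [pair]), dorfman_zero_right hy,
    neg_zero]

lemma dorfman_eq_zero_left (hy : GenNear p y) (hx : ∀ᶠ q in 𝓝 p, x q = 0) :
    dorfman x y p = 0 := by
  rw [dorfman_congr (x' := (0 : GenField F M)) hx (Eventually.of_forall fun _ => rfl) .zero hy,
    dorfman_zero_left hy]

lemma anchorDeriv_eq_zero (h : ∀ᶠ q in 𝓝 p, f q = 0) : anchorDeriv x f p = 0 := by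
  unfold anchorDeriv
  rw [lieFun_congr (g := fun _ => 0) h, lieFun_const]

lemma dorfman_neg_right (hx : GenNear p x) (hy : GenNear p y) :
    dorfman x (-y) p = - dorfman x y p := by
  have := dorfman_smul_right (.const (-1)) hx hy
  rw [anchorDeriv, lieFun_const, zero_smul, add_zero] at this
  exact (dorfman_congr (Eventually.of_forall fun _ => rfl)
    (Eventually.of_forall fun q => (neg_one_smul ℝ (y q)).symm) hx
      (hy.smul (.const (-1)))).trans (this.trans (neg_one_smul ℝ (dorfman x y p : GenTangent F p)))

lemma dorfman_const_smul_right (c : ℝ) (hx : GenNear p x) (hy : GenNear p y) :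
    dorfman x (fun q => c • y q) p = c • dorfman x y p := by
  rw [dorfman_smul_right (.const c) hx hy, anchorDeriv, lieFun_const, zero_smul, add_zero]

lemma dorfman_const_smul_left (c : ℝ) (hx : GenNear p x) (hy : GenNear p y) :
    dorfman (fun q => c • x q) y p = c • dorfman x y p := by
  have h1 : funDeriv (F := F) (fun _ : M => c) p = 0 := mvfderiv_const (I := 𝓘(ℝ, F)) c
  have h2 := dorfman_smul_left (.const c) hx hy
  rw [anchorDeriv, lieFun_const, h1] at h2
  rw [h2]
  refine Prod.ext ?_ ?_
  · simp only [Prod.fst_add, Prod.smul_fst, zero_smul, sub_zero, add_zero]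
  · simp only [Prod.snd_add, Prod.smul_snd, zero_smul, sub_zero, smul_zero, add_zero]

lemma funDeriv_add (hf : FunNear F p f) (hg : FunNear F p g) :
    funDeriv (F := F) (fun q => f q + g q) p = funDeriv f p + funDeriv g p := by
  have := mvfderiv_add (I := 𝓘(ℝ, F)) hf.mdiff hg.mdiff
  exact this

lemma pair_add_left : pair (fun q => x q + y q) z = fun q => pair x z q + pair y z q :=
  funext fun _ => LinearMap.map_add₂ _ _ _ _

lemma dorfman_add_left (hx : GenNear p x) (hy : GenNear p y) (hz : GenNear p z) :
    dorfman (fun q => x q + y q) z p = dorfman x z p + dorfman y z p := by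
  rw [dorfman_symm (hx.add hy) hz, dorfman_add_right hz hx hy, dorfman_symm hx hz,
    dorfman_symm hy hz, pair_add_left, funDeriv_add (hx.pair hz) (hy.pair hz)]
  refine Prod.ext ?_ ?_
  · simp only [Prod.fst_add, Prod.fst_neg, add_zero, neg_add]
  · simp only [Prod.snd_add, Prod.snd_neg, smul_add, neg_add]
    exact add_add_add_comm _ _ _ _

/-! ### Fibrewise linear algebra -/

lemma IsSplit.nondegAt {k : ℕ} (h : IsSplit k E) (p : M) : NondegAt E p :=
  eq_zero_of_signature (pairing_comm p) (h.1.finrank p) (h.2 p).1 (h.2 p).2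

lemma IsSplit.finrank_le_of_isotropic {k : ℕ} (h : IsSplit k E) {S : Submodule ℝ (GenTangent F p)}
    (hS : S ≤ E p) (h0 : ∀ a ∈ S, pairing p a a = 0) : Module.finrank ℝ S ≤ k :=
  finrank_le_of_signature (pairing p) (h.1.finrank p) (h.2 p).1 hS h0

lemma isSplit_of_isotropic {k : ℕ} (h : IsSubbundle (2 * k) E) (hE : ∀ p, NondegAt E p)
    {L : FibreFamily F M} (hLE : ∀ p, L p ≤ E p) (hL : ∀ p, Module.finrank ℝ (L p) = k)
    (h0 : Orthogonal L L) : IsSplit k E :=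
  ⟨h, fun p => signature_of_isotropic (pairing_comm p) (h.finrank p) (hE p) (hLE p) (hL p)
    fun a ha => h0 p a ha a ha⟩

lemma Orthogonal.symm (h : Orthogonal E E') : Orthogonal E' E := fun p x hx y hy => by
  rw [pairing_comm]; exact h p y hy x hx

lemma Orthogonal.sup_left (h : Orthogonal E E'') (h' : Orthogonal E' E'') :
    Orthogonal (E ⊔ E') E'' := fun p x hx y hy => by
  obtain ⟨a, ha, b, hb, rfl⟩ := Submodule.mem_sup.1 hx
  rw [map_add, LinearMap.add_apply, h p a ha y hy, h' p b hb y hy, add_zero]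

lemma Orthogonal.sup_right (h : Orthogonal E E') (h' : Orthogonal E E'') :
    Orthogonal E (E' ⊔ E'') := (h.symm.sup_left h'.symm).symm

lemma Orthogonal.mono {A B : FibreFamily F M} (h : Orthogonal E E') (hA : ∀ p, A p ≤ E p)
    (hB : ∀ p, B p ≤ E' p) : Orthogonal A B := fun p x hx y hy => h p x (hA p hx) y (hB p hy)

/-- The `E'`-component of `a` is orthogonal to `E'`, hence zero. Membership in a summand is thereby
tested by pairings. -/
lemma Orthogonal.mem_left (h : Orthogonal E E') (hE : NondegAt E' p) {a : GenTangent F p}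
    (ha : a ∈ E p ⊔ E' p) (h0 : ∀ b ∈ E' p, pairing p a b = 0) : a ∈ E p := by
  obtain ⟨c, hc, d, hd, rfl⟩ := Submodule.mem_sup.1 ha
  have : d = 0 := hE d hd fun b hb => by
    have := h0 b hb
    rwa [map_add, LinearMap.add_apply, h p c hc b hb, zero_add] at this
  rwa [this, add_zero]

lemma Orthogonal.nondegAt_left (h : Orthogonal E E') (hE : NondegAt (E ⊔ E') p) :
    NondegAt E p := fun a ha h0 =>
  hE a (Submodule.mem_sup_left ha) fun b hb => by
    obtain ⟨c, hc, d, hd, rfl⟩ := Submodule.mem_sup.1 hb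
    rw [map_add, h0 c hc, h p a ha d hd, add_zero]

lemma pairing_span_eq_zero {s : Set (GenTangent F p)} {a b : GenTangent F p}
    (h : ∀ c ∈ s, pairing p a c = 0) (hb : b ∈ Submodule.span ℝ s) : pairing p a b = 0 := by
  have h1 : Submodule.span ℝ s ≤ LinearMap.ker (pairing p a) := Submodule.span_le.2 h
  exact h1 hb

end Germs

/-! ### Finite-dimensional spaces of sections -/

section LinearAlgebra

variable {X Y : Type*} [AddCommGroup X] [Module ℝ X] [AddCommGroup Y] [Module ℝ Y]

/-- Equality of dimensions makes `f` injective on `T`, so `S` has the same dimension as its image.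
The map `f` will be evaluation at a point. -/
lemma exists_eq_span_singleton {S T : Submodule ℝ X} [FiniteDimensional ℝ T] {f : X →ₗ[ℝ] Y}
    (hS : S ≤ T) (hf : Module.finrank ℝ T = Module.finrank ℝ (T.map f))
    (h1 : Module.finrank ℝ (S.map f) ≤ 1) : ∃ v, S = Submodule.span ℝ {v} := by
  have : FiniteDimensional ℝ S := Submodule.finiteDimensional_of_le hS
  have hinj : Function.Injective (f.domRestrict T) := by
    rw [← LinearMap.ker_eq_bot, ← Submodule.finrank_eq_zero (R := ℝ)]
    have h3 := LinearMap.finrank_range_add_finrank_ker (f.domRestrict T)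
    rw [LinearMap.range_domRestrict, ← hf] at h3
    exact Nat.add_eq_left.1 h3
  have hinj' : Function.Injective (f.domRestrict S) := fun a b hab =>
    Subtype.ext (congrArg (Subtype.val : T → X) (@hinj ⟨a, hS a.2⟩ ⟨b, hS b.2⟩ hab))
  have h4 : Module.finrank ℝ S ≤ 1 := by
    rwa [← LinearMap.finrank_range_of_inj hinj', LinearMap.range_domRestrict]
  obtain ⟨v, hv⟩ := finrank_le_one_iff.1 h4
  refine ⟨v, le_antisymm (fun x hx => ?_) ((Submodule.span_singleton_le_iff_mem _ _).2 v.2)⟩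
  obtain ⟨c, hc⟩ := hv ⟨x, hx⟩
  exact Submodule.mem_span_singleton.2 ⟨c, congrArg Subtype.val hc⟩

lemma exists_span_range_eq (K : Submodule ℝ X) [FiniteDimensional ℝ K] :
    ∃ b : Fin (Module.finrank ℝ K) → X, (∀ i, b i ∈ K) ∧ Submodule.span ℝ (Set.range b) = K := by
  let b := Module.finBasis ℝ K
  refine ⟨fun i => b i, fun i => (b i).2, ?_⟩
  have := congrArg (Submodule.map K.subtype) b.span_eq
  rw [Submodule.map_span, Submodule.map_top, Submodule.range_subtype, ← Set.range_comp] at this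
  exact this

end LinearAlgebra

/-! ### Combining frames, and generators of a hyperbolic plane bundle -/

section Generators

variable {F : Type*} [NormedAddCommGroup F] [NormedSpace ℝ F] [FiniteDimensional ℝ F]
variable {M : Type*} [TopologicalSpace M] [ChartedSpace F M] [IsManifold 𝓘(ℝ, F) ∞ M]
variable {p : M} {u v w x y : GenField F M} {A B E E' L : FibreFamily F M}
variable {V W : Submodule ℝ (GenField F M)} {U : Set M}

lemma spanBundle_singleton (v : GenField F M) (p : M) :
    spanBundle (Submodule.span ℝ {v}) p = Submodule.span ℝ {v p} := by
  rw [spanBundle, Submodule.map_span, Set.image_singleton]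
  rfl

lemma FrameAt.sup {ι κ : Type*} {e : ι → GenField F M} {f : κ → GenField F M}
    (he : FrameAt A p e) (hf : FrameAt B p f) (hd : ∀ q, Disjoint (A q) (B q)) :
    FrameAt (A ⊔ B) p (Sum.elim e f) := by
  refine ⟨fun i => by cases i; exacts [he.1 _, hf.1 _], ?_⟩
  filter_upwards [he.2, hf.2] with q h1 h2
  have h3 : (fun i => Sum.elim e f i q) = Sum.elim (fun i => e i q) (fun i => f i q) := by
    funext i
    cases i <;> rfl
  rw [h3]
  refine ⟨h1.1.sum_type h2.1 ?_, ?_⟩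
  · rw [h1.2, h2.2]
    exact hd q
  · rw [Set.Sum.elim_range, Submodule.span_union, h1.2, h2.2]
    rfl

lemma FrameAt.of_span_eq {ι : Type*} [Fintype ι] {e : ι → GenField F M} {r : ℕ}
    (hA : IsSubbundle r A) (hr : Fintype.card ι = r) (he : ∀ i, GenNear p (e i))
    (hs : ∀ᶠ q in 𝓝 p, Submodule.span ℝ (Set.range fun i => e i q) = A q) : FrameAt A p e := by
  refine ⟨he, hs.mono fun q hq => ⟨?_, hq⟩⟩
  rw [linearIndependent_iff_card_eq_finrank_span, Set.finrank, hq, hA.finrank, hr]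

lemma FrameAt.reindex {ι κ : Type*} {e : ι → GenField F M} (h : FrameAt A p e) (g : κ ≃ ι) :
    FrameAt A p (e ∘ g) := by
  refine ⟨fun i => h.1 _, h.2.mono fun q hq => ⟨hq.1.comp g g.injective, ?_⟩⟩
  rw [← hq.2]
  exact congrArg _ (g.surjective.range_comp fun i => e i q)

lemma FrameAt.isSubbundle {r : ℕ} (h : ∀ p, ∃ (ι : Type) (_ : Fintype ι) (e : ι → GenField F M),
    Fintype.card ι = r ∧ FrameAt A p e) : IsSubbundle r A := by
  refine isSubbundle_of_frameAt fun p => ?_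
  obtain ⟨ι, _, e, rfl, he⟩ := h p
  exact ⟨_, he.reindex (Fintype.equivFin ι).symm⟩

/-- Bracket with a section that maps a framing of `A` into `B ⊇ A`. -/
lemma FrameAt.dorfman_secNear {ι : Type*} [Fintype ι] {e : ι → GenField F M} (h : FrameAt A p e)
    (hx : SecNear A p x) (hv : GenNear p v) (hAB : ∀ q, A q ≤ B q)
    (h1 : ∀ᶠ q in 𝓝 p, ∀ i, dorfman v (e i) q ∈ B q) : SecNear B p (dorfman v x) := by
  refine ⟨hv.dorfman hx.1, ?_⟩
  filter_upwards [h.eventually, hx.eventually, hv.eventually, h1] with q h2 h3 h4 h5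
  exact h2.dorfman_mem h3 h4 h5 fun i => hAB q (h2.secNear i).mem

/-- An isotropic bundle is involutive as soon as the brackets of the elements of a framing are
sections of it. -/
lemma FrameAt.dorfman_mem_of_isotropic {ι : Type*} [Fintype ι] {e : ι → GenField F M}
    (h : FrameAt A p e) (hA : Orthogonal A A) (h1 : ∀ i j, dorfman (e i) (e j) p ∈ A p)
    (hx : SecNear A p x) (hy : SecNear A p y) : dorfman x y p ∈ A p := by
  refine h.dorfman_mem hy hx.1 (fun j => ?_) fun i => (h.secNear i).mem
  rw [dorfman_eq_neg hx.1 (h.1 j)]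
  · exact neg_mem (h.dorfman_mem hx (h.1 j) (fun i => h1 j i) fun i => (h.secNear i).mem)
  · filter_upwards [hx.2, (h.secNear j).2] with q h2 h3 using hA q _ h2 _ h3

/-- `v`, `w` are isotropic generators of the hyperbolic plane bundle `E'`. -/
structure SplitGens (E' : FibreFamily F M) (v w : GenField F M) : Prop where
  near_left : ∀ p, GenNear p v
  near_right : ∀ p, GenNear p w
  left_left : ∀ p, pairing p (v p) (v p) = 0
  right_right : ∀ p, pairing p (w p) (w p) = 0
  ne_zero : ∀ p, pairing p (v p) (w p) ≠ 0
  span_eq : ∀ p, E' p = Submodule.span ℝ {v p} ⊔ Submodule.span ℝ {w p}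

/-- Evaluation at a point is injective on a framing and maps `V` and `W` to isotropic subspaces of a
plane of signature `(1, 1)`, which have dimension at most one. -/
lemma IsSplitFraming.exists_generators (hE : IsSplit 1 E') (h : IsSplitFraming E' V W) :
    ∃ v w, V = Submodule.span ℝ {v} ∧ W = Submodule.span ℝ {w} := by
  obtain ⟨hV, hW, -, -, hfin, hfr⟩ := h
  have key : ∀ S ≤ V ⊔ W, (∀ x ∈ S, ∀ y ∈ S, ∀ p, pairing p (x p) (y p) = 0) →
      ∃ v, S = Submodule.span ℝ {v} := by
    intro S hS h0
    rcases isEmpty_or_nonempty M with hM | ⟨⟨p⟩⟩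
    -- Over the empty manifold zero is the only section.
    · exact ⟨0, Subsingleton.elim _ _⟩
    obtain ⟨h1, h2⟩ := hfr p trivial
    refine exists_eq_span_singleton (f := LinearMap.proj p) hS (by rw [h2]; exact h1) ?_
    refine hE.finrank_le_of_isotropic (p := p) ((Submodule.map_mono hS).trans h2.le) ?_
    rintro _ ⟨x, hx, rfl⟩
    exact h0 x hx x hx p
  obtain ⟨v, hv⟩ := key V le_sup_left hV
  obtain ⟨w, hw⟩ := key W le_sup_right hW
  exact ⟨v, w, hv, hw⟩

lemma IsSplitFraming.splitGens (hE : IsSplit 1 E')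
    (h : IsSplitFraming E' (Submodule.span ℝ {v}) (Submodule.span ℝ {w})) : SplitGens E' v w := by
  obtain ⟨hV, hW, -, hsec, hfin, hfr⟩ := h
  have hv := Submodule.mem_span_singleton_self (R := ℝ) v
  have hw := Submodule.mem_span_singleton_self (R := ℝ) w
  have hsp : ∀ p, E' p = Submodule.span ℝ {v p} ⊔ Submodule.span ℝ {w p} := fun p => by
    rw [← (hfr p trivial).2, Submodule.map_sup, ← spanBundle_singleton, ← spanBundle_singleton]
    rfl
  refine ⟨fun p => genNear_of_mem_sections (hsec (Submodule.mem_sup_left hv)) p,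
    fun p => genNear_of_mem_sections (hsec (Submodule.mem_sup_right hw)) p,
    fun p => hV v hv v hv p, fun p => hW w hw w hw p, fun p h0 => ?_, hsp⟩
  -- If `v p` and `w p` were orthogonal, the whole fibre would be isotropic, hence zero by
  -- nondegeneracy, contrary to rank 2.
  have h1 : ∀ a ∈ E' p, ∀ b ∈ E' p, pairing p a b = 0 := by
    intro a ha b hb
    rw [hsp] at ha hb
    obtain ⟨a1, ha1, a2, ha2, rfl⟩ := Submodule.mem_sup.1 ha
    obtain ⟨b1, hb1, b2, hb2, rfl⟩ := Submodule.mem_sup.1 hb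
    obtain ⟨c1, rfl⟩ := Submodule.mem_span_singleton.1 ha1
    obtain ⟨c2, rfl⟩ := Submodule.mem_span_singleton.1 ha2
    obtain ⟨d1, rfl⟩ := Submodule.mem_span_singleton.1 hb1
    obtain ⟨d2, rfl⟩ := Submodule.mem_span_singleton.1 hb2
    simp only [map_add, map_smul, LinearMap.add_apply, LinearMap.smul_apply, h0,
      pairing_comm p (w p) (v p), hV v hv v hv p, hW w hw w hw p, smul_zero, add_zero]
  have h2 : E' p = ⊥ := (Submodule.eq_bot_iff _).2 fun a ha => hE.nondegAt p a ha (h1 a ha)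
  have h3 := hE.1.finrank p
  rw [h2, finrank_bot] at h3
  omega

lemma SplitGens.left_mem (h : SplitGens E' v w) (p : M) : v p ∈ E' p := by
  rw [h.span_eq]
  exact Submodule.mem_sup_left (Submodule.mem_span_singleton_self _)

lemma SplitGens.right_mem (h : SplitGens E' v w) (p : M) : w p ∈ E' p := by
  rw [h.span_eq]
  exact Submodule.mem_sup_right (Submodule.mem_span_singleton_self _)

lemma SplitGens.secNear_left (h : SplitGens E' v w) (p : M) : SecNear E' p v :=
  ⟨h.near_left p, Eventually.of_forall h.left_mem⟩

lemma SplitGens.pairing_eq_zero (h : SplitGens E' v w) {a b : GenTangent F p}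
    (hv : pairing p a (v p) = 0) (hw : pairing p a (w p) = 0) (hb : b ∈ E' p) :
    pairing p a b = 0 := by
  rw [h.span_eq, ← Submodule.span_union] at hb
  refine pairing_span_eq_zero (fun c hc => ?_) hb
  rcases hc with hc | hc
  · rw [Set.mem_singleton_iff.1 hc, hv]
  · rw [Set.mem_singleton_iff.1 hc, hw]

lemma frameAt_spanBundle (hv : GenNear p v) (h0 : ∀ q, v q ≠ 0) :
    FrameAt (spanBundle (Submodule.span ℝ {v})) p fun _ : Unit => v := by
  refine ⟨fun _ => hv, Eventually.of_forall fun q => ⟨?_, ?_⟩⟩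
  · exact linearIndependent_unique_iff.2 (h0 q)
  · rw [spanBundle_singleton, Set.range_const]

lemma SplitGens.left_ne_zero (h : SplitGens E' v w) (p : M) : v p ≠ 0 := fun h0 =>
  h.ne_zero p (by rw [h0, map_zero, LinearMap.zero_apply])

lemma SplitGens.right_ne_zero (h : SplitGens E' v w) (p : M) : w p ≠ 0 := fun h0 =>
  h.ne_zero p (by rw [h0, map_zero])

/-- Pairing with `v` annihilates `A` but detects the coefficient of `w`. -/
lemma SplitGens.disjoint (h : SplitGens E' v w) (hA : Orthogonal A E') (p : M) :
    Disjoint (A p) (spanBundle (Submodule.span ℝ {w}) p) := by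
  rw [spanBundle_singleton, Submodule.disjoint_def]
  intro a ha hw
  obtain ⟨c, rfl⟩ := Submodule.mem_span_singleton.1 hw
  have h1 := hA p _ ha _ (h.left_mem p)
  rw [map_smul, LinearMap.smul_apply, pairing_comm, smul_eq_mul, mul_eq_zero] at h1
  rw [h1.resolve_right (h.ne_zero p), zero_smul]

/-- A section that commutes with the generators of `E'` preserves `Γ(E')`. -/
lemma SplitGens.dorfman_secNear (h : SplitGens E' v w) (hu : GenNear p u)
    (h1 : ∀ᶠ q in 𝓝 p, dorfman u v q = 0) (h2 : ∀ᶠ q in 𝓝 p, dorfman u w q = 0)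
    (hx : SecNear E' p x) : SecNear E' p (dorfman u x) := by
  have hd : ∀ q, Disjoint (spanBundle (Submodule.span ℝ {v}) q)
      (spanBundle (Submodule.span ℝ {w}) q) := by
    intro q
    rw [spanBundle_singleton, spanBundle_singleton, Submodule.disjoint_def]
    intro a ha hw
    obtain ⟨c, rfl⟩ := Submodule.mem_span_singleton.1 hw
    obtain ⟨d, hd⟩ := Submodule.mem_span_singleton.1 ha
    have h3 : pairing q (v q) (d • v q) = pairing q (v q) (c • w q) := by rw [hd]
    rw [map_smul, map_smul, h.left_left, smul_zero, eq_comm, smul_eq_mul, mul_eq_zero] at h3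
    rw [h3.resolve_right (h.ne_zero q), zero_smul]
  have hf := (frameAt_spanBundle (h.near_left p) h.left_ne_zero).sup
    (frameAt_spanBundle (h.near_right p) h.right_ne_zero) hd
  have hE : spanBundle (Submodule.span ℝ {v}) ⊔ spanBundle (Submodule.span ℝ {w}) = E' := by
    funext q
    rw [h.span_eq, ← spanBundle_singleton, ← spanBundle_singleton]
    rfl
  rw [hE] at hf
  refine hf.dorfman_secNear hx hu (fun q => le_rfl) ?_
  filter_upwards [h1, h2] with q h3 h4
  rintro (i | i)
  · exact (show dorfman u v q = 0 from h3) ▸ zero_mem _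
  · exact (show dorfman u w q = 0 from h4) ▸ zero_mem _

end Generators

/-! ### Local framings of the kernel bundles -/

section Ker

variable {F : Type*} [NormedAddCommGroup F] [NormedSpace ℝ F] [FiniteDimensional ℝ F]
variable {M : Type*} [TopologicalSpace M] [ChartedSpace F M] [IsManifold 𝓘(ℝ, F) ∞ M]
variable {p : M} {u v w x y v₁ v₂ : GenField F M} {A B E E' L : FibreFamily F M}
variable {V V₁ V₂ K : Submodule ℝ (GenField F M)} {U : Set M}

lemma kerBundle_le (V : Submodule ℝ (GenField F M)) (L : FibreFamily F M) (p : M) :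
    kerBundle V L p ≤ L p := by
  refine Submodule.span_le.2 ?_
  rintro _ ⟨U, hU, hp, x, hx, rfl⟩
  exact hx.1.2 p hp

lemma mem_kerBundle (hv : ∀ q, GenNear q v) (hx : SecNear L p x)
    (h : ∀ᶠ q in 𝓝 p, dorfman v x q = 0) : x p ∈ kerBundle (Submodule.span ℝ {v}) L p := by
  obtain ⟨U, hU, hUo, hp⟩ := eventually_nhds_iff.1 (hx.eventually.and h)
  refine Submodule.subset_span ⟨U, hUo, hp, x, ⟨(mem_sectionsOn_iff_secNear hUo).2
    fun q hq => (hU q hq).1, fun u hu q hq => ?_⟩, rfl⟩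
  obtain ⟨c, rfl⟩ := Submodule.mem_span_singleton.1 hu
  have := dorfman_const_smul_left c (hv q) (hU q hq).1.1
  rw [(hU q hq).2, smul_zero] at this
  exact this

lemma IsFramingOn.frameAt (hU : IsOpen U) (h : IsFramingOn U A K) (hp : p ∈ U) :
    ∃ e : Fin (Module.finrank ℝ K) → GenField F M, (∀ i, e i ∈ K) ∧ FrameAt A p e := by
  obtain ⟨hs, hfin, hf⟩ := h
  obtain ⟨b, hb, h2⟩ := exists_span_range_eq K
  refine ⟨b, hb, fun i => genNear_of_mem_sectionsOn hU (hs (hb i)) hp, ?_⟩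
  filter_upwards [hU.mem_nhds hp] with q hq
  have h1 : Submodule.span ℝ (Set.range fun i => b i q) = A q := by
    have h3 := (hf q hq).2
    rw [← h2, Submodule.map_span, ← Set.range_comp] at h3
    exact h3
  refine ⟨?_, h1⟩
  rw [linearIndependent_iff_card_eq_finrank_span, Set.finrank, h1, ← (hf q hq).1, Fintype.card_fin]

/-- Commuting framings of `ker(𝕃_{v₂}) ∩ L` and `ker(𝕃_{v₁}) ∩ L` near `p`. -/
structure CommFrames (L : FibreFamily F M) (v₁ v₂ : GenField F M) (p : M) {r₁ r₂ : ℕ}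
    (e : Fin r₁ → GenField F M) (e' : Fin r₂ → GenField F M) : Prop where
  frame₁ : FrameAt (kerBundle (Submodule.span ℝ {v₂}) L) p e
  frame₂ : FrameAt (kerBundle (Submodule.span ℝ {v₁}) L) p e'
  ker₁ : ∀ᶠ q in 𝓝 p, ∀ i, dorfman v₂ (e i) q = 0
  ker₂ : ∀ᶠ q in 𝓝 p, ∀ i, dorfman v₁ (e' i) q = 0
  comm : ∀ᶠ q in 𝓝 p, ∀ i j, dorfman (e i) (e' j) q = 0

lemma HasCommutingFramings.exists_commFrames {P} {r₁ r₂ : ℕ}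
    (h : HasCommutingFramings E L (Submodule.span ℝ {v₁}) (Submodule.span ℝ {v₂}) P)
    (h₁ : IsSubbundle r₁ (kerBundle (Submodule.span ℝ {v₂}) L))
    (h₂ : IsSubbundle r₂ (kerBundle (Submodule.span ℝ {v₁}) L)) (p : M) :
    ∃ U : Set M, IsOpen U ∧ p ∈ U ∧ ∃ K₁ K₂, P U K₁ K₂ ∧
      ∃ (e : Fin r₁ → GenField F M) (e' : Fin r₂ → GenField F M),
        (∀ i, e i ∈ K₁) ∧ (∀ i, e' i ∈ K₂) ∧ CommFrames L v₁ v₂ p e e' := by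
  obtain ⟨U, hU, hp, K₁, K₂, hK₁, hK₂, -, -, hc, hP⟩ := h p
  obtain rfl : Module.finrank ℝ K₁ = r₁ := (hK₁.1.2.2 p hp).1.trans (h₁.finrank p)
  obtain rfl : Module.finrank ℝ K₂ = r₂ := (hK₂.1.2.2 p hp).1.trans (h₂.finrank p)
  obtain ⟨e, he, hfe⟩ := hK₁.1.frameAt hU hp
  obtain ⟨e', he', hfe'⟩ := hK₂.1.frameAt hU hp
  refine ⟨U, hU, hp, K₁, K₂, hP, e, e', he, he', hfe, hfe', ?_, ?_, ?_⟩
  · filter_upwards [hU.mem_nhds hp] with q hq i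
    exact (hK₁.2 (he i)).2 v₂ (Submodule.mem_span_singleton_self _) q hq
  · filter_upwards [hU.mem_nhds hp] with q hq i
    exact (hK₂.2 (he' i)).2 v₁ (Submodule.mem_span_singleton_self _) q hq
  · filter_upwards [hU.mem_nhds hp] with q hq i j
    exact hc _ (he i) _ (he' j) q hq

/-- On the isotropic bundle `L` the Dorfman bracket is skew, so `[K₁, K₂] = 0` implies `[K₂, K₁] =
0`. -/
lemma HasCommutingFramings.swap {P} (hL : Orthogonal L L)
    (h : HasCommutingFramings E L V₁ V₂ P) :
    HasCommutingFramings E L V₂ V₁ fun U K₁ K₂ => P U K₂ K₁ := by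
  intro p
  obtain ⟨U, hU, hp, K₁, K₂, hK₁, hK₂, hn₁, hn₂, hc, hP⟩ := h p
  refine ⟨U, hU, hp, K₂, K₁, hK₂, hK₁, hn₂, hn₁, fun x hx y hy q hq => ?_, hP⟩
  rw [dorfman_eq_neg (genNear_of_mem_sectionsOn hU (hK₂.1.1 hx) hq)
    (genNear_of_mem_sectionsOn hU (hK₁.1.1 hy) hq), hc y hy x hx q hq, neg_zero]
  filter_upwards [hU.mem_nhds hq] with r hr
  exact hL r _ (kerBundle_le _ _ _ ((hK₂.1.1 hx).2 r hr)) _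
    (kerBundle_le _ _ _ ((hK₁.1.1 hy).2 r hr))

end Ker

/-! ### The decomposition of `E` into `E₁` and `E₂` -/

section Bicontact

variable {F : Type*} [NormedAddCommGroup F] [NormedSpace ℝ F] [FiniteDimensional ℝ F]
variable {M : Type*} [TopologicalSpace M] [ChartedSpace F M] [IsManifold 𝓘(ℝ, F) ∞ M]
variable {p : M} {u v w x y z v₁ v₂ w₁ w₂ : GenField F M}
variable {E E'' E₁' E₂' L : FibreFamily F M} {V₁ V₂ W₁ W₂ : Submodule ℝ (GenField F M)}
variable {r₁ r₂ : ℕ} {e : Fin r₁ → GenField F M} {e' : Fin r₂ → GenField F M}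

lemma dorfman_jacobi_of_eq_zero (hx : GenNear p x) (hy : GenNear p y) (hz : GenNear p z)
    (h : ∀ᶠ q in 𝓝 p, dorfman x y q = 0) :
    dorfman x (dorfman y z) p = dorfman y (dorfman x z) p := by
  rw [dorfman_jacobi hx hy hz, dorfman_eq_zero_left hz h, zero_add]

/-- Iterated bracket `[x, [y, z]]` vanishes if `[x, y]` and `[x, z]` do. -/
lemma dorfman_dorfman_eq_zero (hx : GenNear p x) (hy : GenNear p y) (hz : GenNear p z)
    (h : ∀ᶠ q in 𝓝 p, dorfman x y q = 0) (h' : ∀ᶠ q in 𝓝 p, dorfman x z q = 0) :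
    dorfman x (dorfman y z) p = 0 := by
  rw [dorfman_jacobi_of_eq_zero hx hy hz h, dorfman_eq_zero_right hy h']

/-- Metric compatibility when `⟨y, z⟩ = 0` near `p`. -/
lemma pairing_dorfman_eq_neg (hx : GenNear p x) (hy : GenNear p y) (hz : GenNear p z)
    (h : ∀ᶠ q in 𝓝 p, pair y z q = 0) :
    pairing p (dorfman x y p) (z p) = - pairing p (y p) (dorfman x z p) := by
  have h1 := anchorDeriv_pair hx hy hz
  rw [anchorDeriv_eq_zero h] at h1
  linarith

lemma CommFrames.eventually (c : CommFrames L v₁ v₂ p e e') :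
    ∀ᶠ q in 𝓝 p, CommFrames L v₁ v₂ q e e' := by
  filter_upwards [c.frame₁.eventually, c.frame₂.eventually, eventually_eventually_nhds.2 c.ker₁,
    eventually_eventually_nhds.2 c.ker₂, eventually_eventually_nhds.2 c.comm] with q a1 a2 a3 a4 a5
  exact ⟨a1, a2, a3, a4, a5⟩

lemma CommFrames.swap (hL : Orthogonal L L) (c : CommFrames L v₁ v₂ p e e') :
    CommFrames L v₂ v₁ p e' e := by
  refine ⟨c.frame₂, c.frame₁, c.ker₂, c.ker₁, ?_⟩
  filter_upwards [c.eventually] with q hq j i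
  rw [dorfman_eq_neg (hq.frame₂.1 j) (hq.frame₁.1 i), hq.comm.self_of_nhds i j, neg_zero]
  filter_upwards [(hq.frame₂.secNear j).2, (hq.frame₁.secNear i).2] with r h1 h2
  exact hL r _ (kerBundle_le _ _ _ h1) _ (kerBundle_le _ _ _ h2)

lemma dorfman_mem_bicontactSummand [T2Space M] (hv : ∀ q, GenNear q v₁)
    (hx : SecNear (kerBundle (ℝ ∙ v₂) L) p x) :
    dorfman v₁ x p ∈ bicontactSummand L (ℝ ∙ v₁) (ℝ ∙ v₂) p := by
  -- The fibres of `E₁` are defined through global sections of `L₁`, so the germ has to be extended.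
  obtain ⟨x', hx', he⟩ := hx.exists_section
  rw [dorfman_congr (Eventually.of_forall fun _ => rfl) (he.mono fun _ h => h.symm) (hv p)
    (genNear_of_mem_sections hx' p)]
  exact Submodule.mem_sup_right (Submodule.mem_map.2 ⟨dorfman v₁ x', Submodule.subset_span
    ⟨v₁, Submodule.mem_span_singleton_self _, x', hx', rfl⟩, rfl⟩)

lemma kerBundle_le_bicontactSummand (V₁ V₂ : Submodule ℝ (GenField F M)) (p : M) :
    kerBundle V₂ L p ≤ bicontactSummand L V₁ V₂ p := le_sup_left

lemma lieSpan_le_of_line {A : FibreFamily F M} (hv : ∀ q, GenNear q v)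
    {S : Submodule ℝ (GenTangent F p)} (h : ∀ x ∈ Sections A, dorfman v x p ∈ S) :
    (lieSpan (ℝ ∙ v) (Sections A)).map (LinearMap.proj p) ≤ S := by
  rw [Submodule.map_le_iff_le_comap]
  refine Submodule.span_le.2 ?_
  rintro _ ⟨u, hu, x, hx, rfl⟩
  obtain ⟨c, rfl⟩ := Submodule.mem_span_singleton.1 hu
  have h1 := dorfman_const_smul_left c (hv p) (genNear_of_mem_sections hx p)
  have h2 : dorfman (c • v) x p ∈ S := by
    rw [show dorfman (c • v) x p = c • dorfman v x p from h1]
    exact S.smul_mem c (h x hx)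
  exact h2

/-- Modulo `L₁` the operator `[v₁, ·]` on sections of `L₁` is linear over functions, so its values
on a frame suffice. -/
lemma bicontactSummand_eq [T2Space M] (hv : ∀ q, GenNear q v₁)
    (c : FrameAt (kerBundle (ℝ ∙ v₂) L) p e) :
    bicontactSummand L (ℝ ∙ v₁) (ℝ ∙ v₂) p =
      Submodule.span ℝ (Set.range fun i => Sum.elim e (fun i => dorfman v₁ (e i)) i p) := by
  have h3 : (fun i => Sum.elim e (fun i => dorfman v₁ (e i)) i p) =
      Sum.elim (fun i => e i p) (fun i => dorfman v₁ (e i) p) := by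
    funext i
    cases i <;> rfl
  rw [h3, Set.Sum.elim_range, Submodule.span_union, c.span_eq]
  refine le_antisymm (sup_le le_sup_left (lieSpan_le_of_line hv fun x hx => ?_))
    (sup_le le_sup_left (Submodule.span_le.2 ?_))
  · refine c.dorfman_mem (mem_sections_iff_secNear.1 hx p) (hv p)
      (fun i => Submodule.mem_sup_right (Submodule.subset_span ⟨i, rfl⟩))
      fun i => Submodule.mem_sup_left (c.secNear i).mem
  · rintro _ ⟨i, rfl⟩
    exact dorfman_mem_bicontactSummand hv (c.secNear i)

section General

lemma IsContactDatum.isotropic {k : ℕ} (h : IsContactDatum k E E'' L V₁ W₁) : Orthogonal L L :=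
  h.maxIsotropic.2.1

/-- The definition is symmetric in the two indices, so later results need only be proved for `E₁`.
The only point that is not formal is the order in `[K₁, K₂] = 0`. -/
lemma IsBicontactDatum.swap (h : IsBicontactDatum E E₁' E₂' L V₁ W₁ V₂ W₂) :
    IsBicontactDatum E E₂' E₁' L V₂ W₂ V₁ W₁ where
  split := h.split
  split₁ := h.split₂
  split₂ := h.split₁
  orth₁ := h.orth₂
  orth₂ := h.orth₁
  orth₁₂ := h.orth₁₂.symm
  maxIsotropic := h.maxIsotropic
  framing₁ := h.framing₂
  framing₂ := h.framing₁
  contact := by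
    rw [sup_comm E₂', sup_comm V₂, sup_comm W₂]
    exact h.contact
  subbundle₁ := h.subbundle₂
  subbundle₂ := h.subbundle₁
  disjoint p := (h.disjoint p).symm
  sum p := (h.sum p).trans (sup_comm _ _)
  framings := by
    rw [sup_assoc, sup_comm E₂', ← sup_assoc]
    exact h.framings.swap h.contact.isotropic

end General

variable [T2Space M]

variable (h : IsBicontactDatum E E₁' E₂' L (ℝ ∙ v₁) (ℝ ∙ w₁) (ℝ ∙ v₂) (ℝ ∙ w₂))
include h

namespace IsBicontactDatum

lemma gens₁ : SplitGens E₁' v₁ w₁ := h.framing₁.splitGens h.split₁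

lemma gens₂ : SplitGens E₂' v₂ w₂ := h.framing₂.splitGens h.split₂

lemma commute (hu : u = v₁ ∨ u = v₂ ∨ u = w₁ ∨ u = w₂)
    (hv : v = v₁ ∨ v = v₂ ∨ v = w₁ ∨ v = w₂) : dorfman u v = 0 := by
  have key : ∀ u, (u = v₁ ∨ u = v₂ ∨ u = w₁ ∨ u = w₂) →
      u ∈ ((ℝ ∙ v₁) ⊔ (ℝ ∙ v₂)) ⊔ ((ℝ ∙ w₁) ⊔ (ℝ ∙ w₂)) := by
    rintro u (rfl | rfl | rfl | rfl)
    · exact Submodule.mem_sup_left (Submodule.mem_sup_left (Submodule.mem_span_singleton_self _))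
    · exact Submodule.mem_sup_left (Submodule.mem_sup_right (Submodule.mem_span_singleton_self _))
    · exact Submodule.mem_sup_right (Submodule.mem_sup_left (Submodule.mem_span_singleton_self _))
    · exact Submodule.mem_sup_right (Submodule.mem_sup_right (Submodule.mem_span_singleton_self _))
  exact h.contact.commute u (key u hu) v (key v hv)

lemma near (hu : u = v₁ ∨ u = v₂ ∨ u = w₁ ∨ u = w₂) (p : M) : GenNear p u := by
  rcases hu with rfl | rfl | rfl | rfl
  exacts [h.gens₁.near_left p, h.gens₂.near_left p, h.gens₁.near_right p, h.gens₂.near_right p]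

lemma dorfman_secNear (hx : SecNear E p x) : SecNear E p (dorfman v₁ x) :=
  dorfman_secNear_of_sections h.gens₁.near_left (fun y hy => (h.contact.normalizes
    (Submodule.mem_sup_left (Submodule.mem_span_singleton_self v₁))).2 y hy) hx

lemma dorfman_secNear_L (hu : u = w₁ ∨ u = w₂) (hx : SecNear L p x) :
    SecNear L p (dorfman u x) := by
  have h1 : u ∈ (ℝ ∙ w₁) ⊔ (ℝ ∙ w₂) := by
    rcases hu with rfl | rfl
    · exact Submodule.mem_sup_left (Submodule.mem_span_singleton_self _)
    · exact Submodule.mem_sup_right (Submodule.mem_span_singleton_self _)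
  exact dorfman_secNear_of_sections (h.near (Or.inr (Or.inr hu))) (fun y hy =>
    h.contact.preserves (Submodule.subset_span ⟨u, h1, y, hy, rfl⟩)) hx

lemma L_le (p : M) : L p ≤ E p := h.maxIsotropic.1 p

lemma orth_ker : Orthogonal (kerBundle (ℝ ∙ v₂) L) (kerBundle (ℝ ∙ v₂) L) :=
  h.contact.isotropic.mono (kerBundle_le _ _) (kerBundle_le _ _)

lemma exists_commFrames (p : M) : ∃ (r₁ r₂ : ℕ) (e : Fin r₁ → GenField F M)
    (e' : Fin r₂ → GenField F M), CommFrames L v₁ v₂ p e e' := by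
  obtain ⟨r₁, h₁⟩ := h.subbundle₁
  obtain ⟨r₂, h₂⟩ := h.subbundle₂
  obtain ⟨U, -, -, K₁, K₂, -, e, e', -, -, hc⟩ := h.framings.exists_commFrames h₁ h₂ p
  exact ⟨r₁, r₂, e, e', hc⟩

/-- The generators other than `v₁` preserve `Γ(L₁)`. -/
lemma dorfman_secNear_ker (hu : u = v₂ ∨ u = w₁ ∨ u = w₂)
    (hx : SecNear (kerBundle (ℝ ∙ v₂) L) p x) :
    SecNear (kerBundle (ℝ ∙ v₂) L) p (dorfman u x) := by
  obtain ⟨r₁, r₂, e, e', c⟩ := h.exists_commFrames p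
  have hu' := h.near (Or.inr hu)
  refine c.frame₁.dorfman_secNear hx (hu' p) (fun _ => le_rfl) ?_
  filter_upwards [c.eventually] with q hq i
  have hv₂ := h.gens₂.near_left
  rcases hu with rfl | hu
  · rw [hq.ker₁.self_of_nhds i]
    exact zero_mem _
  · refine mem_kerBundle hv₂ (h.dorfman_secNear_L hu ((hq.frame₁.secNear i).mono
      (kerBundle_le _ _))) ?_
    filter_upwards [hq.eventually] with r hr
    -- Since `w₁` and `w₂` preserve `Γ(L)`, only annihilation by `[v₂, ·]` is in question, and `v₂`
    -- commutes both with `u` and with `e i`.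
    refine dorfman_dorfman_eq_zero (hv₂ r) (hu' r) (hr.frame₁.1 i) ?_ (hr.ker₁.mono fun _ h => h i)
    rw [h.commute (Or.inr (Or.inl rfl)) (Or.inr (Or.inr hu))]
    exact Eventually.of_forall fun _ => rfl

lemma frameAt_L (c : CommFrames L v₁ v₂ p e e') : FrameAt L p (Sum.elim e e') := by
  have := c.frame₁.sup c.frame₂ h.disjoint
  rwa [show kerBundle (ℝ ∙ v₂) L ⊔ kerBundle (ℝ ∙ v₁) L = L from
    funext fun q => (h.sum q).symm] at this

lemma summand_le (p : M) : bicontactSummand L (ℝ ∙ v₁) (ℝ ∙ v₂) p ≤ E p := by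
  refine sup_le ((kerBundle_le _ _ p).trans (h.L_le p)) (lieSpan_le_of_line h.gens₁.near_left
    fun x hx => ?_)
  exact (h.dorfman_secNear ((mem_sections_iff_secNear.1 hx p).mono
    fun q => (kerBundle_le _ _ q).trans (h.L_le q))).mem

/-- By condition (5), `E` is spanned by `L` and the brackets of `v₁` and `v₂` with sections of `L =
L₁ ⊕ L₂`. As `[v₁, e'] = 0` and `[v₂, e] = 0`, each bracket of a frame element with a generator lies
in one of the two summands. -/
lemma sup_summand (p : M) : bicontactSummand L (ℝ ∙ v₁) (ℝ ∙ v₂) p ⊔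
    bicontactSummand L (ℝ ∙ v₂) (ℝ ∙ v₁) p = E p := by
  refine le_antisymm (sup_le (h.summand_le p) (h.swap.summand_le p)) fun a ha => ?_
  obtain ⟨k, hk⟩ := h.split
  obtain ⟨z, hz, rfl⟩ := hk.1.exists_section ha
  obtain ⟨x, hx, y, hy, rfl⟩ := (h.contact.generates z).1 hz
  obtain ⟨r₁, r₂, e, e', c⟩ := h.exists_commFrames p
  have hv₁ := h.gens₁.near_left
  have hv₂ := h.gens₂.near_left
  have hL : L p ≤ bicontactSummand L (ℝ ∙ v₁) (ℝ ∙ v₂) p ⊔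
      bicontactSummand L (ℝ ∙ v₂) (ℝ ∙ v₁) p := by
    rw [h.sum p]
    exact sup_le_sup (kerBundle_le_bicontactSummand _ _ _) (kerBundle_le_bicontactSummand _ _ _)
  have h1 : ∀ x ∈ Sections L, dorfman v₁ x p ∈ bicontactSummand L (ℝ ∙ v₁) (ℝ ∙ v₂) p ⊔
      bicontactSummand L (ℝ ∙ v₂) (ℝ ∙ v₁) p := by
    intro x hx
    refine (h.frameAt_L c).dorfman_mem (mem_sections_iff_secNear.1 hx p) (hv₁ p) ?_ ?_
    · rintro (i | i)
      · exact Submodule.mem_sup_left (dorfman_mem_bicontactSummand hv₁ (c.frame₁.secNear i))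
      · exact (show dorfman v₁ (e' i) p = 0 from c.ker₂.self_of_nhds i) ▸ zero_mem _
    · exact fun i => hL ((h.frameAt_L c).secNear i).mem
  have h2 : ∀ x ∈ Sections L, dorfman v₂ x p ∈ bicontactSummand L (ℝ ∙ v₁) (ℝ ∙ v₂) p ⊔
      bicontactSummand L (ℝ ∙ v₂) (ℝ ∙ v₁) p := by
    intro x hx
    refine (h.frameAt_L c).dorfman_mem (mem_sections_iff_secNear.1 hx p) (hv₂ p) ?_ ?_
    · rintro (i | i)
      · exact (show dorfman v₂ (e i) p = 0 from c.ker₁.self_of_nhds i) ▸ zero_mem _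
      · exact Submodule.mem_sup_right (dorfman_mem_bicontactSummand hv₂ (c.frame₂.secNear i))
    · exact fun i => hL ((h.frameAt_L c).secNear i).mem
  refine add_mem (hL (mem_sections_iff_secNear.1 hx p).mem) ?_
  have h3 : lieSpan ((ℝ ∙ v₁) ⊔ (ℝ ∙ v₂)) (Sections L) ≤
      (bicontactSummand L (ℝ ∙ v₁) (ℝ ∙ v₂) p ⊔
        bicontactSummand L (ℝ ∙ v₂) (ℝ ∙ v₁) p).comap (LinearMap.proj p) := by
    refine Submodule.span_le.2 ?_
    rintro _ ⟨u, hu, x, hx, rfl⟩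
    obtain ⟨a, ha, b, hb, rfl⟩ := Submodule.mem_sup.1 hu
    obtain ⟨c, rfl⟩ := Submodule.mem_span_singleton.1 ha
    obtain ⟨d, rfl⟩ := Submodule.mem_span_singleton.1 hb
    have hx' := genNear_of_mem_sections hx p
    have h4 := dorfman_add_left ((hv₁ p).smul (.const c)) ((hv₂ p).smul (.const d)) hx'
    rw [dorfman_const_smul_left c (hv₁ p) hx', dorfman_const_smul_left d (hv₂ p) hx'] at h4
    have h5 := add_mem (Submodule.smul_mem _ c (h1 x hx)) (Submodule.smul_mem _ d (h2 x hx))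
    rw [← h4] at h5
    exact h5
  exact h3 hy

/-- These sections span `E`, and since `L` has half the rank of `E`, their number is the rank of
`E`; so they are independent. -/
lemma frameAt_E (c : CommFrames L v₁ v₂ p e e') : FrameAt E p
    (Sum.elim (Sum.elim e fun i => dorfman v₁ (e i)) (Sum.elim e' fun i => dorfman v₂ (e' i))) := by
  obtain ⟨-, -, k, hk, hLk⟩ := h.maxIsotropic
  have hv₁ := h.gens₁.near_left
  have hv₂ := h.gens₂.near_left
  refine .of_span_eq hk.1 ?_ ?_ ?_
  · have h1 := (h.frameAt_L c).finrank
    rw [hLk.finrank] at h1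
    simp only [Fintype.card_sum, Fintype.card_fin] at h1 ⊢
    omega
  · rintro ((i | i) | (i | i))
    exacts [c.frame₁.1 i, (hv₁ p).dorfman (c.frame₁.1 i), c.frame₂.1 i,
      (hv₂ p).dorfman (c.frame₂.1 i)]
  · filter_upwards [c.eventually] with q hq
    rw [← h.sup_summand q, bicontactSummand_eq hv₁ hq.frame₁, bicontactSummand_eq hv₂ hq.frame₂,
      ← Submodule.span_union, ← Set.Sum.elim_range]
    congr 2
    funext i
    cases i <;> rfl

lemma frameAt_summand (c : CommFrames L v₁ v₂ p e e') :
    FrameAt (bicontactSummand L (ℝ ∙ v₁) (ℝ ∙ v₂)) p (Sum.elim e fun i => dorfman v₁ (e i)) := by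
  refine ⟨fun i => (h.frameAt_E c).1 (Sum.inl i), ?_⟩
  filter_upwards [c.eventually] with q hq
  exact ⟨(h.frameAt_E hq).linearIndependent.comp Sum.inl Sum.inl_injective,
    (bicontactSummand_eq h.gens₁.near_left hq.frame₁).symm⟩

end IsBicontactDatum

end Bicontact

/-! ### Orthogonality, nondegeneracy and invariance of the summands -/

section BicontactSummand

variable {F : Type*} [NormedAddCommGroup F] [NormedSpace ℝ F] [FiniteDimensional ℝ F]
variable {M : Type*} [TopologicalSpace M] [ChartedSpace F M] [IsManifold 𝓘(ℝ, F) ∞ M]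
variable [T2Space M]
variable {p : M} {u v w x y z v₁ v₂ w₁ w₂ : GenField F M}
variable {E E'' E₁' E₂' L : FibreFamily F M} {V₁ V₂ W₁ W₂ : Submodule ℝ (GenField F M)}
variable {r₁ r₂ : ℕ} {e : Fin r₁ → GenField F M} {e' : Fin r₂ → GenField F M}

lemma secNear_dorfman_summand (hv : ∀ q, GenNear q v₁)
    (hx : SecNear (kerBundle (ℝ ∙ v₂) L) p x) :
    SecNear (bicontactSummand L (ℝ ∙ v₁) (ℝ ∙ v₂)) p (dorfman v₁ x) :=
  ⟨(hv p).dorfman hx.1, hx.eventually.mono fun _ hq => dorfman_mem_bicontactSummand hv hq⟩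

variable (h : IsBicontactDatum E E₁' E₂' L (ℝ ∙ v₁) (ℝ ∙ w₁) (ℝ ∙ v₂) (ℝ ∙ w₂))
include h

namespace IsBicontactDatum

lemma pair_eq_zero (hx : SecNear L p x) (hy : SecNear L p y) : ∀ᶠ q in 𝓝 p, pair x y q = 0 := by
  filter_upwards [hx.2, hy.2] with q h1 h2 using h.contact.isotropic q _ h1 _ h2

lemma pairing_summand_eq_zero (c : CommFrames L v₁ v₂ p e e') {a b : GenTangent F p}
    (hb : b ∈ bicontactSummand L (ℝ ∙ v₁) (ℝ ∙ v₂) p)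
    (h1 : ∀ i, pairing p a (e i p) = 0) (h2 : ∀ i, pairing p a (dorfman v₁ (e i) p) = 0) :
    pairing p a b = 0 := by
  rw [← (h.frameAt_summand c).span_eq] at hb
  refine pairing_span_eq_zero ?_ hb
  rintro _ ⟨i | i, rfl⟩
  exacts [h1 i, h2 i]

/-- Invariance moves a bracket across the pairing. Thus `⟨[v₁, e], e'⟩ = -⟨e, [v₁, e']⟩ = 0`,
symmetrically for `⟨[v₂, e'], e⟩`, and `⟨[v₁, e], [v₂, e']⟩ = -⟨[v₂, [v₁, e]], e'⟩ = 0` because `v₂`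
commutes with `v₁` and with `e`. The pairing of `e` with `e'` vanishes because `L` is isotropic. -/
lemma orth_summand : Orthogonal (bicontactSummand L (ℝ ∙ v₁) (ℝ ∙ v₂))
    (bicontactSummand L (ℝ ∙ v₂) (ℝ ∙ v₁)) := by
  intro p a ha b hb
  obtain ⟨r₁, r₂, e, e', c⟩ := h.exists_commFrames p
  have hL := h.contact.isotropic
  have c' := c.swap hL
  have hv₁ := h.gens₁.near_left
  have hv₂ := h.gens₂.near_left
  have he : ∀ {q}, CommFrames L v₁ v₂ q e e' → ∀ i, SecNear L q (e i) := fun c i =>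
    (c.frame₁.secNear i).mono (kerBundle_le _ _)
  have he' : ∀ {q}, CommFrames L v₁ v₂ q e e' → ∀ i, SecNear L q (e' i) := fun c i =>
    (c.frame₂.secNear i).mono (kerBundle_le _ _)
  have key : ∀ {q}, CommFrames L v₁ v₂ q e e' → ∀ i j,
      pairing q (dorfman v₁ (e i) q) (e' j q) = 0 := by
    intro q c i j
    rw [pairing_dorfman_eq_neg (hv₁ q) (he c i).1 (he' c j).1 (h.pair_eq_zero (he c i) (he' c j)),
      c.ker₂.self_of_nhds j, map_zero, neg_zero]
  refine h.swap.pairing_summand_eq_zero c' hb (fun j => ?_) fun j => ?_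
  · rw [pairing_comm]
    refine h.pairing_summand_eq_zero c ha (fun i => ?_) fun i => ?_
    · exact hL p _ (he' c j).mem _ (he c i).mem
    · rw [pairing_comm, key c i j]
  · rw [pairing_comm]
    refine h.pairing_summand_eq_zero c ha (fun i => ?_) fun i => ?_
    · rw [pairing_dorfman_eq_neg (hv₂ p) (he' c j).1 (he c i).1
        (h.pair_eq_zero (he' c j) (he c i)), c.ker₁.self_of_nhds i, map_zero, neg_zero]
    · rw [pairing_comm, ← neg_eq_zero, ← pairing_dorfman_eq_neg (hv₂ p)
        ((hv₁ p).dorfman (he c i).1) (he' c j).1 (c.eventually.mono fun q hq => key hq i j),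
        dorfman_dorfman_eq_zero (hv₂ p) (hv₁ p) (he c i).1 ?_ (c.ker₁.mono fun _ h => h i),
        map_zero, LinearMap.zero_apply]
      rw [h.commute (Or.inr (Or.inl rfl)) (Or.inl rfl)]
      exact Eventually.of_forall fun _ => rfl

lemma nondegAt_E (p : M) : NondegAt E p := by
  obtain ⟨k, hk⟩ := h.split
  exact hk.nondegAt p

lemma sup_summand' : bicontactSummand L (ℝ ∙ v₁) (ℝ ∙ v₂) ⊔
    bicontactSummand L (ℝ ∙ v₂) (ℝ ∙ v₁) = E := funext h.sup_summand

lemma nondegAt_summand (p : M) : NondegAt (bicontactSummand L (ℝ ∙ v₁) (ℝ ∙ v₂)) p :=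
  h.orth_summand.nondegAt_left (by rw [h.sup_summand']; exact h.nondegAt_E p)

lemma mem_summand {a : GenTangent F p} (ha : a ∈ E p)
    (h0 : ∀ b ∈ bicontactSummand L (ℝ ∙ v₂) (ℝ ∙ v₁) p, pairing p a b = 0) :
    a ∈ bicontactSummand L (ℝ ∙ v₁) (ℝ ∙ v₂) p :=
  h.orth_summand.mem_left (h.swap.nondegAt_summand p) (by rwa [h.sup_summand]) h0

lemma orth_gens : Orthogonal (bicontactSummand L (ℝ ∙ v₁) (ℝ ∙ v₂)) E₁' :=
  h.orth₁.mono h.summand_le fun _ => le_rfl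

lemma orth_gens' : Orthogonal (bicontactSummand L (ℝ ∙ v₁) (ℝ ∙ v₂)) E₂' :=
  h.orth₂.mono h.summand_le fun _ => le_rfl

lemma isSplit_summand {r : ℕ} (hr : IsSubbundle r (kerBundle (ℝ ∙ v₂) L)) :
    IsSplit r (bicontactSummand L (ℝ ∙ v₁) (ℝ ∙ v₂)) := by
  refine isSplit_of_isotropic (FrameAt.isSubbundle fun p => ?_) h.nondegAt_summand
    (kerBundle_le_bicontactSummand _ _) (fun p => hr.finrank p) h.orth_ker
  obtain ⟨r₁, r₂, e, e', c⟩ := h.exists_commFrames p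
  refine ⟨_, inferInstance, _, ?_, h.frameAt_summand c⟩
  have := c.frame₁.finrank
  rw [hr.finrank] at this
  simp only [Fintype.card_sum, Fintype.card_fin] at this ⊢
  omega

/-- The bracket lies in `E` because `v₁` normalizes `E`. It is orthogonal to `E₂` because `[v₁, ·]`
annihilates the frame `e'`, `[v₂, e']` of `E₂`. -/
lemma dorfman_secNear_summand_left
    (hx : SecNear (bicontactSummand L (ℝ ∙ v₁) (ℝ ∙ v₂)) p x) :
    SecNear (bicontactSummand L (ℝ ∙ v₁) (ℝ ∙ v₂)) p (dorfman v₁ x) := by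
  have h1 := h.dorfman_secNear (hx.mono h.summand_le)
  refine ⟨h1.1, ?_⟩
  filter_upwards [h1.2, hx.eventually] with q h2 hx
  refine h.mem_summand h2 fun b hb => ?_
  obtain ⟨r₁, r₂, e, e', c⟩ := h.exists_commFrames q
  have hv₁ := h.gens₁.near_left
  have hv₂ := h.gens₂.near_left
  have hz : ∀ z, SecNear (bicontactSummand L (ℝ ∙ v₂) (ℝ ∙ v₁)) q z → dorfman v₁ z q = 0 →
      pairing q (dorfman v₁ x q) (z q) = 0 := by
    intro z hz h0
    rw [pairing_dorfman_eq_neg (hv₁ q) hx.1 hz.1, h0, map_zero, neg_zero]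
    filter_upwards [hx.2, hz.2] with r h1 h2 using h.orth_summand r _ h1 _ h2
  refine h.swap.pairing_summand_eq_zero (c.swap h.contact.isotropic) hb (fun j => ?_) fun j => ?_
  · exact hz _ ((c.frame₂.secNear j).mono (kerBundle_le_bicontactSummand _ _))
      (c.ker₂.self_of_nhds j)
  · refine hz _ (secNear_dorfman_summand hv₂ (c.frame₂.secNear j)) ?_
    refine dorfman_dorfman_eq_zero (hv₁ q) (hv₂ q) (c.frame₂.1 j) ?_ (c.ker₂.mono fun _ h => h j)
    rw [h.commute (Or.inl rfl) (Or.inr (Or.inl rfl))]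
    exact Eventually.of_forall fun _ => rfl

/-- All generators preserve `Γ(E₁)`. -/
lemma dorfman_secNear_summand (hu : u = v₁ ∨ u = v₂ ∨ u = w₁ ∨ u = w₂)
    (hx : SecNear (bicontactSummand L (ℝ ∙ v₁) (ℝ ∙ v₂)) p x) :
    SecNear (bicontactSummand L (ℝ ∙ v₁) (ℝ ∙ v₂)) p (dorfman u x) := by
  rcases eq_or_ne u v₁ with rfl | hne
  · exact h.dorfman_secNear_summand_left hx
  have hu' := hu.resolve_left hne
  obtain ⟨r₁, r₂, e, e', c⟩ := h.exists_commFrames p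
  have hv₁ := h.gens₁.near_left
  refine (h.frameAt_summand c).dorfman_secNear hx (h.near hu p) (fun _ => le_rfl) ?_
  filter_upwards [c.eventually] with q hq
  rintro (i | i)
  · exact kerBundle_le_bicontactSummand _ _ _ (h.dorfman_secNear_ker hu' (hq.frame₁.secNear i)).mem
  -- Since `u` commutes with `v₁`, the two brackets can be interchanged, and `[u, e i]` is a section
  -- of `L₁`.
  · have h1 : dorfman u (dorfman v₁ (e i)) q = dorfman v₁ (dorfman u (e i)) q := by
      refine dorfman_jacobi_of_eq_zero (h.near hu q) (hv₁ q) (hq.frame₁.1 i) ?_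
      rw [h.commute hu (Or.inl rfl)]
      exact Eventually.of_forall fun _ => rfl
    change dorfman u (dorfman v₁ (e i)) q ∈ _
    rw [h1]
    exact dorfman_mem_bicontactSummand hv₁ (h.dorfman_secNear_ker hu' (hq.frame₁.secNear i))

/-- The bundle `L₁ ⊕ span(w₁)` is isotropic, so brackets of a frame suffice, and only `[e i, e j]`
needs an argument. It lies in `L₁ ⊕ L₂ ⊕ span(w₁, w₂)`. Because `e i` commutes with `v₂` and with
`[v₂, e' k]`, invariance makes it orthogonal to these sections, which removes the components in
`span(w₂)` and `L₂`. -/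
lemma involutive_ker (hx : SecNear (kerBundle (ℝ ∙ v₂) L ⊔ spanBundle (ℝ ∙ w₁)) p x)
    (hy : SecNear (kerBundle (ℝ ∙ v₂) L ⊔ spanBundle (ℝ ∙ w₁)) p y) :
    dorfman x y p ∈ kerBundle (ℝ ∙ v₂) L p ⊔ spanBundle (ℝ ∙ w₁) p := by
  obtain ⟨r₁, r₂, e, e', c⟩ := h.exists_commFrames p
  have hv₂ := h.gens₂.near_left
  have hL := h.contact.isotropic
  have horth : Orthogonal (kerBundle (ℝ ∙ v₂) L) E₁' :=
    h.orth_gens.mono (kerBundle_le_bicontactSummand _ _) fun _ => le_rfl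
  have horth' : Orthogonal (kerBundle (ℝ ∙ v₂) L) E₂' :=
    h.orth_gens'.mono (kerBundle_le_bicontactSummand _ _) fun _ => le_rfl
  have hf := c.frame₁.sup (frameAt_spanBundle (h.gens₁.near_right p) h.gens₁.right_ne_zero)
    (h.gens₁.disjoint horth)
  have hw : Orthogonal (spanBundle (ℝ ∙ w₁)) (spanBundle (ℝ ∙ w₁)) := by
    intro q a ha b hb
    rw [spanBundle_singleton] at ha hb
    obtain ⟨s, rfl⟩ := Submodule.mem_span_singleton.1 ha
    obtain ⟨t, rfl⟩ := Submodule.mem_span_singleton.1 hb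
    rw [map_smul, map_smul, LinearMap.smul_apply, h.gens₁.right_right, smul_zero, smul_zero]
  have hwE : ∀ q, spanBundle (ℝ ∙ w₁) q ≤ E₁' q := fun q => by
    rw [spanBundle_singleton, Submodule.span_singleton_le_iff_mem]
    exact h.gens₁.right_mem q
  have hew := horth.mono (fun _ => le_rfl) hwE
  have hwe : ∀ i, dorfman w₁ (e i) p ∈ kerBundle (ℝ ∙ v₂) L p ⊔ spanBundle (ℝ ∙ w₁) p := fun i =>
    Submodule.mem_sup_left (h.dorfman_secNear_ker (Or.inr (Or.inl rfl)) (c.frame₁.secNear i)).mem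
  refine hf.dorfman_mem_of_isotropic ((h.orth_ker.sup_left hew.symm).sup_right
    (hew.sup_left hw)) ?_ hx hy
  rintro (i | i) (j | j)
  · change dorfman (e i) (e j) p ∈ _
    have hle : ∀ q, kerBundle (ℝ ∙ v₂) L q ≤ (L ⊔ spanBundle ((ℝ ∙ w₁) ⊔ (ℝ ∙ w₂))) q :=
      fun q => (kerBundle_le _ _ q).trans le_sup_left
    have h1 : dorfman (e i) (e j) p ∈ L p ⊔ spanBundle ((ℝ ∙ w₁) ⊔ (ℝ ∙ w₂)) p :=
      (dorfman_secNear_of_sections₂ h.contact.involutive ((c.frame₁.secNear i).mono hle)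
        ((c.frame₁.secNear j).mono hle)).mem
    have h2 : spanBundle ((ℝ ∙ w₁) ⊔ (ℝ ∙ w₂)) p = (ℝ ∙ w₁ p) ⊔ (ℝ ∙ w₂ p) := by
      rw [spanBundle, Submodule.map_sup, ← spanBundle_singleton, ← spanBundle_singleton]
      rfl
    rw [h.sum p, h2] at h1
    obtain ⟨l, hl, b, hb, hlb⟩ := Submodule.mem_sup.1 h1
    obtain ⟨l₁, hl₁, l₂, hl₂, rfl⟩ := Submodule.mem_sup.1 hl
    obtain ⟨b₁, hb₁, b₂, hb₂, rfl⟩ := Submodule.mem_sup.1 hb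
    obtain ⟨s, rfl⟩ := Submodule.mem_span_singleton.1 hb₁
    obtain ⟨t, rfl⟩ := Submodule.mem_span_singleton.1 hb₂
    have c' := c.swap hL
    have hev : ∀ᶠ q in 𝓝 p, dorfman (e i) v₂ q = 0 := by
      filter_upwards [c.eventually] with q hq
      rw [dorfman_eq_neg (hq.frame₁.1 i) (hv₂ q), hq.ker₁.self_of_nhds i, neg_zero]
      filter_upwards [(hq.frame₁.secNear i).2] with r hr
      exact horth' r _ hr _ (h.gens₂.left_mem r)
    have hP : ∀ z, SecNear (bicontactSummand L (ℝ ∙ v₂) (ℝ ∙ v₁) ⊔ E₂') p z →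
        dorfman (e i) z p = 0 → pairing p (dorfman (e i) (e j) p) (z p) = 0 := by
      intro z hz h0
      rw [pairing_dorfman_eq_neg (c.frame₁.1 i) (c.frame₁.1 j) hz.1, h0, map_zero, neg_zero]
      filter_upwards [(c.frame₁.secNear j).2, hz.2] with r h1 h2
      exact (h.orth_summand.sup_right h.orth_gens') r _ (kerBundle_le_bicontactSummand _ _ _ h1) _ h2
    have hE₂ : ∀ q, bicontactSummand L (ℝ ∙ v₂) (ℝ ∙ v₁) q ≤
      (bicontactSummand L (ℝ ∙ v₂) (ℝ ∙ v₁) ⊔ E₂') q := fun q => le_sup_left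
    have hl₂' := kerBundle_le_bicontactSummand (ℝ ∙ v₂) (ℝ ∙ v₁) p hl₂
    -- Among the components only `t • w₂` pairs nontrivially with `v₂`.
    have ht : t = 0 := by
      have h3 := hP v₂ ((h.gens₂.secNear_left p).mono fun _ => le_sup_right) hev.self_of_nhds
      rw [← hlb] at h3
      simp only [map_add, map_smul, LinearMap.add_apply, LinearMap.smul_apply,
        horth' p _ hl₁ _ (h.gens₂.left_mem p), h.swap.orth_gens p _ hl₂' _ (h.gens₂.left_mem p),
        h.orth₁₂ p _ (h.gens₁.right_mem p) _ (h.gens₂.left_mem p), zero_add,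
        smul_eq_mul, mul_zero, mul_eq_zero] at h3
      refine h3.resolve_right ?_
      rw [pairing_comm]
      exact h.gens₂.ne_zero p
    -- `E₂` is nondegenerate and framed by `e'` and `[v₂, e']`; isotropy of `L` disposes of `e'`,
    -- and orthogonality of `[e i, e j]` to `[v₂, e' k]` of the rest.
    have hl0 : l₂ = 0 := by
      refine h.swap.nondegAt_summand p l₂ hl₂' fun b hb => ?_
      refine h.swap.pairing_summand_eq_zero c' hb (fun k => ?_) fun k => ?_
      · exact hL p _ (kerBundle_le _ _ _ hl₂) _ (kerBundle_le _ _ _ (c.frame₂.secNear k).mem)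
      have hz := secNear_dorfman_summand hv₂ (c.frame₂.secNear k)
      have h3 := hP _ (hz.mono hE₂) (dorfman_dorfman_eq_zero (c.frame₁.1 i) (hv₂ p) (c.frame₂.1 k)
        hev (c.comm.mono fun _ h => h i k))
      rw [← hlb, ht, zero_smul, add_zero] at h3
      simp only [map_add, map_smul, LinearMap.add_apply, LinearMap.smul_apply,
        h.orth_summand p _ (kerBundle_le_bicontactSummand _ _ _ hl₁) _ hz.mem, zero_add,
        h.swap.orth_gens'.symm p _ (h.gens₁.right_mem p) _ hz.mem, smul_zero, add_zero] at h3
      exact h3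
    rw [← hlb, ht, hl0, zero_smul, add_zero, add_zero]
    refine Submodule.add_mem_sup hl₁ ?_
    rw [spanBundle_singleton]
    exact hb₁
  · change dorfman (e i) w₁ p ∈ _
    rw [dorfman_eq_neg (c.frame₁.1 i) (h.gens₁.near_right p)]
    · exact neg_mem (hwe i)
    · filter_upwards [(c.frame₁.secNear i).2] with q hq
      exact horth q _ hq _ (h.gens₁.right_mem q)
  · exact hwe j
  · change dorfman w₁ w₁ p ∈ _
    rw [h.commute (Or.inr (Or.inr (Or.inl rfl))) (Or.inr (Or.inr (Or.inl rfl)))]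
    exact zero_mem _

end IsBicontactDatum

end BicontactSummand

/-! ### The rank 1 contact datum on a summand -/

section BicontactContact

variable {F : Type*} [NormedAddCommGroup F] [NormedSpace ℝ F] [FiniteDimensional ℝ F]
variable {M : Type*} [TopologicalSpace M] [ChartedSpace F M] [IsManifold 𝓘(ℝ, F) ∞ M]
variable {p : M} {u v w x y z v₁ v₂ w₁ w₂ : GenField F M}
variable {A B E E'' E₁' E₂' L : FibreFamily F M} {V₁ V₂ W₁ W₂ : Submodule ℝ (GenField F M)}
variable {r₁ r₂ : ℕ} {e : Fin r₁ → GenField F M} {e' : Fin r₂ → GenField F M}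

lemma add_mem_sections (hx : x ∈ Sections A) (hy : y ∈ Sections A) : x + y ∈ Sections A :=
  mem_sections_iff_secNear.2 fun p =>
    (mem_sections_iff_secNear.1 hx p).add (mem_sections_iff_secNear.1 hy p)

lemma smul_mem_sections (c : ℝ) (hx : x ∈ Sections A) : c • x ∈ Sections A :=
  mem_sections_iff_secNear.2 fun p => (mem_sections_iff_secNear.1 hx p).smul (.const c)

lemma zero_mem_sections : (0 : GenField F M) ∈ Sections A :=
  mem_sections_iff_secNear.2 fun _ => ⟨.zero, Eventually.of_forall fun _ => zero_mem _⟩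

lemma neg_mem_sections (hx : x ∈ Sections A) : -x ∈ Sections A :=
  mem_sections_iff.2 fun q => ⟨(genNear_of_mem_sections hx q).neg,
    neg_mem (mem_sections_iff.1 hx q).2⟩

lemma sub_mem_sections (hx : x ∈ Sections A) (hy : y ∈ Sections A) : x - y ∈ Sections A := by
  rw [sub_eq_add_neg]
  exact add_mem_sections hx (neg_mem_sections hy)

/-- For a line spanned by `v`, scalars and sums are absorbed into the section, so the span consists
of single brackets. -/
lemma exists_of_mem_lieSpan (hv : ∀ q, GenNear q v) (hy : y ∈ lieSpan (ℝ ∙ v) (Sections A)) :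
    ∃ a ∈ Sections A, y = dorfman v a := by
  induction hy using Submodule.span_induction with
  | mem y hy =>
    obtain ⟨u, hu, x, hx, rfl⟩ := hy
    obtain ⟨c, rfl⟩ := Submodule.mem_span_singleton.1 hu
    refine ⟨c • x, smul_mem_sections c hx, funext fun q => ?_⟩
    have hx' := genNear_of_mem_sections hx q
    exact (dorfman_const_smul_left c (hv q) hx').trans (dorfman_const_smul_right c (hv q) hx').symm
  | zero => exact ⟨0, zero_mem_sections, funext fun q => (dorfman_zero_right (hv q)).symm⟩
  | add y z _ _ hy hz =>
    obtain ⟨a, ha, rfl⟩ := hy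
    obtain ⟨b, hb, rfl⟩ := hz
    refine ⟨a + b, add_mem_sections ha hb, funext fun q => ?_⟩
    exact (dorfman_add_right (hv q) (genNear_of_mem_sections ha q)
      (genNear_of_mem_sections hb q)).symm
  | smul c y _ hy =>
    obtain ⟨a, ha, rfl⟩ := hy
    exact ⟨c • a, smul_mem_sections c ha, funext fun q =>
      (dorfman_const_smul_right c (hv q) (genNear_of_mem_sections ha q)).symm⟩

lemma exists_of_mem_lieSpan_sup (hv₁ : ∀ q, GenNear q v₁) (hv₂ : ∀ q, GenNear q v₂)
    (hy : y ∈ lieSpan ((ℝ ∙ v₁) ⊔ (ℝ ∙ v₂)) (Sections A)) :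
    ∃ a ∈ Sections A, ∃ b ∈ Sections A, y = dorfman v₁ a + dorfman v₂ b := by
  have h1 : lieSpan ((ℝ ∙ v₁) ⊔ (ℝ ∙ v₂)) (Sections A) ≤
      lieSpan (ℝ ∙ v₁) (Sections A) ⊔ lieSpan (ℝ ∙ v₂) (Sections A) := by
    refine Submodule.span_le.2 ?_
    rintro _ ⟨u, hu, x, hx, rfl⟩
    obtain ⟨u₁, hu₁, u₂, hu₂, rfl⟩ := Submodule.mem_sup.1 hu
    have h2 : dorfman (u₁ + u₂) x = dorfman u₁ x + dorfman u₂ x := by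
      obtain ⟨c, rfl⟩ := Submodule.mem_span_singleton.1 hu₁
      obtain ⟨d, rfl⟩ := Submodule.mem_span_singleton.1 hu₂
      exact funext fun q => dorfman_add_left ((hv₁ q).smul (.const c)) ((hv₂ q).smul (.const d))
        (genNear_of_mem_sections hx q)
    rw [h2]
    exact Submodule.add_mem_sup (Submodule.subset_span ⟨u₁, hu₁, x, hx, rfl⟩)
      (Submodule.subset_span ⟨u₂, hu₂, x, hx, rfl⟩)
  obtain ⟨y₁, hy₁, y₂, hy₂, rfl⟩ := Submodule.mem_sup.1 (h1 hy)
  obtain ⟨a, ha, rfl⟩ := exists_of_mem_lieSpan hv₁ hy₁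
  obtain ⟨b, hb, rfl⟩ := exists_of_mem_lieSpan hv₂ hy₂
  exact ⟨a, ha, b, hb, rfl⟩

/-- Smoothness of the projections of a direct sum of bundles. -/
lemma exists_sections_add (hd : ∀ q, Disjoint (A q) (B q)) (hA : ∃ r, IsSubbundle r A)
    (hB : ∃ r, IsSubbundle r B) (hx : x ∈ Sections (A ⊔ B)) :
    ∃ a ∈ Sections A, ∃ b ∈ Sections B, x = a + b := by
  obtain ⟨r, hA⟩ := hA
  obtain ⟨s, hB⟩ := hB
  choose a ha b hb hab using fun q => Submodule.mem_sup.1 ((mem_sections_iff.1 hx q).2)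
  have key : ∀ p, GenNear p a ∧ GenNear p b := by
    intro p
    obtain ⟨e, he⟩ := hA.exists_frameAt p
    obtain ⟨f, hf⟩ := hB.exists_frameAt p
    obtain ⟨c, hc, hxc⟩ := (he.sup hf hd).exists_coeff (mem_sections_iff_secNear.1 hx p)
    have h1 : ∀ᶠ q in 𝓝 p, a q = ∑ i, c (Sum.inl i) q • e i q ∧
        b q = ∑ i, c (Sum.inr i) q • f i q := by
      filter_upwards [hxc, he.eventually, hf.eventually] with q h2 h3 h4
      rw [Fintype.sum_sum_type, ← hab q] at h2
      simp only [Sum.elim_inl, Sum.elim_inr] at h2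
      have h5 : ∑ i, c (Sum.inl i) q • e i q ∈ A q :=
        Submodule.sum_mem _ fun i _ => Submodule.smul_mem _ _ (h3.secNear i).mem
      have h6 : ∑ i, c (Sum.inr i) q • f i q ∈ B q :=
        Submodule.sum_mem _ fun i _ => Submodule.smul_mem _ _ (h4.secNear i).mem
      have h7 : a q - ∑ i, c (Sum.inl i) q • e i q = ∑ i, c (Sum.inr i) q • f i q - b q := by
        rw [sub_eq_sub_iff_add_eq_add, h2, add_comm]
      have h8 := Submodule.disjoint_def.1 (hd q) _ (sub_mem (ha q) h5)
        (h7 ▸ sub_mem h6 (hb q))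
      refine ⟨sub_eq_zero.1 h8, ?_⟩
      rw [h8, eq_comm, sub_eq_zero] at h7
      exact h7.symm
    exact ⟨(GenNear.sum fun i _ => (he.1 i).smul (hc _)).congr (h1.mono fun _ h => h.1),
      (GenNear.sum fun i _ => (hf.1 i).smul (hc _)).congr (h1.mono fun _ h => h.2)⟩
  exact ⟨a, mem_sections_iff.2 fun p => ⟨(key p).1, ha p⟩, b,
    mem_sections_iff.2 fun p => ⟨(key p).2, hb p⟩, funext fun q => (hab q).symm⟩

variable [T2Space M]
variable (h : IsBicontactDatum E E₁' E₂' L (ℝ ∙ v₁) (ℝ ∙ w₁) (ℝ ∙ v₂) (ℝ ∙ w₂))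
include h

namespace IsBicontactDatum

/-- Condition (5) for `E` gives `z = x + [v₁, a] + [v₂, b]` with `x`, `a`, `b` in `Γ(L)`. Splitting
these along `L₁ ⊕ L₂` and sorting the terms, the part in `E₂` must vanish and the part in `E₁` has
the required form. -/
lemma generates_summand (z : GenField F M) :
    z ∈ Sections (bicontactSummand L (ℝ ∙ v₁) (ℝ ∙ v₂)) ↔
      ∃ x ∈ Sections (kerBundle (ℝ ∙ v₂) L),
        ∃ y ∈ lieSpan (ℝ ∙ v₁) (Sections (kerBundle (ℝ ∙ v₂) L)), z = x + y := by
  have hv₁ := h.gens₁.near_left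
  have hv₂ := h.gens₂.near_left
  constructor
  · intro hz
    rw [mem_sections_iff_secNear] at hz
    obtain ⟨x, hx, y, hy, rfl⟩ := (h.contact.generates z).1
      (mem_sections_iff_secNear.2 fun p => (hz p).mono h.summand_le)
    obtain ⟨a, ha, b, hb, rfl⟩ := exists_of_mem_lieSpan_sup hv₁ hv₂ hy
    have hL : L = kerBundle (ℝ ∙ v₂) L ⊔ kerBundle (ℝ ∙ v₁) L := funext h.sum
    have hdec := fun {x} => exists_sections_add (x := x) h.disjoint h.subbundle₁ h.subbundle₂
    rw [← hL] at hdec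
    obtain ⟨x₁, hx₁, x₂, hx₂, rfl⟩ := hdec hx
    obtain ⟨a₁, ha₁, a₂, ha₂, rfl⟩ := hdec ha
    obtain ⟨b₁, hb₁, b₂, hb₂, rfl⟩ := hdec hb
    rw [mem_sections_iff_secNear] at hx₁ hx₂ ha₁ ha₂ hb₁ hb₂
    -- A section of the bundle `L₁` is a combination of annihilated sections with function
    -- coefficients, so `[v₂, ·]` need not kill it; by the Leibniz rule the bracket is a section of
    -- `L₁` again.
    have h1 : ∀ q, SecNear (kerBundle (ℝ ∙ v₂) L) q (dorfman v₂ b₁) := fun q =>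
      h.dorfman_secNear_ker (Or.inl rfl) (hb₁ q)
    have h2 : ∀ q, SecNear (kerBundle (ℝ ∙ v₁) L) q (dorfman v₁ a₂) := fun q =>
      h.swap.dorfman_secNear_ker (Or.inl rfl) (ha₂ q)
    refine ⟨x₁ + dorfman v₂ b₁, add_mem_sections (mem_sections_iff_secNear.2 hx₁)
      (mem_sections_iff_secNear.2 h1), dorfman v₁ a₁, Submodule.subset_span ⟨v₁,
        Submodule.mem_span_singleton_self _, a₁, mem_sections_iff_secNear.2 ha₁, rfl⟩,
      funext fun q => ?_⟩
    have h3 : (x₁ + x₂ + (dorfman v₁ (a₁ + a₂) + dorfman v₂ (b₁ + b₂))) q =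
        (x₁ q + dorfman v₂ b₁ q + dorfman v₁ a₁ q) +
          (x₂ q + dorfman v₁ a₂ q + dorfman v₂ b₂ q) := by
      have h4 : dorfman v₁ (a₁ + a₂) q = dorfman v₁ a₁ q + dorfman v₁ a₂ q :=
        dorfman_add_right (hv₁ q) (ha₁ q).1 (ha₂ q).1
      have h5 : dorfman v₂ (b₁ + b₂) q = dorfman v₂ b₁ q + dorfman v₂ b₂ q :=
        dorfman_add_right (hv₂ q) (hb₁ q).1 (hb₂ q).1
      simp only [Pi.add_apply, h4, h5]
      abel
    have h6 : x₁ q + dorfman v₂ b₁ q + dorfman v₁ a₁ q ∈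
        bicontactSummand L (ℝ ∙ v₁) (ℝ ∙ v₂) q :=
      add_mem (kerBundle_le_bicontactSummand _ _ _ (add_mem (hx₁ q).mem (h1 q).mem))
        (dorfman_mem_bicontactSummand hv₁ (ha₁ q))
    have h7 : x₂ q + dorfman v₁ a₂ q + dorfman v₂ b₂ q ∈
        bicontactSummand L (ℝ ∙ v₂) (ℝ ∙ v₁) q :=
      add_mem (kerBundle_le_bicontactSummand _ _ _ (add_mem (hx₂ q).mem (h2 q).mem))
        (dorfman_mem_bicontactSummand hv₂ (hb₂ q))
    have h8 := (hz q).mem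
    rw [h3] at h8
    -- The part in `E₂` also lies in `E₁`, so it is orthogonal to `E₂` and vanishes by
    -- nondegeneracy.
    rw [h3, h.swap.nondegAt_summand q _ h7 fun b hb => h.orth_summand q _
      ((Submodule.add_mem_iff_right _ h6).1 h8) b hb, add_zero]
    rfl
  · rintro ⟨x, hx, y, hy, rfl⟩
    obtain ⟨a, ha, rfl⟩ := exists_of_mem_lieSpan hv₁ hy
    rw [mem_sections_iff_secNear] at hx ha
    exact add_mem_sections (mem_sections_iff_secNear.2 fun p => (hx p).mono
        (kerBundle_le_bicontactSummand _ _))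
      (mem_sections_iff_secNear.2 fun p => secNear_dorfman_summand hv₁ (ha p))

/-- If `a = ∑ f i • e i`, then `[v₁, a]` equals `∑ f i • [v₁, e i]` modulo `L₁`. Being in `L₁`
forces all `f i` to vanish, by independence of the frame `e`, `[v₁, e]`; so `a = 0`. -/
lemma direct_summand (hx : x ∈ Sections (kerBundle (ℝ ∙ v₂) L))
    (hx' : x ∈ lieSpan (ℝ ∙ v₁) (Sections (kerBundle (ℝ ∙ v₂) L))) : x = 0 := by
  have hv₁ := h.gens₁.near_left
  obtain ⟨a, ha, rfl⟩ := exists_of_mem_lieSpan hv₁ hx'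
  have h0 : a = 0 := by
    funext q
    obtain ⟨r₁, r₂, e, e', c⟩ := h.exists_commFrames q
    obtain ⟨f, hf, hfa⟩ := c.frame₁.exists_coeff (mem_sections_iff_secNear.1 ha q)
    have h1 := (mem_sections_iff.1 hx q).2
    rw [dorfman_congr (Eventually.of_forall fun _ => rfl) hfa (hv₁ q)
      (GenNear.sum fun i _ => (c.frame₁.1 i).smul (hf i)),
      dorfman_sum_right _ hf (hv₁ q) c.frame₁.1, Finset.sum_add_distrib,
      Submodule.add_mem_iff_left _ (Submodule.sum_mem _ fun i _ =>
        Submodule.smul_mem _ _ (c.frame₁.secNear i).mem), ← c.frame₁.span_eq] at h1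
    have h2 := (h.frameAt_summand c).linearIndependent
    have h3 : (fun i => Sum.elim e (fun i => dorfman v₁ (e i)) i q) =
        Sum.elim (fun i => e i q) (fun i => dorfman v₁ (e i) q) := by
      funext i
      cases i <;> rfl
    rw [h3, linearIndependent_sum] at h2
    have h4 := Submodule.disjoint_def.1 h2.2.2 _ h1 (Submodule.sum_mem _ fun i _ =>
      Submodule.smul_mem _ _ (Submodule.subset_span ⟨i, rfl⟩))
    have h5 := Fintype.linearIndependent_iff.1 h2.2.1 (fun i => f i q) h4
    rw [hfa.self_of_nhds]
    exact Finset.sum_eq_zero fun i _ => by rw [h5 i, zero_smul]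
  rw [h0]
  exact funext fun q => dorfman_zero_right (hv₁ q)

lemma isContactDatum : IsContactDatum 1 (bicontactSummand L (ℝ ∙ v₁) (ℝ ∙ v₂)) E₁'
    (kerBundle (ℝ ∙ v₂) L) (ℝ ∙ v₁) (ℝ ∙ w₁) := by
  obtain ⟨r, hr⟩ := h.subbundle₁
  have hs := h.isSplit_summand hr
  have hv₁ := h.gens₁.near_left
  have hle : (ℝ ∙ v₁) ⊔ (ℝ ∙ w₁) ≤ ((ℝ ∙ v₁) ⊔ (ℝ ∙ v₂)) ⊔ ((ℝ ∙ w₁) ⊔ (ℝ ∙ w₂)) :=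
    sup_le_sup le_sup_left le_sup_left
  refine
    { split := ⟨r, hs⟩
      split' := h.split₁
      orthogonal := h.orth_gens
      maxIsotropic := ⟨kerBundle_le_bicontactSummand _ _, h.orth_ker, r, hs, hr⟩
      framing := h.framing₁
      normalizes := ?_
      involutive := ?_
      commute := fun x hx y hy => h.contact.commute x (hle hx) y (hle hy)
      preserves := ?_
      generates := h.generates_summand }
  · intro u hu
    obtain ⟨c, rfl⟩ := Submodule.mem_span_singleton.1 hu
    refine ⟨mem_sections_iff.2 fun q => ⟨(hv₁ q).smul (.const c), trivial⟩, fun y hy => ?_⟩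
    change dorfman (c • v₁) y ∈ Sections _
    have h1 : dorfman (c • v₁) y = c • dorfman v₁ y := funext fun q =>
      dorfman_const_smul_left c (hv₁ q) (genNear_of_mem_sections hy q)
    rw [h1]
    exact smul_mem_sections c (mem_sections_iff_secNear.2 fun p =>
      h.dorfman_secNear_summand (Or.inl rfl) (mem_sections_iff_secNear.1 hy p))
  · intro x hx y hy
    rw [mem_sections_iff_secNear] at hx hy
    exact mem_sections_iff.2 fun p =>
      ⟨(hx p).1.dorfman (hy p).1, h.involutive_ker (hx p) (hy p)⟩
  · intro y hy
    obtain ⟨a, ha, rfl⟩ := exists_of_mem_lieSpan h.gens₁.near_right hy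
    exact mem_sections_iff_secNear.2 fun p => h.dorfman_secNear_ker (Or.inr (Or.inl rfl))
      (mem_sections_iff_secNear.1 ha p)

end IsBicontactDatum

end BicontactContact

/-! ### Real forms of the normalizer and CRF conditions; exchange of indices -/

section SGF

variable {F : Type*} [NormedAddCommGroup F] [NormedSpace ℝ F] [FiniteDimensional ℝ F]
variable {M : Type*} [TopologicalSpace M] [ChartedSpace F M] [IsManifold 𝓘(ℝ, F) ∞ M]
variable {p : M} {u v x y z : GenField F M} {J J' : EndFamily F M}
variable {A B E E'' E₁' E₂' L : FibreFamily F M} {V₁ V₂ W₁ W₂ : Submodule ℝ (GenField F M)}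

lemma IsSGF.secNear (hJ : IsSGF E J) (hx : SecNear E p x) : SecNear E p (J.act x) := by
  obtain ⟨U, hU, hp, hxU⟩ := hx.exists_open
  exact (mem_sectionsOn_iff_secNear hU).1 (hJ.smooth U hU x hxU) p hp

lemma IsSGF.act_mem (hJ : IsSGF E J) (hx : x ∈ Sections E) : J.act x ∈ Sections E :=
  hJ.smooth _ isOpen_univ x hx

lemma IsSGF.nondegAt (hJ : IsSGF E J) (p : M) : NondegAt E p := by
  obtain ⟨k, hk⟩ := hJ.split
  exact hk.nondegAt p

/-- Skewness and orthogonality give `⟨J (J a), b⟩ = -⟨J a, J b⟩ = -⟨a, b⟩`; conclude by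
nondegeneracy. -/
lemma IsSGF.apply_apply (hJ : IsSGF E J) {a : GenTangent F p} (ha : a ∈ E p) :
    J p (J p a) = -a := by
  have h1 := hJ.maps p
  rw [← add_eq_zero_iff_eq_neg]
  refine hJ.nondegAt p _ (add_mem (h1 _ (h1 _ ha)) ha) fun b hb => ?_
  rw [map_add, LinearMap.add_apply, hJ.skew p _ (h1 _ ha) b hb, hJ.orth p a ha b hb,
    neg_add_cancel]

lemma IsSGF.act_act (hJ : IsSGF E J) (hx : x ∈ Sections E) : J.act (J.act x) = -x :=
  funext fun q => hJ.apply_apply (mem_sections_iff.1 hx q).2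

/-- The restriction of a split generalized F-structure to an invariant split structure. -/
lemma IsSGF.restrict (hJ : IsSGF E J) (hA : ∃ k, IsSplit k A) (hAE : ∀ p, A p ≤ E p)
    (hm : ∀ p, ∀ a ∈ A p, J p a ∈ A p) (hr : IsRestriction A J' J) : IsSGF A J' where
  split := hA
  maps p a ha := by
    rw [hr p a ha]
    exact hm p a ha
  smooth U hU x hx := by
    rw [mem_sectionsOn_iff_secNear hU] at hx ⊢
    intro p hp
    have h1 := hJ.secNear ((hx p hp).mono hAE)
    refine SecNear.congr (x := J.act x) ⟨h1.1, (hx p hp).2.mono fun q hq => hm q _ hq⟩ ?_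
    exact (hx p hp).2.mono fun q hq => hr q _ hq
  skew p a ha b hb := by
    rw [hr p a ha, hr p b hb]
    exact hJ.skew p a (hAE p ha) b (hAE p hb)
  orth p a ha b hb := by
    rw [hr p a ha, hr p b hb]
    exact hJ.orth p a (hAE p ha) b (hAE p hb)

lemma IsRestriction.act_eq (hr : IsRestriction A J' J) (hx : x ∈ Sections A) :
    J'.act x = J.act x := funext fun q => hr q _ (mem_sections_iff.1 hx q).2

lemma dorfman_neg_right' (hx : ∀ q, GenNear q x) (hy : ∀ q, GenNear q y) :
    dorfman x (-y) = - dorfman x y := funext fun q => dorfman_neg_right (hx q) (hy q)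

lemma dorfman_neg_left' (hx : ∀ q, GenNear q x) (hy : ∀ q, GenNear q y) :
    dorfman (-x) y = - dorfman x y := by
  have h1 : (-x : GenField F M) = fun q => (-1 : ℝ) • x q :=
    funext fun q => (neg_one_smul ℝ (x q : GenTangent F q)).symm
  rw [h1]
  exact funext fun q => (dorfman_const_smul_left (-1) (hx q) (hy q)).trans
    (neg_one_smul ℝ (dorfman x y q : GenTangent F q))

lemma mem_eigenSections {z : CGenField F M} :
    z ∈ eigenSections E J ↔ z.1 ∈ Sections E ∧ z.2 = - J.act z.1 := by
  constructor
  · rintro ⟨x, hx, rfl⟩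
    exact ⟨hx, rfl⟩
  · rintro ⟨h1, h2⟩
    exact ⟨z.1, h1, Prod.ext rfl h2⟩

/-- Real and imaginary parts of `[u, x - √-1 J x]`: a real section normalizes `J` iff its bracket
preserves `Γ(E)` and commutes with `J`. -/
lemma mem_sgfNormalizer (hJ : IsSGF E J) :
    u ∈ sgfNormalizer E J ↔ (∀ p, GenNear p u) ∧
      ∀ x ∈ Sections E, dorfman u x ∈ Sections E ∧ dorfman u (J.act x) = J.act (dorfman u x) := by
  have h0 : ∀ {x : GenField F M}, (∀ q, GenNear q x) → dorfman (0 : GenField F M) x = 0 :=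
    fun hx => funext fun q => dorfman_zero_left (hx q)
  have key : (∀ p, GenNear p u) → ∀ x ∈ Sections E,
      (cdorfman (u, 0) (x, - J.act x) ∈ eigenSections E J ↔
        dorfman u x ∈ Sections E ∧ dorfman u (J.act x) = J.act (dorfman u x)) := by
    intro hu x hx
    have hx1 := genNear_of_mem_sections hx
    have hx2 := genNear_of_mem_sections (hJ.act_mem hx)
    have hx3 := genNear_of_mem_sections (neg_mem_sections (hJ.act_mem hx))
    have h1 : cdorfman (u, 0) (x, - J.act x) = (dorfman u x, - dorfman u (J.act x)) := by
      refine Prod.ext ?_ ?_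
      · change dorfman u x - dorfman (0 : GenField F M) (- J.act x) = dorfman u x
        rw [h0 hx3, sub_zero]
      · change dorfman u (- J.act x) + dorfman (0 : GenField F M) x = - dorfman u (J.act x)
        rw [h0 hx1, add_zero, dorfman_neg_right' hu hx2]
    rw [h1, mem_eigenSections, neg_inj]
  constructor
  · rintro ⟨⟨hu, -⟩, h⟩
    have hu' : ∀ p, GenNear p u := genNear_of_mem_sections hu
    exact ⟨hu', fun x hx => (key hu' x hx).1 (h _ ⟨x, hx, rfl⟩)⟩
  · rintro ⟨hu, h⟩
    refine ⟨⟨mem_sections_iff.2 fun q => ⟨hu q, trivial⟩, zero_mem_sections⟩, ?_⟩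
    rintro _ ⟨x, hx, rfl⟩
    exact (key hu x hx).2 (h x hx)

/-- Real and imaginary parts of `[x - √-1 J x, y - √-1 J y]`. The second condition is the vanishing
of a Nijenhuis-type expression; the first is needed because `E` itself need not be involutive. -/
lemma isCRF_iff : IsCRF E J ↔ IsSGF E J ∧ ∀ x ∈ Sections E, ∀ y ∈ Sections E,
    dorfman x y - dorfman (J.act x) (J.act y) ∈ Sections E ∧
    J.act (dorfman x y - dorfman (J.act x) (J.act y)) =
      dorfman (J.act x) y + dorfman x (J.act y) := by
  refine and_congr_right fun hJ => ?_
  have key : ∀ x ∈ Sections E, ∀ y ∈ Sections E,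
      (cdorfman (x, - J.act x) (y, - J.act y) ∈ eigenSections E J ↔
        dorfman x y - dorfman (J.act x) (J.act y) ∈ Sections E ∧
        J.act (dorfman x y - dorfman (J.act x) (J.act y)) =
          dorfman (J.act x) y + dorfman x (J.act y)) := by
    intro x hx y hy
    have hx1 := genNear_of_mem_sections hx
    have hx2 := genNear_of_mem_sections (hJ.act_mem hx)
    have hy1 := genNear_of_mem_sections hy
    have hy2 := genNear_of_mem_sections (hJ.act_mem hy)
    have hy3 := genNear_of_mem_sections (neg_mem_sections (hJ.act_mem hy))
    have h1 : cdorfman (x, - J.act x) (y, - J.act y) =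
        (dorfman x y - dorfman (J.act x) (J.act y),
          - (dorfman (J.act x) y + dorfman x (J.act y))) := by
      refine Prod.ext ?_ ?_
      · change dorfman x y - dorfman (- J.act x) (- J.act y) = _
        rw [dorfman_neg_left' hx2 hy3, dorfman_neg_right' hx2 hy2, neg_neg]
      · change dorfman x (- J.act y) + dorfman (- J.act x) y = _
        rw [dorfman_neg_left' hx2 hy1, dorfman_neg_right' hx1 hy2, neg_add, add_comm]
    rw [h1, mem_eigenSections, neg_inj]
    exact and_congr_right fun _ => eq_comm
  constructor
  · intro h x hx y hy
    exact (key x hx y hy).1 (h _ ⟨x, hx, rfl⟩ _ ⟨y, hy, rfl⟩)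
  · rintro h _ ⟨x, hx, rfl⟩ _ ⟨y, hy, rfl⟩
    exact (key x hx y hy).2 (h x hx y hy)

variable [T2Space M]

lemma dorfman_secNear_of_mem_sgfNormalizer (hJ : IsSGF E J) (hu : u ∈ sgfNormalizer E J)
    (hx : SecNear E p x) :
    SecNear E p (dorfman u x) ∧ dorfman u (J.act x) p = J p (dorfman u x p) := by
  obtain ⟨hu, h⟩ := (mem_sgfNormalizer hJ).1 hu
  refine ⟨dorfman_secNear_of_sections hu (fun y hy => (h y hy).1) hx, ?_⟩
  obtain ⟨x', hx', he⟩ := hx.exists_section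
  have hr : ∀ᶠ q in 𝓝 p, u q = u q := Eventually.of_forall fun _ => rfl
  have he' : ∀ᶠ q in 𝓝 p, J.act x q = J.act x' q := he.mono fun q hq => by
    change J q (x q) = J q (x' q)
    rw [hq]
  rw [dorfman_congr hr he' (hu p) (genNear_of_mem_sections (hJ.act_mem hx') p),
    dorfman_congr hr (he.mono fun _ h => h.symm) (hu p) (genNear_of_mem_sections hx' p),
    (h x' hx').2]
  rfl

/-- The CRF identity for `u` and `x`, after removal of `J [u, x] = [u, J x]`, reads `-J [J u, J x] =
[J u, x]`; applying `J` gives `[J u, J x] = J [J u, x]`. It carries the normalizing hypothesis from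
`V₁ ⊕ W₁` to `V₂ ⊕ W₂`. -/
lemma act_mem_sgfNormalizer (hJ : IsCRF E J) (hu : u ∈ Sections E) (hn : u ∈ sgfNormalizer E J) :
    J.act u ∈ sgfNormalizer E J := by
  obtain ⟨hJ', hc⟩ := isCRF_iff.1 hJ
  obtain ⟨hu1, hn⟩ := (mem_sgfNormalizer hJ').1 hn
  have hJu := hJ'.act_mem hu
  have h1 : ∀ x ∈ Sections E, dorfman (J.act u) (J.act x) ∈ Sections E := by
    intro x hx
    have h2 := sub_mem_sections (hn x hx).1 (hc u hu x hx).1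
    rwa [sub_sub_cancel] at h2
  have h2 : ∀ x ∈ Sections E, dorfman (J.act u) x ∈ Sections E := by
    intro x hx
    have h3 := neg_mem_sections (h1 _ (hJ'.act_mem hx))
    rwa [hJ'.act_act hx, dorfman_neg_right' (genNear_of_mem_sections hJu)
      (genNear_of_mem_sections hx), neg_neg] at h3
  refine (mem_sgfNormalizer hJ').2 ⟨genNear_of_mem_sections hJu, fun x hx => ⟨h2 x hx, ?_⟩⟩
  have h3 := (hc u hu x hx).2
  rw [map_sub, (hn x hx).2, add_comm, sub_eq_add_neg, add_left_cancel_iff] at h3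
  rw [← h3, map_neg, hJ'.act_act (h1 x hx), neg_neg]

lemma IsBicontactDatum.gens_subset (h : IsBicontactDatum E E₁' E₂' L V₁ W₁ V₂ W₂)
    (hu : u ∈ V₁ ⊔ W₁) : u ∈ Sections (bicontactTotal E₁' E₂' L V₁ V₂) :=
  mem_sections_iff_secNear.2 fun p => (mem_sections_iff_secNear.1 (h.framing₁.2.2.2.1 hu) p).mono
    fun _ => le_sup_right.trans le_sup_left

lemma bicontactTotal_swap (E₁' E₂' L : FibreFamily F M) (V₁ V₂ : Submodule ℝ (GenField F M)) :
    bicontactTotal E₂' E₁' L V₂ V₁ = bicontactTotal E₁' E₂' L V₁ V₂ := sup_comm _ _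

/-- As `J² = -1` and real subspaces absorb signs, `J` maps `V₂` and `W₂` back onto `V₁` and `W₁`;
the normalizing condition for the second index comes from `act_mem_sgfNormalizer`. -/
lemma IsHermitianBicontactDatum.swap (h : IsHermitianBicontactDatum E E₁' E₂' J L V₁ W₁ V₂ W₂) :
    IsHermitianBicontactDatum E E₂' E₁' J L V₂ W₂ V₁ W₁ := by
  have hJ := h.crf.1
  have hmap : ∀ V ≤ V₁ ⊔ W₁, (V.map J.act).map J.act = V := by
    intro V hV
    have h1 : ∀ x ∈ V, J.act (J.act x) = -x := fun x hx =>
      hJ.act_act (h.bicontact.gens_subset (hV hx))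
    ext x
    constructor
    · rintro ⟨_, ⟨y, hy, rfl⟩, rfl⟩
      rw [h1 y hy]
      exact neg_mem hy
    · intro hx
      exact ⟨J.act (-x), ⟨-x, neg_mem hx, rfl⟩, by rw [map_neg, map_neg, h1 x hx, neg_neg]⟩
  refine
    { bicontact := h.bicontact.swap
      crf := by rw [bicontactTotal_swap]; exact h.crf
      normalizes := ?_
      mapV := by rw [← h.mapV, hmap _ le_sup_left]
      mapW := by rw [← h.mapW, hmap _ le_sup_right]
      preserves := by rw [sup_comm W₂]; exact h.preserves }
  rw [bicontactTotal_swap, ← h.mapV, ← h.mapW, ← Submodule.map_sup]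
  rintro _ ⟨u, hu, rfl⟩
  rw [h.mapV]
  exact act_mem_sgfNormalizer h.crf (h.bicontact.gens_subset hu) (h.normalizes hu)

lemma IsAdaptable.swap (hL : Orthogonal L L) (h : IsAdaptable E₁' E₂' J L V₁ V₂) :
    IsAdaptable E₂' E₁' J L V₂ V₁ := by
  have h1 := HasCommutingFramings.swap hL h
  unfold IsAdaptable
  rw [bicontactTotal_swap]
  intro p
  obtain ⟨U, hU, hp, K₁, K₂, a, b, c, d, f, g⟩ := h1 p
  exact ⟨U, hU, hp, K₁, K₂, a, b, c, d, f, g.symm⟩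

end SGF

/-! ### Invariance of the summands under `J` -/

section Hermitian

variable {F : Type*} [NormedAddCommGroup F] [NormedSpace ℝ F] [FiniteDimensional ℝ F]
variable {M : Type*} [TopologicalSpace M] [ChartedSpace F M] [IsManifold 𝓘(ℝ, F) ∞ M]
variable {p : M} {u v w x y z v₁ v₂ w₁ w₂ : GenField F M} {f : M → ℝ}
variable {E E₁' E₂' L : FibreFamily F M} {J J₁ Ψ : EndFamily F M}
variable {r₁ r₂ : ℕ} {e : Fin r₁ → GenField F M} {e' : Fin r₂ → GenField F M}

lemma dorfman_smul_add_smul (s t : ℝ) (hv : ∀ q, GenNear q v) (hw : ∀ q, GenNear q w)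
    (hx : ∀ q, GenNear q x) :
    dorfman (s • v + t • w) x = s • dorfman v x + t • dorfman w x := by
  funext q
  have h1 := dorfman_add_left ((hv q).smul (.const s)) ((hw q).smul (.const t)) (hx q)
  rw [dorfman_const_smul_left s (hv q) (hx q), dorfman_const_smul_left t (hw q) (hx q)] at h1
  exact h1

/-- Combines invariance with skew-symmetry. A component of the bracket of two arbitrary sections
becomes a question about the single operator `[z, ·]`. -/
lemma pairing_dorfman_cyclic (hx : GenNear p x) (hy : GenNear p y) (hz : GenNear p z)
    (hxz : ∀ᶠ q in 𝓝 p, pair x z q = 0) (hyz : ∀ᶠ q in 𝓝 p, pair y z q = 0) :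
    pairing p (dorfman x y p) (z p) = pairing p (y p) (dorfman z x p) := by
  rw [pairing_dorfman_eq_neg hx hy hz hyz, dorfman_eq_neg hx hz hxz, map_neg, neg_neg]

/-- The factor 2 undoes the `1 / 2` in the inner product. -/
lemma anchorDeriv_eq_pairing (f : M → ℝ) (z : GenField F M) (p : M) :
    anchorDeriv z f p = 2 * pairing p ((0, funDeriv f p) : GenTangent F p) (z p) := by
  rw [pairing_apply]
  change funDeriv f p (z p).1 = _
  simp

lemma bicontactSummand_le_total (V₁ V₂ : Submodule ℝ (GenField F M)) (p : M) :
    bicontactSummand L V₁ V₂ p ≤ bicontactTotal E₁' E₂' L V₁ V₂ p := le_sup_left.trans le_sup_left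

lemma kerBundle_le_total (V₁ V₂ : Submodule ℝ (GenField F M)) (p : M) :
    kerBundle V₂ L p ≤ bicontactTotal E₁' E₂' L V₁ V₂ p :=
  (kerBundle_le_bicontactSummand V₁ V₂ p).trans (bicontactSummand_le_total V₁ V₂ p)

variable [T2Space M]

variable (h : IsHermitianBicontactDatum E E₁' E₂' J L (ℝ ∙ v₁) (ℝ ∙ w₁) (ℝ ∙ v₂) (ℝ ∙ w₂))
include h

namespace IsHermitianBicontactDatum

lemma E_le_total (p : M) : E p ≤ bicontactTotal E₁' E₂' L (ℝ ∙ v₁) (ℝ ∙ v₂) p := by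
  rw [← h.bicontact.sup_summand]
  exact sup_le_sup le_sup_left le_sup_left

lemma gen_mem_total (hu : u = v₁ ∨ u = v₂ ∨ u = w₁ ∨ u = w₂) (p : M) :
    u p ∈ bicontactTotal E₁' E₂' L (ℝ ∙ v₁) (ℝ ∙ v₂) p := by
  have h1 : E₁' p ≤ bicontactTotal E₁' E₂' L (ℝ ∙ v₁) (ℝ ∙ v₂) p := le_sup_right.trans le_sup_left
  have h2 : E₂' p ≤ bicontactTotal E₁' E₂' L (ℝ ∙ v₁) (ℝ ∙ v₂) p := le_sup_right.trans le_sup_right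
  rcases hu with rfl | rfl | rfl | rfl
  exacts [h1 (h.bicontact.gens₁.left_mem p), h2 (h.bicontact.gens₂.left_mem p),
    h1 (h.bicontact.gens₁.right_mem p), h2 (h.bicontact.gens₂.right_mem p)]

lemma pairing_gen (hu : u = v₁ ∨ u = v₂ ∨ u = w₁ ∨ u = w₂) {a : GenTangent F p} (ha : a ∈ E p) :
    pairing p a (u p) = 0 := by
  have hb := h.bicontact
  rcases hu with rfl | rfl | rfl | rfl
  exacts [hb.orth₁ p a ha _ (hb.gens₁.left_mem p), hb.orth₂ p a ha _ (hb.gens₂.left_mem p),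
    hb.orth₁ p a ha _ (hb.gens₁.right_mem p), hb.orth₂ p a ha _ (hb.gens₂.right_mem p)]

/-- `E''` is the orthogonal sum of `E₁` and the nondegenerate bundle `E₁' ⊕ E₂ ⊕ E₂'`, so lying in
`E₁` means being orthogonal to the latter. -/
lemma mem_summand_of_total {a : GenTangent F p}
    (ha : a ∈ bicontactTotal E₁' E₂' L (ℝ ∙ v₁) (ℝ ∙ v₂) p)
    (h₂ : ∀ b ∈ bicontactSummand L (ℝ ∙ v₂) (ℝ ∙ v₁) p, pairing p a b = 0)
    (hu : ∀ u, (u = v₁ ∨ u = v₂ ∨ u = w₁ ∨ u = w₂) → pairing p a (u p) = 0) :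
    a ∈ bicontactSummand L (ℝ ∙ v₁) (ℝ ∙ v₂) p := by
  have hb := h.bicontact
  have horth : Orthogonal (bicontactSummand L (ℝ ∙ v₁) (ℝ ∙ v₂))
      (E₁' ⊔ (bicontactSummand L (ℝ ∙ v₂) (ℝ ∙ v₁) ⊔ E₂')) :=
    hb.orth_gens.sup_right (hb.orth_summand.sup_right hb.orth_gens')
  have hnd := h.crf.1.nondegAt p
  have hT : bicontactTotal E₁' E₂' L (ℝ ∙ v₁) (ℝ ∙ v₂) = bicontactSummand L (ℝ ∙ v₁) (ℝ ∙ v₂) ⊔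
      (E₁' ⊔ (bicontactSummand L (ℝ ∙ v₂) (ℝ ∙ v₁) ⊔ E₂')) := sup_assoc _ _ _
  rw [hT] at hnd ha
  refine horth.mem_left (horth.symm.nondegAt_left (by rwa [sup_comm])) ha fun b hb' => ?_
  obtain ⟨b₁, hb₁, b₂, hb₂, rfl⟩ := Submodule.mem_sup.1 hb'
  obtain ⟨b₂, hb₂', b₃, hb₃, rfl⟩ := Submodule.mem_sup.1 hb₂
  rw [map_add, map_add, h₂ b₂ hb₂', hb.gens₁.pairing_eq_zero (hu v₁ (Or.inl rfl))
    (hu w₁ (Or.inr (Or.inr (Or.inl rfl)))) hb₁, hb.gens₂.pairing_eq_zero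
    (hu v₂ (Or.inr (Or.inl rfl))) (hu w₂ (Or.inr (Or.inr (Or.inr rfl)))) hb₃, add_zero, add_zero]

lemma gen_mem_sgfNormalizer (hu : u = v₁ ∨ u = v₂ ∨ u = w₁ ∨ u = w₂) :
    u ∈ sgfNormalizer (bicontactTotal E₁' E₂' L (ℝ ∙ v₁) (ℝ ∙ v₂)) J := by
  have h1 := h.normalizes
  have h2 := h.swap.normalizes
  rw [bicontactTotal_swap] at h2
  rcases hu with rfl | rfl | rfl | rfl
  exacts [h1 (Submodule.mem_sup_left (Submodule.mem_span_singleton_self _)),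
    h2 (Submodule.mem_sup_left (Submodule.mem_span_singleton_self _)),
    h1 (Submodule.mem_sup_right (Submodule.mem_span_singleton_self _)),
    h2 (Submodule.mem_sup_right (Submodule.mem_span_singleton_self _))]

lemma act_left (p : M) : ∃ c : ℝ, J p (v₁ p) = c • v₂ p := by
  have h1 : J.act v₁ ∈ ℝ ∙ v₂ := by
    rw [← h.mapV]
    exact ⟨v₁, Submodule.mem_span_singleton_self _, rfl⟩
  obtain ⟨c, hc⟩ := Submodule.mem_span_singleton.1 h1
  exact ⟨c, (congrFun hc p).symm⟩

lemma act_right (p : M) : ∃ c : ℝ, J p (w₁ p) = c • w₂ p := by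
  have h1 : J.act w₁ ∈ ℝ ∙ w₂ := by
    rw [← h.mapW]
    exact ⟨w₁, Submodule.mem_span_singleton_self _, rfl⟩
  obtain ⟨c, hc⟩ := Submodule.mem_span_singleton.1 h1
  exact ⟨c, (congrFun hc p).symm⟩

/-- Write `J a = l + s w₁ + t w₂`. Pairing with `v₁` gives `s⟨w₁, v₁⟩ = -⟨a, J v₁⟩`, which is zero
because `J v₁` is a multiple of `v₂` and `a ∈ E`; likewise for `t`. -/
lemma act_mem_L {a : GenTangent F p} (ha : a ∈ L p) : J p a ∈ L p := by
  have hb := h.bicontact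
  have h1 := h.preserves p a (Submodule.mem_sup_left ha)
  have h2 : spanBundle ((ℝ ∙ w₁) ⊔ (ℝ ∙ w₂)) p = (ℝ ∙ w₁ p) ⊔ (ℝ ∙ w₂ p) := by
    rw [spanBundle, Submodule.map_sup, ← spanBundle_singleton, ← spanBundle_singleton]
    rfl
  have hgen := fun {u} (hu : u = v₁ ∨ u = v₂ ∨ u = w₁ ∨ u = w₂) {a : GenTangent F p}
    (ha : a ∈ L p) => h.pairing_gen hu (hb.L_le p ha)
  rw [h2] at h1
  obtain ⟨l, hl, b, hb', hlb⟩ := Submodule.mem_sup.1 h1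
  obtain ⟨b₁, hb₁, b₂, hb₂, rfl⟩ := Submodule.mem_sup.1 hb'
  obtain ⟨s, rfl⟩ := Submodule.mem_span_singleton.1 hb₁
  obtain ⟨t, rfl⟩ := Submodule.mem_span_singleton.1 hb₂
  have h3 : pairing p (J p a) (v₁ p) = 0 := by
    obtain ⟨c, hc⟩ := h.act_left p
    rw [h.crf.1.skew p a (h.E_le_total p (hb.L_le p ha)) _ (h.gen_mem_total (Or.inl rfl) p), hc,
      map_smul, hgen (Or.inr (Or.inl rfl)) ha, smul_zero, neg_zero]
  have h4 : pairing p (J p a) (v₂ p) = 0 := by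
    obtain ⟨c, hc⟩ := h.swap.act_left p
    rw [h.crf.1.skew p a (h.E_le_total p (hb.L_le p ha)) _
      (h.gen_mem_total (Or.inr (Or.inl rfl)) p), hc, map_smul, hgen (Or.inl rfl) ha, smul_zero,
      neg_zero]
  have h5 : pairing p (w₂ p) (v₁ p) = 0 :=
    hb.orth₁₂.symm p _ (hb.gens₂.right_mem p) _ (hb.gens₁.left_mem p)
  have h6 : pairing p (w₁ p) (v₂ p) = 0 :=
    hb.orth₁₂ p _ (hb.gens₁.right_mem p) _ (hb.gens₂.left_mem p)
  rw [← hlb] at h3 h4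
  simp only [map_add, map_smul, LinearMap.add_apply, LinearMap.smul_apply, hgen (Or.inl rfl) hl, h5,
    smul_eq_mul, mul_zero, zero_add, add_zero, mul_eq_zero] at h3
  simp only [map_add, map_smul, LinearMap.add_apply, LinearMap.smul_apply,
    hgen (Or.inr (Or.inl rfl)) hl, h6, smul_eq_mul, mul_zero, zero_add, mul_eq_zero] at h4
  rw [pairing_comm] at h3 h4
  rw [← hlb, h3.resolve_right (hb.gens₁.ne_zero p), h4.resolve_right (hb.gens₂.ne_zero p),
    zero_smul, zero_smul, add_zero, add_zero]
  exact hl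

/-- Since `[v₂, ·]` commutes with `J`, the sections `J (e i)` are again annihilated by it. -/
lemma act_mem_ker {a : GenTangent F p} (ha : a ∈ kerBundle (ℝ ∙ v₂) L p) :
    J p a ∈ kerBundle (ℝ ∙ v₂) L p := by
  obtain ⟨r₁, r₂, e, e', c⟩ := h.bicontact.exists_commFrames p
  suffices h1 : kerBundle (ℝ ∙ v₂) L p ≤ (kerBundle (ℝ ∙ v₂) L p).comap (J p) from h1 ha
  conv_lhs => rw [← c.frame₁.span_eq]
  refine Submodule.span_le.2 ?_
  rintro _ ⟨i, rfl⟩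
  have heL : SecNear L p (e i) := (c.frame₁.secNear i).mono (kerBundle_le _ _)
  have heT := heL.mono fun q => (h.bicontact.L_le q).trans (h.E_le_total q)
  refine mem_kerBundle h.bicontact.gens₂.near_left (x := J.act (e i))
    ⟨(h.crf.1.secNear heT).1, heL.2.mono fun q hq => h.act_mem_L hq⟩ ?_
  filter_upwards [heT.eventually, c.ker₁] with q hq h0
  rw [(dorfman_secNear_of_mem_sgfNormalizer h.crf.1 (h.gen_mem_sgfNormalizer (Or.inr (Or.inl rfl)))
    hq).2, h0 i, map_zero]

lemma secNear_act_ker (hx : SecNear (kerBundle (ℝ ∙ v₂) L) p x) :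
    SecNear (kerBundle (ℝ ∙ v₂) L) p (J.act x) :=
  ⟨(h.crf.1.secNear (hx.mono (kerBundle_le_total _ _))).1, hx.2.mono fun _ hq => h.act_mem_ker hq⟩

lemma act_dorfman (hx : SecNear (kerBundle (ℝ ∙ v₂) L) p x) :
    J.act (dorfman v₁ x) p = dorfman v₁ (J.act x) p :=
  (dorfman_secNear_of_mem_sgfNormalizer h.crf.1 (h.gen_mem_sgfNormalizer (Or.inl rfl))
    (hx.mono (kerBundle_le_total _ _))).2.symm

/-- On the frame, `J [v₁, e i] = [v₁, J (e i)]` with `J (e i)` in `L₁`. -/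
lemma act_mem_summand {a : GenTangent F p} (ha : a ∈ bicontactSummand L (ℝ ∙ v₁) (ℝ ∙ v₂) p) :
    J p a ∈ bicontactSummand L (ℝ ∙ v₁) (ℝ ∙ v₂) p := by
  obtain ⟨r₁, r₂, e, e', c⟩ := h.bicontact.exists_commFrames p
  suffices h1 : bicontactSummand L (ℝ ∙ v₁) (ℝ ∙ v₂) p ≤
    (bicontactSummand L (ℝ ∙ v₁) (ℝ ∙ v₂) p).comap (J p) from h1 ha
  conv_lhs => rw [← (h.bicontact.frameAt_summand c).span_eq]
  refine Submodule.span_le.2 ?_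
  rintro _ ⟨i | i, rfl⟩
  · exact kerBundle_le_bicontactSummand _ _ _ (h.act_mem_ker (c.frame₁.secNear i).mem)
  · change J.act (dorfman v₁ (e i)) p ∈ bicontactSummand L (ℝ ∙ v₁) (ℝ ∙ v₂) p
    rw [h.act_dorfman (c.frame₁.secNear i)]
    exact dorfman_mem_bicontactSummand h.bicontact.gens₁.near_left
      (h.secNear_act_ker (c.frame₁.secNear i))

lemma secNear_act_summand (hx : SecNear (bicontactSummand L (ℝ ∙ v₁) (ℝ ∙ v₂)) p x) :
    SecNear (bicontactSummand L (ℝ ∙ v₁) (ℝ ∙ v₂)) p (J.act x) :=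
  ⟨(h.crf.1.secNear (hx.mono (bicontactSummand_le_total _ _))).1, hx.2.mono fun _ hq => h.act_mem_summand hq⟩

lemma isSGF_summand (hJ₁ : IsRestriction (bicontactSummand L (ℝ ∙ v₁) (ℝ ∙ v₂)) J₁ J) :
    IsSGF (bicontactSummand L (ℝ ∙ v₁) (ℝ ∙ v₂)) J₁ := by
  obtain ⟨r, hr⟩ := h.bicontact.subbundle₁
  exact h.crf.1.restrict ⟨r, h.bicontact.isSplit_summand hr⟩ (bicontactSummand_le_total _ _)
    (fun p a ha => h.act_mem_summand ha) hJ₁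

lemma act_mem_gens {a : GenTangent F p} (ha : a ∈ E₁' p) : J p a ∈ E₂' p := by
  have hb := h.bicontact
  obtain ⟨s, hs⟩ := h.act_left p
  obtain ⟨t, ht⟩ := h.act_right p
  rw [hb.gens₁.span_eq] at ha
  obtain ⟨a₁, ha₁, a₂, ha₂, rfl⟩ := Submodule.mem_sup.1 ha
  obtain ⟨c, rfl⟩ := Submodule.mem_span_singleton.1 ha₁
  obtain ⟨d, rfl⟩ := Submodule.mem_span_singleton.1 ha₂
  rw [map_add, map_smul, map_smul, hs, ht]
  exact add_mem (Submodule.smul_mem _ _ (Submodule.smul_mem _ _ (hb.gens₂.left_mem p)))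
    (Submodule.smul_mem _ _ (Submodule.smul_mem _ _ (hb.gens₂.right_mem p)))

lemma isSGF_gens (hΨ : IsRestriction (E₁' ⊔ E₂') Ψ J) : IsSGF (E₁' ⊔ E₂') Ψ := by
  refine h.crf.1.restrict ⟨2, h.bicontact.contact.split'⟩
    (fun q => sup_le_sup le_sup_right le_sup_right) (fun p a ha => ?_) hΨ
  obtain ⟨a₁, ha₁, a₂, ha₂, rfl⟩ := Submodule.mem_sup.1 ha
  rw [map_add, add_comm]
  exact Submodule.add_mem_sup (h.swap.act_mem_gens ha₂) (h.act_mem_gens ha₁)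

/-- If `z` commutes with `v₁` and with an adapted framing of `L₁`, then
`⟨J b, [z, J x]⟩ = ⟨b, [z, x]⟩` for `b`, `x` in `E₁`. -/
lemma pairing_act_dorfman_act (c : CommFrames L v₁ v₂ p e e')
    (hz : SecNear (bicontactSummand L (ℝ ∙ v₂) (ℝ ∙ v₁)) p z)
    (h1 : ∀ᶠ q in 𝓝 p, ∀ i, dorfman z (e i) q = 0) (h2 : ∀ᶠ q in 𝓝 p, dorfman z v₁ q = 0)
    (had : ∀ᶠ q in 𝓝 p, ∀ i j, anchorDeriv z (pair (J.act (e i)) (dorfman v₁ (e j))) q = 0)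
    (hx : SecNear (bicontactSummand L (ℝ ∙ v₁) (ℝ ∙ v₂)) p x) {b : GenTangent F p}
    (hb : b ∈ bicontactSummand L (ℝ ∙ v₁) (ℝ ∙ v₂) p) :
    pairing p (J p b) (dorfman z (J.act x) p) = pairing p b (dorfman z x p) := by
  have hB := h.bicontact
  have hv₁ := hB.gens₁.near_left
  have hA : ∀ᶠ q in 𝓝 p, ∀ i, dorfman z (dorfman v₁ (e i)) q = 0 := by
    filter_upwards [hz.eventually, eventually_eventually_nhds.2 h1, eventually_eventually_nhds.2 h2,
      c.eventually] with q a1 a2 a3 a4 i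
    exact dorfman_dorfman_eq_zero a1.1 (hv₁ q) (a4.frame₁.1 i) a3 (a2.mono fun _ h => h i)
  -- By invariance the pairing of `[z, J (e i)]` with `e j` is `-⟨J (e i), [z, e j]⟩ = 0`; its
  -- pairing with `[v₁, e j]` is the derivative of `⟨J (e i), [v₁, e j]⟩` along `z`, zero by `had`.
  have hX : ∀ᶠ q in 𝓝 p, ∀ i, ∀ b ∈ bicontactSummand L (ℝ ∙ v₁) (ℝ ∙ v₂) q,
      pairing q (dorfman z (J.act (e i)) q) b = 0 := by
    filter_upwards [hz.eventually, h1, hA, had, c.eventually] with q a1 a2 a3 a4 a5 i b hb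
    have hJe := h.secNear_act_ker (a5.frame₁.secNear i)
    refine hB.pairing_summand_eq_zero a5 hb (fun j => ?_) fun j => ?_
    · rw [pairing_dorfman_eq_neg a1.1 hJe.1 (a5.frame₁.1 j), a2 j, map_zero, neg_zero]
      exact hB.pair_eq_zero (hJe.mono (kerBundle_le _ _))
        ((a5.frame₁.secNear j).mono (kerBundle_le _ _))
    · have h3 := anchorDeriv_pair a1.1 hJe.1 ((hv₁ q).dorfman (a5.frame₁.1 j))
      rw [a4 i j, a3 j, map_zero, add_zero] at h3
      exact h3.symm
  -- Here `[z, J [v₁, e i]] = [v₁, [z, J (e i)]]`, and `[v₁, ·]` keeps a section orthogonal to `E₁`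
  -- because `v₁` preserves `Γ(E₁)`.
  have hY : ∀ i, ∀ b ∈ bicontactSummand L (ℝ ∙ v₁) (ℝ ∙ v₂) p,
      pairing p (dorfman z (J.act (dorfman v₁ (e i))) p) b = 0 := by
    intro i b hb
    obtain ⟨r, hr⟩ := hB.subbundle₁
    obtain ⟨y, hy, rfl⟩ := (hB.isSplit_summand hr).1.exists_section hb
    have hy := mem_sections_iff_secNear.1 hy p
    have hJe := h.secNear_act_ker (c.frame₁.secNear i)
    rw [dorfman_congr (y' := dorfman v₁ (J.act (e i))) (Eventually.of_forall fun _ => rfl)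
      (c.eventually.mono fun q hq => h.act_dorfman (hq.frame₁.secNear i)) hz.1
      ((hv₁ p).dorfman hJe.1), dorfman_jacobi_of_eq_zero hz.1 (hv₁ p) hJe.1 h2,
      pairing_dorfman_eq_neg (hv₁ p) (hz.1.dorfman hJe.1) hy.1,
      hX.self_of_nhds i _ (hB.dorfman_secNear_summand (Or.inl rfl) hy).mem, neg_zero]
    filter_upwards [hX, hy.2] with q a1 a2 using a1 i _ a2
  have hfr := hB.frameAt_summand c
  obtain ⟨f, hf, hfx⟩ := hfr.exists_coeff hx
  have hJg : ∀ i, SecNear _ p (J.act ((Sum.elim e fun i => dorfman v₁ (e i)) i)) := fun i =>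
    h.secNear_act_summand (hfr.secNear i)
  have hJx : ∀ᶠ q in 𝓝 p, J.act x q =
      ∑ i, f i q • J.act ((Sum.elim e fun i => dorfman v₁ (e i)) i) q := by
    filter_upwards [hfx] with q hq
    change J q (x q) = _
    rw [hq, map_sum]
    exact Finset.sum_congr rfl fun i _ => map_smul _ _ _
  have hr : ∀ᶠ q in 𝓝 p, z q = z q := Eventually.of_forall fun _ => rfl
  rw [dorfman_congr hr hfx hz.1 (GenNear.sum fun i _ => (hfr.1 i).smul (hf i)),
    dorfman_sum_right _ hf hz.1 hfr.1,
    dorfman_congr hr hJx hz.1 (GenNear.sum fun i _ => (hJg i).1.smul (hf i)),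
    dorfman_sum_right _ hf hz.1 fun i => (hJg i).1, map_sum, map_sum]
  -- Only the terms with the derivative of `f i` along `z` survive on either side, and they agree
  -- because `J` is orthogonal.
  refine Finset.sum_congr rfl fun i _ => ?_
  have hJb := h.act_mem_summand hb
  have h3 : pairing p (J p b) (dorfman z (J.act ((Sum.elim e fun i => dorfman v₁ (e i)) i)) p) = 0 := by
    rw [pairing_comm]
    rcases i with i | i
    exacts [hX.self_of_nhds i _ hJb, hY i _ hJb]
  have h4 : dorfman z ((Sum.elim e fun i => dorfman v₁ (e i)) i) p = 0 := by
    rcases i with i | i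
    exacts [h1.self_of_nhds i, hA.self_of_nhds i]
  have h5 : pairing p (J p b) (J.act ((Sum.elim e fun i => dorfman v₁ (e i)) i) p) =
      pairing p b ((Sum.elim e fun i => dorfman v₁ (e i)) i p) :=
    h.crf.1.orth p b (bicontactSummand_le_total _ _ p hb) _ (bicontactSummand_le_total _ _ p (hfr.secNear i).mem)
  rw [map_add, map_add, map_smul, map_smul, map_smul, map_smul, h3, h4, h5, map_zero]

end IsHermitianBicontactDatum

end Hermitian

/-! ### Adaptability, the CRF property of `J₁`, and the normal contact datum -/

section Adapted

variable {F : Type*} [NormedAddCommGroup F] [NormedSpace ℝ F] [FiniteDimensional ℝ F]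
variable {M : Type*} [TopologicalSpace M] [ChartedSpace F M] [IsManifold 𝓘(ℝ, F) ∞ M]
variable [T2Space M]
variable {p : M} {u v w x y z v₁ v₂ w₁ w₂ : GenField F M}
variable {E E₁' E₂' L : FibreFamily F M} {J J₁ : EndFamily F M}
variable {r₁ r₂ : ℕ} {e : Fin r₁ → GenField F M} {e' : Fin r₂ → GenField F M}

variable (h : IsHermitianBicontactDatum E E₁' E₂' J L (ℝ ∙ v₁) (ℝ ∙ w₁) (ℝ ∙ v₂) (ℝ ∙ w₂))
include h

namespace IsHermitianBicontactDatum

lemma exists_adapted_commFrames (had : IsAdaptable E₁' E₂' J L (ℝ ∙ v₁) (ℝ ∙ v₂)) (p : M) :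
    ∃ (r₁ r₂ : ℕ) (e : Fin r₁ → GenField F M) (e' : Fin r₂ → GenField F M),
      CommFrames L v₁ v₂ p e e' ∧ ∀ᶠ q in 𝓝 p, ∀ i j,
        ((0, funDeriv (pair (J.act (e i)) (dorfman v₁ (e j))) q) : GenTangent F q) ∈
          (bicontactSummand L (ℝ ∙ v₁) (ℝ ∙ v₂) ⊔ E₁') q := by
  obtain ⟨r₁, h₁⟩ := h.bicontact.subbundle₁
  obtain ⟨r₂, h₂⟩ := h.bicontact.subbundle₂
  obtain ⟨U, hU, hp, K₁, K₂, hP, e, e', he, -, hc⟩ := had.exists_commFrames h₁ h₂ p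
  refine ⟨r₁, r₂, e, e', hc, ?_⟩
  filter_upwards [hU.mem_nhds hp] with q hq i j
  exact (hP.1 (e i) (he i) (e j) (he j) v₁ (Submodule.mem_span_singleton_self _)).2 q hq

/-- `[x, y] - [J x, J y]` is orthogonal to `E₂` for sections `x`, `y` of `E₁`. -/
lemma pairing_dorfman_summand (had : IsAdaptable E₁' E₂' J L (ℝ ∙ v₁) (ℝ ∙ v₂))
    (hx : SecNear (bicontactSummand L (ℝ ∙ v₁) (ℝ ∙ v₂)) p x)
    (hy : SecNear (bicontactSummand L (ℝ ∙ v₁) (ℝ ∙ v₂)) p y) {b : GenTangent F p}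
    (hb : b ∈ bicontactSummand L (ℝ ∙ v₂) (ℝ ∙ v₁) p) :
    pairing p (dorfman x y p - dorfman (J.act x) (J.act y) p) b = 0 := by
  have hB := h.bicontact
  have hL := hB.contact.isotropic
  have hv₁ := hB.gens₁.near_left
  have hv₂ := hB.gens₂.near_left
  obtain ⟨r₁, r₂, e, e', c, hd⟩ := h.exists_adapted_commFrames had p
  have c' := c.swap hL
  have hpair : ∀ {q x z}, SecNear (bicontactSummand L (ℝ ∙ v₁) (ℝ ∙ v₂)) q x →
      SecNear (bicontactSummand L (ℝ ∙ v₂) (ℝ ∙ v₁)) q z → ∀ᶠ r in 𝓝 q, pair x z r = 0 := by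
    intro q x z hx hz
    filter_upwards [hx.2, hz.2] with r a1 a2 using hB.orth_summand r _ a1 _ a2
  have key : ∀ z, SecNear (bicontactSummand L (ℝ ∙ v₂) (ℝ ∙ v₁)) p z →
      (∀ᶠ q in 𝓝 p, ∀ i, dorfman z (e i) q = 0) → (∀ᶠ q in 𝓝 p, dorfman z v₁ q = 0) →
      pairing p (dorfman x y p - dorfman (J.act x) (J.act y) p) (z p) = 0 := by
    intro z hz h1 h2
    have hJx := h.secNear_act_summand hx
    have hJy := h.secNear_act_summand hy
    -- Adaptability enters here: the differential lies in `E₁''`, which is orthogonal to `z` in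
    -- `E₂`.
    have h3 := h.pairing_act_dorfman_act c hz h1 h2 (by
      filter_upwards [hd, hz.2] with q a1 a2 i j
      rw [anchorDeriv_eq_pairing, (hB.orth_summand.sup_left hB.swap.orth_gens'.symm) q _ (a1 i j) _ a2,
        mul_zero]) hx hy.mem
    -- By cyclicity the pairing equals `⟨y, [z, x]⟩ - ⟨J y, [z, J x]⟩`.
    rw [map_sub, LinearMap.sub_apply,
      pairing_dorfman_cyclic hx.1 hy.1 hz.1 (hpair hx hz) (hpair hy hz),
      pairing_dorfman_cyclic hJx.1 hJy.1 hz.1 (hpair hJx hz) (hpair hJy hz), ← h3]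
    exact sub_self _
  have hEv : ∀ {q x}, SecNear E q x → ∀ u, (u = v₁ ∨ u = v₂ ∨ u = w₁ ∨ u = w₂) →
      dorfman u x q = 0 → dorfman x u q = 0 := by
    intro q x hx u hu h0
    rw [dorfman_eq_neg hx.1 (hB.near hu q), h0, neg_zero]
    exact hx.2.mono fun r hr => h.pairing_gen hu hr
  -- `E₂` is framed by `e'` and `[v₂, e']`; both families commute with `e` and `v₁`, the second by
  -- the Jacobi identity.
  refine hB.swap.pairing_summand_eq_zero c' hb (fun j => ?_) fun j => ?_
  · refine key _ ((c.frame₂.secNear j).mono (kerBundle_le_bicontactSummand _ _)) ?_ ?_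
    · filter_upwards [c'.comm] with q hq i using hq j i
    · filter_upwards [c.eventually] with q hq
      exact hEv ((hq.frame₂.secNear j).mono fun r => (kerBundle_le _ _ r).trans (hB.L_le r)) v₁
        (Or.inl rfl) (hq.ker₂.self_of_nhds j)
  · refine key _ (secNear_dorfman_summand hv₂ (c.frame₂.secNear j)) ?_ ?_
    · filter_upwards [c.eventually] with q hq i
      have hz := secNear_dorfman_summand hv₂ (hq.frame₂.secNear j)
      have he := (hq.frame₁.secNear i).mono (kerBundle_le_bicontactSummand (ℝ ∙ v₁) (ℝ ∙ v₂))
      rw [dorfman_eq_neg hz.1 he.1, dorfman_dorfman_eq_zero he.1 (hv₂ q) (hq.frame₂.1 j), neg_zero]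
      · filter_upwards [hq.eventually] with r hr
        exact hEv ((hr.frame₁.secNear i).mono fun s => (kerBundle_le _ _ s).trans (hB.L_le s)) v₂
          (Or.inr (Or.inl rfl)) (hr.ker₁.self_of_nhds i)
      · exact hq.comm.mono fun _ h => h i j
      · rw [pair_comm]
        exact hpair he hz
    · filter_upwards [c.eventually] with q hq
      refine hEv ((secNear_dorfman_summand hv₂ (hq.frame₂.secNear j)).mono hB.swap.summand_le) v₁
        (Or.inl rfl) ?_
      refine dorfman_dorfman_eq_zero (hv₁ q) (hv₂ q) (hq.frame₂.1 j) ?_ (hq.ker₂.mono fun _ h => h j)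
      rw [hB.commute (Or.inl rfl) (Or.inr (Or.inl rfl))]
      exact Eventually.of_forall fun _ => rfl

/-- `[x, y] - [J x, J y]` is orthogonal to `E₁' ⊕ E₂'` for sections `x`, `y` of `E₁`. -/
lemma pairing_dorfman_gen (hu : u = v₁ ∨ u = v₂ ∨ u = w₁ ∨ u = w₂)
    (hx : SecNear (bicontactSummand L (ℝ ∙ v₁) (ℝ ∙ v₂)) p x)
    (hy : SecNear (bicontactSummand L (ℝ ∙ v₁) (ℝ ∙ v₂)) p y) :
    pairing p (dorfman x y p - dorfman (J.act x) (J.act y) p) (u p) = 0 := by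
  have hB := h.bicontact
  have hpair : ∀ {x}, SecNear (bicontactSummand L (ℝ ∙ v₁) (ℝ ∙ v₂)) p x →
      ∀ᶠ q in 𝓝 p, pair x u q = 0 := fun hx =>
    hx.2.mono fun q hq => h.pairing_gen hu (hB.summand_le q hq)
  have hJx := h.secNear_act_summand hx
  have hJy := h.secNear_act_summand hy
  have hT := bicontactSummand_le_total (E₁' := E₁') (E₂' := E₂') (L := L) (ℝ ∙ v₁) (ℝ ∙ v₂)
  have h1 := dorfman_secNear_of_mem_sgfNormalizer h.crf.1 (h.gen_mem_sgfNormalizer hu) (hx.mono hT)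
  rw [map_sub, LinearMap.sub_apply, pairing_dorfman_cyclic hx.1 hy.1 (hB.near hu p) (hpair hx)
    (hpair hy), pairing_dorfman_cyclic hJx.1 hJy.1 (hB.near hu p) (hpair hJx) (hpair hJy), h1.2]
  -- The bracket with `u` commutes with `J`, which is orthogonal.
  exact sub_eq_zero.2 (h.crf.1.orth p _ (hT p hy.mem) _ h1.1.mem).symm

/-- The identity required of `J₁` is inherited from `J`. The content is that `[x, y] - [J x, J y]`,
a section of `E''`, lies in `E₁`, which is tested by its pairings with `E₂`, `E₁'` and `E₂'`. -/
lemma isCRF_summand (had : IsAdaptable E₁' E₂' J L (ℝ ∙ v₁) (ℝ ∙ v₂))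
    (hJ₁ : IsRestriction (bicontactSummand L (ℝ ∙ v₁) (ℝ ∙ v₂)) J₁ J) :
    IsCRF (bicontactSummand L (ℝ ∙ v₁) (ℝ ∙ v₂)) J₁ := by
  refine isCRF_iff.2 ⟨h.isSGF_summand hJ₁, fun x hx y hy => ?_⟩
  have hT := bicontactSummand_le_total (E₁' := E₁') (E₂' := E₂') (L := L) (ℝ ∙ v₁) (ℝ ∙ v₂)
  have hmono : ∀ x ∈ Sections (bicontactSummand L (ℝ ∙ v₁) (ℝ ∙ v₂)),
      x ∈ Sections (bicontactTotal E₁' E₂' L (ℝ ∙ v₁) (ℝ ∙ v₂)) := fun x hx =>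
    mem_sections_iff_secNear.2 fun p => (mem_sections_iff_secNear.1 hx p).mono hT
  obtain ⟨h1, h2⟩ := (isCRF_iff.1 h.crf).2 x (hmono x hx) y (hmono y hy)
  rw [hJ₁.act_eq hx, hJ₁.act_eq hy]
  have h3 : dorfman x y - dorfman (J.act x) (J.act y) ∈
      Sections (bicontactSummand L (ℝ ∙ v₁) (ℝ ∙ v₂)) := by
    refine mem_sections_iff.2 fun p => ⟨genNear_of_mem_sections h1 p, ?_⟩
    have hx' := mem_sections_iff_secNear.1 hx p
    have hy' := mem_sections_iff_secNear.1 hy p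
    exact h.mem_summand_of_total (mem_sections_iff.1 h1 p).2
      (fun b hb => h.pairing_dorfman_summand had hx' hy' hb)
      fun u hu => h.pairing_dorfman_gen hu hx' hy'
  exact ⟨h3, by rw [hJ₁.act_eq h3, h2]⟩

lemma normalizes_summand (hJ₁ : IsRestriction (bicontactSummand L (ℝ ∙ v₁) (ℝ ∙ v₂)) J₁ J)
    (hu : u ∈ (ℝ ∙ v₁) ⊔ (ℝ ∙ w₁)) :
    u ∈ sgfNormalizer (bicontactSummand L (ℝ ∙ v₁) (ℝ ∙ v₂)) J₁ ∧ u ∈ normalizer E₁' := by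
  have hB := h.bicontact
  have hv := hB.gens₁.near_left
  have hw := hB.gens₁.near_right
  have hus : u ∈ Sections E₁' := hB.framing₁.2.2.2.1 hu
  have hn := (mem_sgfNormalizer h.crf.1).1 (h.normalizes hu)
  obtain ⟨a, ha, b, hb, rfl⟩ := Submodule.mem_sup.1 hu
  obtain ⟨s, rfl⟩ := Submodule.mem_span_singleton.1 ha
  obtain ⟨t, rfl⟩ := Submodule.mem_span_singleton.1 hb
  have key : ∀ {A : FibreFamily F M} {x : GenField F M}, x ∈ Sections A →
      dorfman v₁ x ∈ Sections A → dorfman w₁ x ∈ Sections A →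
      dorfman (s • v₁ + t • w₁) x ∈ Sections A := by
    intro A x hx h1 h2
    rw [dorfman_smul_add_smul s t hv hw (genNear_of_mem_sections hx)]
    exact add_mem_sections (smul_mem_sections s h1) (smul_mem_sections t h2)
  constructor
  · refine (mem_sgfNormalizer (h.isSGF_summand hJ₁)).2 ⟨hn.1, fun x hx => ?_⟩
    have hx' := mem_sections_iff_secNear.1 hx
    have h1 := key hx (mem_sections_iff_secNear.2 fun p =>
        hB.dorfman_secNear_summand (Or.inl rfl) (hx' p))
      (mem_sections_iff_secNear.2 fun p =>
        hB.dorfman_secNear_summand (Or.inr (Or.inr (Or.inl rfl))) (hx' p))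
    refine ⟨h1, ?_⟩
    rw [hJ₁.act_eq hx, hJ₁.act_eq h1]
    exact (hn.2 x (mem_sections_iff_secNear.2 fun p =>
      (hx' p).mono (bicontactSummand_le_total _ _))).2
  · refine ⟨mem_sections_iff.2 fun q => ⟨hn.1 q, trivial⟩, fun x hx => ?_⟩
    have hx' := mem_sections_iff_secNear.1 hx
    have h0 : ∀ {u v}, (u = v₁ ∨ u = v₂ ∨ u = w₁ ∨ u = w₂) → (v = v₁ ∨ v = v₂ ∨ v = w₁ ∨ v = w₂) →
        ∀ p : M, ∀ᶠ q in 𝓝 p, dorfman u v q = 0 := fun hu hv p => by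
      rw [hB.commute hu hv]
      exact Eventually.of_forall fun _ => rfl
    have h1 : ∀ {u}, (u = v₁ ∨ u = v₂ ∨ u = w₁ ∨ u = w₂) → dorfman u x ∈ Sections E₁' := fun hu =>
      mem_sections_iff_secNear.2 fun p => hB.gens₁.dorfman_secNear (hB.near hu p)
        (h0 hu (Or.inl rfl) p) (h0 hu (Or.inr (Or.inr (Or.inl rfl))) p) (hx' p)
    exact key hx (h1 (Or.inl rfl)) (h1 (Or.inr (Or.inr (Or.inl rfl))))

/-- The restriction of an adaptable Hermitian bicontact datum to the first summand. -/
theorem isNormalContactDatum (had : IsAdaptable E₁' E₂' J L (ℝ ∙ v₁) (ℝ ∙ v₂))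
    (hJ₁ : IsRestriction (bicontactSummand L (ℝ ∙ v₁) (ℝ ∙ v₂)) J₁ J) :
    IsNormalContactDatum (bicontactSummand L (ℝ ∙ v₁) (ℝ ∙ v₂)) E₁' J₁ (kerBundle (ℝ ∙ v₂) L)
      (ℝ ∙ v₁) (ℝ ∙ w₁) where
  contact := h.bicontact.isContactDatum
  direct _ hx hx' := h.bicontact.direct_summand hx hx'
  sgf := h.isSGF_summand hJ₁
  preserves p a ha := by
    rw [hJ₁ p a (kerBundle_le_bicontactSummand _ _ p ha)]
    exact Submodule.mem_sup_left (h.act_mem_ker ha)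
  normal :=
    { crf := h.isCRF_summand had hJ₁
      split' := ⟨1, h.bicontact.split₁⟩
      orthogonal := h.bicontact.orth_gens
      framing := h.bicontact.framing₁.2.2.2
      normalizes := fun _ hu => h.normalizes_summand hJ₁ hu }

end IsHermitianBicontactDatum

end Adapted

end GenGeom

end

theorem mainTheorem3 {F : Type*} [NormedAddCommGroup F] [NormedSpace ℝ F] [FiniteDimensional ℝ F]
    {M : Type*} [TopologicalSpace M] [ChartedSpace F M] [IsManifold 𝓘(ℝ, F) ∞ M]
    [T2Space M] [SecondCountableTopology M]
    (E E₁' E₂' L : GenGeom.FibreFamily F M) (J J₁ J₂ Ψ : GenGeom.EndFamily F M)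
    (V₁ W₁ V₂ W₂ : Submodule ℝ (GenGeom.GenField F M))
    (hJ : GenGeom.IsHermitianBicontactDatum E E₁' E₂' J L V₁ W₁ V₂ W₂)
    (hadapt : GenGeom.IsAdaptable E₁' E₂' J L V₁ V₂)
    (hJ₁ : GenGeom.IsRestriction (GenGeom.bicontactSummand L V₁ V₂) J₁ J)
    (hJ₂ : GenGeom.IsRestriction (GenGeom.bicontactSummand L V₂ V₁) J₂ J)
    (hΨ : GenGeom.IsRestriction (E₁' ⊔ E₂') Ψ J) :
    GenGeom.IsSGF (GenGeom.bicontactSummand L V₁ V₂) J₁ ∧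
    GenGeom.IsSGF (GenGeom.bicontactSummand L V₂ V₁) J₂ ∧
    GenGeom.IsSGF (E₁' ⊔ E₂') Ψ ∧
    GenGeom.IsNormalContactDatum (GenGeom.bicontactSummand L V₁ V₂) E₁' J₁
      (GenGeom.kerBundle V₂ L) V₁ W₁ ∧
    GenGeom.IsNormalContactDatum (GenGeom.bicontactSummand L V₂ V₁) E₂' J₂
      (GenGeom.kerBundle V₁ L) V₂ W₂ := by
  obtain ⟨v₁, w₁, rfl, rfl⟩ := hJ.bicontact.framing₁.exists_generators hJ.bicontact.split₁
  obtain ⟨v₂, w₂, rfl, rfl⟩ := hJ.bicontact.framing₂.exists_generators hJ.bicontact.split₂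
  -- All hypotheses are stable under exchanging the indices, so the second summand needs no separate
  -- argument.
  have hadapt' := hadapt.swap hJ.bicontact.contact.isotropic
  exact ⟨hJ.isSGF_summand hJ₁, hJ.swap.isSGF_summand hJ₂, hJ.isSGF_gens hΨ,
    hJ.isNormalContactDatum hadapt hJ₁, hJ.swap.isNormalContactDatum hadapt' hJ₂⟩
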